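/- Notation. Let $\mathbb T=\{|z|=1\}$ and $[f]_n=f_n=\int_{\mathbb T}z^{-n}f(z)\frac{dz}{2\pi i z}$ for $n\in\mathbb Z$. For $N\ge 1$ let $T_N(\phi)=(\phi_{j-k})_{0\le j,k\le N-1}$, let $T(\phi)$ be the bounded operator on $\ell^2(\{0,1,2,\dots\})$ with matrix $(\phi_{j-k})_{j,k\ge 0}$, and let $e_0=(1,0,0,\dots)^T$. Put $$F_N[\phi;\psi]=e_0^T\,T_N(\phi)^{-1}T_N(\psi)\,e_0,\qquad F[\phi;\psi]=e_0^T\,T(\phi)^{-1}T(\psi)\,e_0,$$ $$G[\phi]=\exp([\log\phi]_0),\qquad E[\phi]=\exp\Big(\sum_{n\ge1}n[\log\phi]_n[\log\phi]_{-n}\Big),$$ where $\log\phi$ is a continuous logarithm of $\phi$ on $\mathbb T$, and for $N>1$ let the bordered Toeplitz determinant be $$D^B_N[\phi;\psi]=\det\begin{pmatrix}\phi_0&\cdots&\phi_{N-2}&\psi_{N-1}\\ \phi_{-1}&\cdots&\phi_{N-3}&\psi_{N-2}\\ \vdots&&\vdots&\vdots\\ \phi_{1-N}&\cdots&\phi_{-1}&\psi_0\end{pmatrix}.$$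 Corollary 3.7. Let $0\le a_i<1<b_i\le\infty$ for $i=1,2$ (with $\infty^{-1}=0$). Let $\phi$ be analytic and nonvanishing on the annulus $a_1<|z|<b_1$ with winding number zero along $\mathbb T$, and let $\psi$ be analytic on the annulus $a_2<|z|<b_2$. Then $T(\phi)$ and $T(\psi)$ are well-defined bounded operators, $T(\phi)$ is invertible, $\phi$ has a continuous logarithm on $\mathbb T$, the series in $E[\phi]$ converges absolutely, and $T_N(\phi)$ is invertible for all sufficiently large $N$. Moreover, for every $\kappa>a_1\max\{b_1^{-1},b_2^{-1}\}$, as $N\to\infty$, $$F_N[\phi;\psi]=F[\phi;\psi]+O(\kappa^N)$$ and $$D^B_N[\phi;\psi]=G[\phi]^N E[\phi]\,\big(F[\phi;\psi]+O(\kappa^N)\big).$$ -/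

import Mathlib

open Filter Asymptotics
open scoped Real NNReal ENNReal Matrix

noncomputable section

/-- The open annulus `a < |z| < b` in `ℂ`, with `0 ≤ a` and `b ≤ ∞`. -/
def annulus (a b : ℝ≥0∞) : Set ℂ := {z | a < ‖z‖ₑ ∧ ‖z‖ₑ < b}

/-- The `n`-th Fourier coefficient `[f]_n = ∫_𝕋 z⁻ⁿ f(z) dz / (2πi z)` of a function on the
unit circle. -/
def fourierCoef (f : ℂ → ℂ) (n : ℤ) : ℂ :=
  (2 * π * Complex.I)⁻¹ * ∮ z in C(0, 1), z ^ (-n) * f z / z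

/-- The restriction of `f` to the unit circle is continuous and nonvanishing with winding
number `n` around the origin: `f (e^{iθ})` has a continuous logarithm along `0 ≤ θ ≤ 2π`, whose
increment is `2πi n`. -/
def HasWindingNumber (f : ℂ → ℂ) (n : ℤ) : Prop :=
  ∃ g : ℝ → ℂ, Continuous g ∧
    (∀ θ : ℝ, Complex.exp (g θ) = f (Complex.exp (θ * Complex.I))) ∧
    g (2 * π) - g 0 = 2 * π * Complex.I * n

/-- `l` is a continuous logarithm of `f` on the unit circle. -/
def IsCircleLog (f l : ℂ → ℂ) : Prop :=
  ContinuousOn l (Metric.sphere 0 1) ∧ ∀ z ∈ Metric.sphere (0 : ℂ) 1, Complex.exp (l z) = f z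

/-- The continuous logarithm `log f` on the unit circle, when there is one; it is determined on
the circle up to an additive constant in `2πi ℤ`, which affects neither `szegoG` nor `szegoE`. -/
def circleLog (f : ℂ → ℂ) : ℂ → ℂ := Classical.epsilon (IsCircleLog f)

/-- `G[φ] = exp [log φ]_0`. -/
def szegoG (φ : ℂ → ℂ) : ℂ := Complex.exp (fourierCoef (circleLog φ) 0)

/-- The terms `n [log φ]_n [log φ]_{-n}`; the term with `n = 0` vanishes. -/
def szegoTerm (φ : ℂ → ℂ) (n : ℕ) : ℂ :=
  n * fourierCoef (circleLog φ) n * fourierCoef (circleLog φ) (-n)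

/-- `E[φ] = exp (∑_{n ≥ 1} n [log φ]_n [log φ]_{-n})`. -/
def szegoE (φ : ℂ → ℂ) : ℂ := Complex.exp (∑' n : ℕ, szegoTerm φ n)

/-- The `N × N` Toeplitz matrix `T_N(φ) = (φ_{j-k})`. -/
def toeplitzMatrix (φ : ℂ → ℂ) (N : ℕ) : Matrix (Fin N) (Fin N) ℂ :=
  Matrix.of fun j k => fourierCoef φ ((j : ℤ) - (k : ℤ))

/-- The column vector `e₀ = (1, 0, …, 0)ᵀ` in `ℂ^N`. -/
def finE0 (N : ℕ) : Fin N → ℂ := fun i => if (i : ℕ) = 0 then 1 else 0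

/-- `F_N[φ;ψ] = e₀ᵀ T_N(φ)⁻¹ T_N(ψ) e₀`. -/
def finF (φ ψ : ℂ → ℂ) (N : ℕ) : ℂ :=
  finE0 N ⬝ᵥ ((toeplitzMatrix φ N)⁻¹ *ᵥ (toeplitzMatrix ψ N *ᵥ finE0 N))

/-- The bordered Toeplitz determinant `D^B_N[φ;ψ]`: for `0 ≤ i ≤ N - 1`, row `i` of the matrix is
`(φ_{-i}, φ_{1-i}, …, φ_{N-2-i}, ψ_{N-1-i})`. -/
def borderedToeplitzDet (φ ψ : ℂ → ℂ) (N : ℕ) : ℂ :=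
  Matrix.det (Matrix.of fun i j : Fin N =>
    if (j : ℕ) + 1 = N then fourierCoef ψ ((N : ℤ) - 1 - (i : ℤ))
    else fourierCoef φ ((j : ℤ) - (i : ℤ)))

/-- The Hilbert space `ℓ²` of square-summable sequences indexed by `0, 1, 2, …`. -/
abbrev EllTwo : Type := lp (fun _ : ℕ => ℂ) 2

/-- The `k`-th standard basis vector of `ℓ²`. -/
def ellE (k : ℕ) : EllTwo := lp.single 2 k (1 : ℂ)

/-- The bounded operator `A` on `ℓ²` has the matrix `(φ_{j-k})`, `j, k ≥ 0`. -/
def IsToeplitzOp (φ : ℂ → ℂ) (A : EllTwo →L[ℂ] EllTwo) : Prop :=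
  ∀ j k : ℕ, A (ellE k) j = fourierCoef φ ((j : ℤ) - (k : ℤ))

/-- The Toeplitz operator `T(φ)`: the bounded operator on `ℓ²` with the matrix `(φ_{j-k})`
(at most one bounded operator has a given matrix). -/
def toeplitzOp (φ : ℂ → ℂ) : EllTwo →L[ℂ] EllTwo := Classical.epsilon (IsToeplitzOp φ)

/-- `F[φ;ψ] = e₀ᵀ T(φ)⁻¹ T(ψ) e₀`. -/
def limF (φ ψ : ℂ → ℂ) : ℂ := Ring.inverse (toeplitzOp φ) (toeplitzOp ψ (ellE 0)) 0

end

open scoped Topology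

noncomputable section

local notation "𝕊" => Metric.sphere (0 : ℂ) 1

/-! ### Fourier coefficients on the unit circle -/


/-! Write `L = log φ` as its mean plus a part with positive and a part with negative exponents, and
let `p` and `q` be the Toeplitz operators of these two parts. Exponentiating gives the Wiener–Hopf
factorization `T(φ) = G e^q e^p`, upper triangular times lower triangular
(`HasLaurentDecay.toep_eq`). Truncation respects products in the opposite order, so one rewrites
`e^q e^p = e^p A e^q` with the multiplicative commutator `A = e^{-p} e^q e^p e^{-q}`. Then `T_N(φ) =
G (e^p)_N A_N (e^q)_N`, the triangular corners are unipotent, and everything reduces to `A_N`.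

The operator `A` is the identity plus something concentrated in the upper left corner. For `D =
diag(w^j)` and `E = diag(x^k)`, with `x` above the inner radius and `1/w` below the outer radius of
the annulus, the additive commutator is `[q,p] = D M E` (`exists_toep_commutator`). Toeplitz
operators with decaying coefficients can be moved across `D` and `E`, so `A = 1 + D M' E`
(`exists_expCommutator`).

For the rate of `F_N`, the first row of `e^{-q}` factors through `E`, and `e^{-p} T(ψ) e₀` lies in
the range of `D`. Only `E A_N⁻¹ D` matters, and the resolvent identity expresses its error through
`E (1 - P_N) D`, of norm at most `(xw)^N` (`exists_finiteSection_bound`,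
`IsLocalizedPair.exists_finiteSection_rate`). The two decay rates multiply, and `xw` may be taken
arbitrarily close to `a₁ max{1/b₁, 1/b₂}`.

For the determinants, let `A_s` be the commutator with `sp` in place of `p`. The functions `det
(A_s)_N` converge locally uniformly in `s` to an entire function that is multiplicative in `s`,
hence to `e^{cs}`, where `c` is the limit of the traces of the corners of `e^q p e^{-q} - p`. This
limit is Szegő's sum (`HasLaurentDecay.tendsto_trace_corner`), so `d_N = det T_N(φ) / G^N` tends to
`E[φ]`. The rate comes from `d_N / d_{N+1} = G (T_{N+1}(φ)⁻¹)_{00}`, to which the finite section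
estimate applies; the limit of the ratios must be `1` because `E[φ] ≠ 0`
(`exists_norm_sub_le_of_ratio`). Finally Cramer's rule gives `D^B_N = det T_N(φ) · F_N`
(`borderedToeplitzDet_eq`). -/

/-- The open annulus `r < |z| < R` with real radii. -/
def realAnnulus (r R : ℝ) : Set ℂ := {z | r < ‖z‖ ∧ ‖z‖ < R}

lemma isOpen_realAnnulus (r R : ℝ) : IsOpen (realAnnulus r R) :=
  (isOpen_lt continuous_const continuous_norm).inter (isOpen_lt continuous_norm continuous_const)

lemma ne_zero_of_mem_unitSphere {z : ℂ} (hz : z ∈ 𝕊) : z ≠ 0 := by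
  rintro rfl
  simp at hz

lemma sphere_subset_realAnnulus {r R t : ℝ} (hr : r < t) (hR : t < R) :
    Metric.sphere (0 : ℂ) t ⊆ realAnnulus r R := by
  intro z hz
  rw [mem_sphere_zero_iff_norm] at hz
  exact ⟨hz ▸ hr, hz ▸ hR⟩

lemma continuousOn_zpow_sphere (n : ℤ) : ContinuousOn (fun z : ℂ => z ^ n) 𝕊 :=
  fun _ hz => (continuousAt_zpow₀ _ n (Or.inl (ne_zero_of_mem_unitSphere hz))).continuousWithinAt

lemma norm_zpow_of_mem_sphere {z : ℂ} (hz : z ∈ 𝕊) (n : ℤ) : ‖z ^ n‖ = 1 := by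
  rw [norm_zpow, mem_sphere_zero_iff_norm.1 hz, one_zpow]

lemma fourierCoef_congr {f g : ℂ → ℂ} (h : Set.EqOn f g 𝕊) (n : ℤ) :
    fourierCoef f n = fourierCoef g n := by
  unfold fourierCoef
  congr 1
  exact circleIntegral.integral_congr zero_le_one fun z hz => by simp only [h hz]

lemma fourierCoef_const_mul (c : ℂ) (f : ℂ → ℂ) (n : ℤ) :
    fourierCoef (fun z => c * f z) n = c * fourierCoef f n := by
  unfold fourierCoef
  have : ∀ z : ℂ, z ^ (-n) * (c * f z) / z = c * (z ^ (-n) * f z / z) := fun z => by ring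
  simp only [this, circleIntegral.integral_const_mul]
  ring

lemma continuousOn_fourierIntegrand {f : ℂ → ℂ} (hf : ContinuousOn f 𝕊) (n : ℤ) :
    ContinuousOn (fun z => z ^ (-n) * f z / z) 𝕊 :=
  ((continuousOn_zpow_sphere _).mul hf).div continuousOn_id fun _ hz => ne_zero_of_mem_unitSphere hz

lemma fourierCoef_sum {ι : Type*} (s : Finset ι) {F : ι → ℂ → ℂ}
    (hF : ∀ i, ContinuousOn (F i) 𝕊) (n : ℤ) :
    fourierCoef (fun z => ∑ i ∈ s, F i z) n = ∑ i ∈ s, fourierCoef (F i) n := by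
  unfold fourierCoef
  simp only [Finset.mul_sum, Finset.sum_div]
  rw [circleIntegral.integral_fun_sum fun i _ =>
    (continuousOn_fourierIntegrand (hF i) n).circleIntegrable zero_le_one, Finset.mul_sum]

/-- Fourier coefficients of the sum of a series dominated on the circle. -/
lemma hasSum_fourierCoef {ι : Type*} [Countable ι] {F : ι → ℂ → ℂ} {f : ℂ → ℂ} {u : ι → ℝ}
    (hF : ∀ i, ContinuousOn (F i) 𝕊) (hu : Summable u) (hFu : ∀ i, ∀ z ∈ 𝕊, ‖F i z‖ ≤ u i)
    (hf : ∀ z ∈ 𝕊, HasSum (fun i => F i z) (f z)) (n : ℤ) :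
    HasSum (fun i => fourierCoef (F i) n) (fourierCoef f n) := by
  have h1 : TendstoUniformlyOn (fun (s : Finset ι) z => ∑ i ∈ s, z ^ (-n) * F i z / z)
      (fun z => ∑' i, z ^ (-n) * F i z / z) atTop 𝕊 := by
    refine tendstoUniformlyOn_tsum hu fun i z hz => ?_
    rw [norm_div, norm_mul, norm_zpow_of_mem_sphere hz, mem_sphere_zero_iff_norm.1 hz, one_mul,
      div_one]
    exact hFu i z hz
  have h2 := h1.tendsto_circleIntegral_of_continuousOn zero_le_one (Eventually.of_forall fun s =>
    continuousOn_finsetSum s fun i _ => continuousOn_fourierIntegrand (hF i) n)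
  have h3 := h2.const_mul (2 * π * Complex.I)⁻¹
  have h4 : (∮ z in C(0, 1), ∑' i, z ^ (-n) * F i z / z) = ∮ z in C(0, 1), z ^ (-n) * f z / z :=
    circleIntegral.integral_congr zero_le_one fun z hz =>
      (((hf z hz).mul_left _).div_const _).tsum_eq
  rw [h4] at h3
  refine h3.congr fun s => ?_
  rw [← fourierCoef_sum s hF, fourierCoef]
  simp only [Finset.mul_sum, Finset.sum_div]

lemma fourierCoef_zpow (k n : ℤ) : fourierCoef (fun z => z ^ k) n = if k = n then 1 else 0 := by
  unfold fourierCoef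
  have h : (∮ z in C(0, 1), z ^ (-n) * z ^ k / z) = ∮ z in C(0, 1), (z - 0) ^ (k - n - 1) := by
    refine circleIntegral.integral_congr zero_le_one fun z hz => ?_
    have hz0 := ne_zero_of_mem_unitSphere hz
    simp only [sub_zero]
    rw [zpow_sub_one₀ hz0, ← zpow_add₀ hz0, div_eq_mul_inv]
    congr 2
    ring
  rw [h]
  split_ifs with hkn
  · subst hkn
    have : ∀ z : ℂ, (z - 0) ^ (k - k - 1) = (z - 0)⁻¹ := fun z => by
      rw [sub_self, zero_sub, zpow_neg_one]
    simp only [this]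
    rw [circleIntegral.integral_sub_center_inv _ one_ne_zero]
    exact inv_mul_cancel₀ (by simp [Real.pi_ne_zero])
  · rw [circleIntegral.integral_sub_zpow_of_ne (by omega), mul_zero]

lemma fourierCoef_one (n : ℤ) : fourierCoef (fun _ => 1) n = if n = 0 then 1 else 0 := by
  simpa [eq_comm] using fourierCoef_zpow 0 n

/-- `[z f']_n = n [f]_n`. -/
lemma fourierCoef_mul_deriv {f f' : ℂ → ℂ} (hf' : ContinuousOn f' 𝕊)
    (h : ∀ z ∈ 𝕊, HasDerivWithinAt f (f' z) 𝕊 z) (n : ℤ) :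
    fourierCoef (fun z => z * f' z) n = n * fourierCoef f n := by
  have hf : ContinuousOn f 𝕊 := fun z hz => (h z hz).continuousWithinAt
  have h0 : (∮ z in C(0, 1), (z ^ (-n) * (z * f' z) / z - n * (z ^ (-n) * f z / z))) = 0 := by
    refine circleIntegral.integral_eq_zero_of_hasDerivWithinAt (f := fun z => z ^ (-n) * f z)
      zero_le_one fun z hz => ?_
    have hz0 := ne_zero_of_mem_unitSphere hz
    have := ((hasDerivAt_zpow (-n) z (Or.inl hz0)).hasDerivWithinAt (s := 𝕊)).mul (h z hz)
    refine this.congr_deriv ?_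
    rw [zpow_sub_one₀ hz0]
    field_simp
    push_cast
    ring
  have hn : ContinuousOn (fun z => n * (z ^ (-n) * f z / z)) 𝕊 :=
    continuousOn_const.mul (continuousOn_fourierIntegrand hf n)
  rw [circleIntegral.integral_sub
    ((continuousOn_fourierIntegrand (f := fun z => z * f' z) (continuousOn_id.mul hf') n).circleIntegrable zero_le_one)
    (hn.circleIntegrable zero_le_one),
    circleIntegral.integral_const_mul, sub_eq_zero] at h0
  unfold fourierCoef
  rw [h0]
  ring

/-- The contour defining a Fourier coefficient can be moved inside an annulus of analyticity. -/
lemma fourierCoef_eq_circleIntegral {f : ℂ → ℂ} {r R t : ℝ} (hr : 0 ≤ r) (hr1 : r < 1)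
    (hR1 : 1 < R) (hf : DifferentiableOn ℂ f (realAnnulus r R)) (hrt : r < t) (htR : t < R)
    (n : ℤ) :
    fourierCoef f n = (2 * π * Complex.I)⁻¹ • ∮ z in C(0, t), z ^ (-n) * f z / z := by
  have key : ∀ s u : ℝ, r < s → s ≤ u → u < R →
      (∮ z in C(0, u), z ^ (-n) * f z / z) = ∮ z in C(0, s), z ^ (-n) * f z / z := by
    intro s u hs hsu hu
    have hd : DifferentiableOn ℂ (fun z => z ^ (-n) * f z) (realAnnulus r R) := by
      refine DifferentiableOn.mul (fun z hz => ?_) hf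
      have : z ≠ 0 := norm_pos_iff.1 (hr.trans_lt hz.1)
      exact (differentiableAt_zpow.2 (Or.inl this)).differentiableWithinAt
    have := Complex.circleIntegral_sub_center_inv_smul_eq_of_differentiable_on_annulus_off_countable
      (c := 0) (hr.trans_lt hs) hsu (f := fun z => z ^ (-n) * f z) Set.countable_empty
      (hd.continuousOn.mono fun z hz => by
        simp only [Set.mem_sdiff, mem_closedBall_zero_iff, mem_ball_zero_iff, not_lt] at hz
        exact ⟨hs.trans_le hz.2, hz.1.trans_lt hu⟩)
      (fun z hz => by
        simp only [Set.mem_sdiff, mem_closedBall_zero_iff, mem_ball_zero_iff, not_le] at hz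
        exact hd.differentiableAt ((isOpen_realAnnulus r R).mem_nhds
          ⟨hs.trans hz.1.2, hz.1.1.trans hu⟩))
    simpa [div_eq_inv_mul] using this
  rw [fourierCoef, smul_eq_mul]
  rcases le_total t 1 with h | h
  · rw [key t 1 hrt h hR1]
  · rw [key 1 t hr1 h htR]

/-- Cauchy's estimate for Fourier coefficients. -/
lemma exists_norm_fourierCoef_le {f : ℂ → ℂ} {r R t : ℝ} (hr : 0 ≤ r) (hr1 : r < 1)
    (hR1 : 1 < R) (hf : DifferentiableOn ℂ f (realAnnulus r R)) (hrt : r < t) (htR : t < R) :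
    ∃ C, ∀ n : ℤ, ‖fourierCoef f n‖ ≤ C * t ^ (-n) := by
  have ht : 0 < t := hr.trans_lt hrt
  obtain ⟨C, hC⟩ := (isCompact_sphere (0 : ℂ) t).exists_bound_of_continuousOn
    (hf.continuousOn.mono (sphere_subset_realAnnulus hrt htR))
  refine ⟨C, fun n => ?_⟩
  rw [fourierCoef_eq_circleIntegral hr hr1 hR1 hf hrt htR]
  have hz' : ∀ z ∈ Metric.sphere (0 : ℂ) t, ‖z ^ (-n) * f z / z‖ ≤ t ^ (-n) * C / t := by
    intro z hz
    rw [norm_div, norm_mul, norm_zpow, mem_sphere_zero_iff_norm.1 hz]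
    gcongr
    exact hC z hz
  refine (circleIntegral.norm_two_pi_i_inv_smul_integral_le_of_norm_le_const ht.le hz').trans_eq ?_
  field_simp

/-- Weighted absolute summability of the Fourier coefficients of an analytic function. -/
lemma summable_norm_fourierCoef_mul_zpow {f : ℂ → ℂ} {r R t : ℝ} (hr : 0 ≤ r) (hr1 : r < 1)
    (hR1 : 1 < R) (hf : DifferentiableOn ℂ f (realAnnulus r R)) (hrt : r < t) (htR : t < R) :
    Summable fun n : ℤ => ‖fourierCoef f n‖ * t ^ n := by
  have ht : 0 < t := hr.trans_lt hrt
  obtain ⟨u, htu, huR⟩ := exists_between htR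
  obtain ⟨s, hrs, hst⟩ := exists_between hrt
  have hs : 0 < s := hr.trans_lt hrs
  have hu : 0 < u := ht.trans htu
  obtain ⟨C, hC⟩ := exists_norm_fourierCoef_le hr hr1 hR1 hf (hrt.trans htu) huR
  obtain ⟨C', hC'⟩ := exists_norm_fourierCoef_le hr hr1 hR1 hf hrs (hst.trans htR)
  -- Cauchy's estimate is used on a circle larger than `t` for positive exponents and on a smaller
  -- one for negative exponents, so both halves are geometric.
  refine Summable.of_nat_of_neg ?_ ?_
  · refine Summable.of_nonneg_of_le (fun n => by positivity) (fun n => ?_)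
      ((summable_geometric_of_lt_one (by positivity) ((div_lt_one hu).2 htu)).mul_left C)
    calc ‖fourierCoef f n‖ * t ^ (n : ℤ) ≤ C * u ^ (-(n : ℤ)) * t ^ (n : ℤ) := by
          gcongr
          exact hC n
      _ = C * (t / u) ^ n := by
          rw [zpow_neg, zpow_natCast, zpow_natCast, div_pow]
          ring
  · refine Summable.of_nonneg_of_le (fun n => by positivity) (fun n => ?_)
      ((summable_geometric_of_lt_one (by positivity) ((div_lt_one ht).2 hst)).mul_left C')
    calc ‖fourierCoef f (-n)‖ * t ^ (-(n : ℤ)) ≤ C' * s ^ (-(-(n : ℤ))) * t ^ (-(n : ℤ)) := by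
          gcongr
          exact hC' _
      _ = C' * (s / t) ^ n := by
          rw [zpow_neg t, neg_neg, zpow_natCast, zpow_natCast, div_pow]
          ring

lemma summable_norm_fourierCoef {f : ℂ → ℂ} {r R : ℝ} (hr : 0 ≤ r) (hr1 : r < 1)
    (hR1 : 1 < R) (hf : DifferentiableOn ℂ f (realAnnulus r R)) :
    Summable fun n : ℤ => ‖fourierCoef f n‖ := by
  simpa using summable_norm_fourierCoef_mul_zpow hr hr1 hR1 hf hr1 hR1

/-- An absolutely convergent Fourier series sums to the function. -/
lemma hasSum_fourierCoef_mul_zpow {f : ℂ → ℂ} (hf : ContinuousOn f 𝕊)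
    (hs : Summable fun n : ℤ => ‖fourierCoef f n‖) {z : ℂ} (hz : z ∈ 𝕊) :
    HasSum (fun n : ℤ => fourierCoef f n * z ^ n) (f z) := by
  have : Fact (0 < 2 * π) := ⟨Real.two_pi_pos⟩
  have hsph : ∀ x : Circle, (x : ℂ) ∈ 𝕊 := fun x => by
    rw [mem_sphere_zero_iff_norm, Circle.norm_coe]
  let F : C(AddCircle (2 * π), ℂ) :=
    ⟨fun x => f (AddCircle.toCircle x), hf.comp_continuous
      (continuous_subtype_val.comp AddCircle.continuous_toCircle) fun x => hsph _⟩
  have hval : ∀ θ : ℝ, ((AddCircle.toCircle (θ : AddCircle (2 * π)) : Circle) : ℂ)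
      = circleMap 0 1 θ := fun θ => by
    rw [AddCircle.toCircle_apply_mk, div_self Real.two_pi_pos.ne', one_mul, Circle.coe_exp]
    simp [circleMap]
  have hcoef : ∀ n : ℤ, fourierCoeff F n = fourierCoef f n := by
    intro n
    rw [fourierCoeff_eq_intervalIntegral _ n 0, zero_add, fourierCoef, circleIntegral]
    have h1 : ∀ θ : ℝ, deriv (circleMap 0 1) θ • (circleMap 0 1 θ ^ (-n) *
        f (circleMap 0 1 θ) / circleMap 0 1 θ) =
        Complex.I * (@fourier (2 * π) (-n) (θ : AddCircle (2 * π)) • F θ) := by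
      intro θ
      have h0 : circleMap 0 1 θ ≠ 0 := circleMap_ne_center one_ne_zero
      rw [deriv_circleMap, fourier_apply, AddCircle.toCircle_zsmul]
      simp only [F, ContinuousMap.coe_mk, Circle.coe_zpow, hval, smul_eq_mul]
      field_simp
    simp only [h1]
    rw [intervalIntegral.integral_const_mul, Complex.real_smul]
    push_cast
    field_simp
  have hsum : Summable (fourierCoeff F) := by
    refine Summable.of_norm ?_
    simpa only [hcoef] using hs
  obtain ⟨θ, rfl⟩ : ∃ θ : ℝ, circleMap 0 1 θ = z := by
    have : z ∈ Set.range (circleMap 0 1) := by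
      rw [range_circleMap, abs_one]
      exact hz
    exact this
  have := has_pointwise_sum_fourier_series_of_summable hsum (θ : AddCircle (2 * π))
  simp only [hcoef] at this
  simp only [fourier_apply, AddCircle.toCircle_zsmul, Circle.coe_zpow, hval,
    smul_eq_mul, F, ContinuousMap.coe_mk] at this
  exact this

lemma continuousOn_of_differentiableOn_realAnnulus {f : ℂ → ℂ} {r R : ℝ} (hr1 : r < 1)
    (hR1 : 1 < R) (hf : DifferentiableOn ℂ f (realAnnulus r R)) : ContinuousOn f 𝕊 :=
  hf.continuousOn.mono (sphere_subset_realAnnulus hr1 hR1)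

lemma fourierCoef_zpow_mul (k : ℤ) (g : ℂ → ℂ) (n : ℤ) :
    fourierCoef (fun z => z ^ k * g z) n = fourierCoef g (n - k) := by
  unfold fourierCoef
  congr 1
  refine circleIntegral.integral_congr zero_le_one fun z hz => ?_
  have hz0 := ne_zero_of_mem_unitSphere hz
  beta_reduce
  rw [← mul_assoc, ← zpow_add₀ hz0, show -n + k = -(n - k) by ring]

/-- The Fourier coefficients of a product are given by convolution. -/
lemma hasSum_fourierCoef_mul {f g : ℂ → ℂ} (hf : ContinuousOn f 𝕊)
    (hs : Summable fun n : ℤ => ‖fourierCoef f n‖) (hg : ContinuousOn g 𝕊) (n : ℤ) :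
    HasSum (fun k : ℤ => fourierCoef f k * fourierCoef g (n - k))
      (fourierCoef (fun z => f z * g z) n) := by
  obtain ⟨C, hC⟩ := (isCompact_sphere (0 : ℂ) 1).exists_bound_of_continuousOn hg
  have := hasSum_fourierCoef (F := fun (k : ℤ) z => fourierCoef f k * (z ^ k * g z))
    (f := fun z => f z * g z) (fun k => continuousOn_const.mul ((continuousOn_zpow_sphere k).mul hg))
    (hs.mul_right C) (fun k z hz => by
      rw [norm_mul, norm_mul, norm_zpow_of_mem_sphere hz, one_mul]
      gcongr
      exact hC z hz)
    (fun z hz => by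
      simpa only [mul_assoc] using (hasSum_fourierCoef_mul_zpow hf hs hz).mul_right (g z)) n
  simpa only [fourierCoef_const_mul, fourierCoef_zpow_mul] using this

/-! ### The continuous logarithm on the circle -/

lemma eq_zero_of_exp_eq_one_of_norm_lt {w : ℂ} (hw : Complex.exp w = 1) (h : ‖w‖ < 1) : w = 0 := by
  have him : |w.im| < π :=
    ((Complex.abs_im_le_norm w).trans_lt h).trans (by linarith [Real.pi_gt_three])
  rw [← Complex.log_exp (abs_lt.1 him).1 (abs_lt.1 him).2.le, hw, Complex.log_one]

/-- The difference `g (θ + T) - g θ` is continuous with values in `2πiℤ`, so its zero set is clopen;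
it contains `0`. -/
lemma periodic_of_exp_periodic {g : ℝ → ℂ} (hg : Continuous g) {T : ℝ}
    (hexp : Function.Periodic (fun θ => Complex.exp (g θ)) T) (h0 : g T = g 0) :
    Function.Periodic g T := by
  have hk : Continuous fun θ => g (θ + T) - g θ := by fun_prop
  have hk1 : ∀ θ, Complex.exp (g (θ + T) - g θ) = 1 := fun θ => by
    rw [Complex.exp_sub, div_eq_one_iff_eq (Complex.exp_ne_zero _)]
    exact hexp θ
  have hclopen : IsClopen {θ | g (θ + T) - g θ = 0} := by
    refine ⟨isClosed_eq hk continuous_const, isOpen_iff_mem_nhds.2 fun θ hθ => ?_⟩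
    have h1 : ∀ᶠ t in 𝓝 θ, ‖g (t + T) - g t‖ < 1 := by
      refine (hk.norm.tendsto θ).eventually_lt_const ?_
      rw [show g (θ + T) - g θ = 0 from hθ, norm_zero]
      exact one_pos
    exact h1.mono fun t ht => eq_zero_of_exp_eq_one_of_norm_lt (hk1 t) ht
  have := hclopen.eq_univ ⟨0, by simp [h0]⟩
  intro θ
  exact sub_eq_zero.1 (this.symm ▸ Set.mem_univ θ : θ ∈ {θ | g (θ + T) - g θ = 0})

/-- Zero winding makes the lift `g` periodic, so `g ∘ arg` is a logarithm. It is continuous even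
across the cut of `arg`, because near `z₀` periodicity allows `arg z` to be replaced by `arg (z /
z₀) + arg z₀`. -/
lemma HasWindingNumber.exists_isCircleLog {f : ℂ → ℂ} (hf : HasWindingNumber f 0) :
    ∃ l, IsCircleLog f l := by
  obtain ⟨g, hg, hgf, h0⟩ := hf
  have hper : Function.Periodic g (2 * π) := by
    refine periodic_of_exp_periodic hg (fun θ => ?_) (by simpa [sub_eq_zero] using h0)
    simp only [hgf]
    congr 1
    push_cast
    rw [add_mul, Complex.exp_add, Complex.exp_two_pi_mul_I, mul_one]
  have hlift : ∀ θ : ℝ, ∀ z : ℂ, Complex.exp (θ * Complex.I) = z → g (Complex.arg z) = g θ := by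
    rintro θ z rfl
    have h1 : Complex.exp (Complex.arg (Complex.exp (θ * Complex.I)) * Complex.I)
        = Complex.exp (θ * Complex.I) := by
      have := Complex.norm_mul_exp_arg_mul_I (Complex.exp (θ * Complex.I))
      rwa [Complex.norm_exp_ofReal_mul_I, Complex.ofReal_one, one_mul] at this
    obtain ⟨n, hn⟩ := Complex.exp_eq_exp_iff_exists_int.1 h1
    have h2 : Complex.arg (Complex.exp (θ * Complex.I)) = θ + n * (2 * π) := by
      have h3 : ((Complex.arg (Complex.exp (θ * Complex.I)) : ℝ) : ℂ) * Complex.I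
          = ((θ + n * (2 * π) : ℝ) : ℂ) * Complex.I := by
        rw [hn]; push_cast; ring
      exact_mod_cast mul_right_cancel₀ Complex.I_ne_zero h3
    rw [h2]
    exact (hper.int_mul n) θ
  have harg : ∀ z ∈ 𝕊, Complex.exp (Complex.arg z * Complex.I) = z := fun z hz => by
    have := Complex.norm_mul_exp_arg_mul_I z
    rwa [mem_sphere_zero_iff_norm.1 hz, Complex.ofReal_one, one_mul] at this
  refine ⟨fun z => g (Complex.arg z), fun z₀ hz₀ => ?_, fun z hz => ?_⟩
  · have hz0 := ne_zero_of_mem_unitSphere hz₀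
    have h1 : ContinuousAt (fun z : ℂ => g (Complex.arg (z / z₀) + Complex.arg z₀)) z₀ := by
      refine hg.continuousAt.comp (ContinuousAt.add ?_ continuousAt_const)
      refine ContinuousAt.comp (g := Complex.arg) (f := fun z => z / z₀) ?_ (by fun_prop)
      rw [div_self hz0]
      exact Complex.continuousAt_arg Complex.one_mem_slitPlane
    refine h1.continuousWithinAt.congr (fun z hz => hlift _ _ ?_) (hlift _ _ ?_)
    · have hzz : z / z₀ ∈ 𝕊 := by
        rw [mem_sphere_zero_iff_norm, norm_div, mem_sphere_zero_iff_norm.1 hz,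
          mem_sphere_zero_iff_norm.1 hz₀, div_one]
      push_cast
      rw [add_mul, Complex.exp_add, harg _ hzz, harg _ hz₀, div_mul_cancel₀ _ hz0]
    · rw [div_self hz0, Complex.arg_one, zero_add, harg _ hz₀]
  · rw [hgf, harg z hz]

lemma HasWindingNumber.isCircleLog_circleLog {f : ℂ → ℂ} (hf : HasWindingNumber f 0) :
    IsCircleLog f (circleLog f) :=
  Classical.epsilon_spec hf.exists_isCircleLog

/-- Near `z` on the circle, `l` agrees with `l z + Log (f w / f z)`: both are logarithms of `f`, and
continuity keeps the increment of `l` in the strip where `Log ∘ exp` is the identity. -/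
lemma IsCircleLog.hasDerivWithinAt {f l : ℂ → ℂ} (hl : IsCircleLog f l) {z : ℂ} (hz : z ∈ 𝕊)
    {f' : ℂ} (hf : HasDerivAt f f' z) : HasDerivWithinAt l (f' / f z) 𝕊 z := by
  have hfz : f z ≠ 0 := hl.2 z hz ▸ Complex.exp_ne_zero _
  have h1 : HasDerivAt (fun w => l z + Complex.log (f w / f z)) (f' / f z) z := by
    have := (hf.div_const (f z)).clog (by rw [div_self hfz]; exact Complex.one_mem_slitPlane)
    rw [div_self hfz, div_one] at this
    exact this.const_add _
  refine h1.hasDerivWithinAt.congr_of_eventuallyEq ?_ (by simp [div_self hfz])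
  have h2 : ∀ᶠ w in 𝓝[𝕊] z, ‖l w - l z‖ < 1 := by
    have := ((hl.1 z hz).sub (continuousWithinAt_const (b := l z))).norm
    refine Tendsto.eventually_lt_const ?_ this
    simp
  filter_upwards [h2, self_mem_nhdsWithin] with w hw hwS
  have him : |(l w - l z).im| < π :=
    ((Complex.abs_im_le_norm _).trans_lt hw).trans (by linarith [Real.pi_gt_three])
  rw [← hl.2 w hwS, ← hl.2 z hz, ← Complex.exp_sub,
    Complex.log_exp (abs_lt.1 him).1 (abs_lt.1 him).2.le]
  ring

/-- The Fourier coefficients of the logarithm decay at the rate given by the annulus. -/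
lemma IsCircleLog.summable_norm_fourierCoef {f l : ℂ → ℂ} {r R : ℝ} (hr : 0 ≤ r) (hr1 : r < 1)
    (hR1 : 1 < R) (hf : DifferentiableOn ℂ f (realAnnulus r R))
    (hf0 : ∀ z ∈ realAnnulus r R, f z ≠ 0) (hl : IsCircleLog f l) {t : ℝ} (hrt : r < t)
    (htR : t < R) : Summable fun n : ℤ => ‖fourierCoef l n‖ * t ^ n := by
  have hd : DifferentiableOn ℂ (fun z => deriv f z / f z) (realAnnulus r R) :=
    (hf.deriv (isOpen_realAnnulus r R)).div hf hf0
  have hsub := sphere_subset_realAnnulus hr1 hR1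
  have hcoef : ∀ n : ℤ, fourierCoef (fun z => z * (deriv f z / f z)) n = n * fourierCoef l n :=
    fourierCoef_mul_deriv (hd.continuousOn.mono hsub) fun z hz =>
      hl.hasDerivWithinAt hz (hf.differentiableAt ((isOpen_realAnnulus r R).mem_nhds
        (hsub hz))).hasDerivAt
  have hsum := summable_norm_fourierCoef_mul_zpow hr hr1 hR1 (differentiableOn_id.mul hd) hrt htR
  have ht : 0 < t := hr.trans_lt hrt
  -- The identity `[z f'/f]_n = n [l]_n` says nothing about `[l]_0`, so the comparison is made off
  -- the single index `0`.
  refine Summable.of_norm_bounded_eventually hsum ?_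
  filter_upwards [(Set.finite_singleton (0 : ℤ)).compl_mem_cofinite] with n hn
  have hn1 : (1 : ℝ) ≤ |(n : ℝ)| := by exact_mod_cast Int.one_le_abs hn
  have h3 : fourierCoef (id * fun z => deriv f z / f z) n = n * fourierCoef l n := hcoef n
  rw [h3, norm_mul, norm_mul, norm_norm, norm_zpow, Real.norm_of_nonneg ht.le, Complex.norm_intCast]
  have := norm_nonneg (fourierCoef l n)
  have := zpow_pos ht n
  gcongr
  nlinarith

/-! ### Laurent series -/

/-- The sum of the Laurent series with the given coefficients. -/
def laurentSum (c : ℤ → ℂ) (z : ℂ) : ℂ := ∑' n : ℤ, c n * z ^ n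

/-- On `s < |w| < t` one has `|w|^n ≤ s^n + t^n` for every integer `n`, which dominates both tails
at once. -/
lemma differentiableOn_laurentSum {c : ℤ → ℂ} {r R : ℝ} (hr : 0 ≤ r)
    (hc : ∀ t, r < t → t < R → Summable fun n : ℤ => ‖c n‖ * t ^ n) :
    DifferentiableOn ℂ (laurentSum c) (realAnnulus r R) := by
  intro z hz
  obtain ⟨s, hrs, hsz⟩ := exists_between hz.1
  obtain ⟨t, hzt, htR⟩ := exists_between hz.2
  have hs : 0 < s := hr.trans_lt hrs
  have hsum := (hc s hrs (hsz.trans hz.2)).add (hc t (hz.1.trans hzt) htR)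
  have hd := Complex.differentiableOn_tsum_of_summable_norm (F := fun (n : ℤ) w => c n * w ^ n)
    hsum (fun n => ?_) (isOpen_realAnnulus s t) ?_
  · exact (hd.differentiableAt ((isOpen_realAnnulus s t).mem_nhds
      ⟨hsz, hzt⟩)).differentiableWithinAt
  · exact fun w hw => ((differentiableAt_zpow.2
      (Or.inl (norm_pos_iff.1 (hs.trans hw.1)))).const_mul _).differentiableWithinAt
  · intro n w hw
    rw [norm_mul, norm_zpow, ← mul_add]
    have hw0 : 0 < ‖w‖ := hs.trans hw.1
    gcongr
    rcases le_total 0 n with hn | hn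
    · exact (zpow_le_zpow_left₀ hn hw0.le hw.2.le).trans
        (le_add_of_nonneg_left (zpow_nonneg hs.le n))
    · refine le_trans ?_ (le_add_of_nonneg_right (zpow_nonneg (hw0.trans hw.2).le n))
      rw [← neg_neg n, zpow_neg, zpow_neg s]
      exact inv_anti₀ (zpow_pos hs _) (zpow_le_zpow_left₀ (by omega) hs.le hw.1.le)

lemma hasSum_laurentSum {c : ℤ → ℂ} (hc : Summable fun n : ℤ => ‖c n‖) {z : ℂ} (hz : z ∈ 𝕊) :
    HasSum (fun n : ℤ => c n * z ^ n) (laurentSum c z) := by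
  refine (Summable.of_norm ?_).hasSum
  simpa only [norm_mul, norm_zpow_of_mem_sphere hz, mul_one] using hc

lemma fourierCoef_laurentSum {c : ℤ → ℂ} (hc : Summable fun n : ℤ => ‖c n‖) (n : ℤ) :
    fourierCoef (laurentSum c) n = c n := by
  have := hasSum_fourierCoef (F := fun (k : ℤ) z => c k * z ^ k) (f := laurentSum c)
    (fun k => continuousOn_const.mul (continuousOn_zpow_sphere k)) hc
    (fun k z hz => by rw [norm_mul, norm_zpow_of_mem_sphere hz, mul_one])
    (fun z hz => hasSum_laurentSum hc hz) n
  simp only [fourierCoef_const_mul, fourierCoef_zpow] at this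
  refine this.unique ?_
  have h := hasSum_ite_eq n (c n)
  convert h using 2 with k
  by_cases hk : k = n <;> simp [hk]

/-! ### Weighted composition operators on `ℓ²` -/

/-- Since `τ` is injective where `d` does not vanish, each coordinate of `x` is counted at most
once. -/
lemma sum_weightedComp_le {d : ℕ → ℂ} {τ : ℕ → ℕ} {M : ℝ} (hM : ∀ j, ‖d j‖ ≤ M)
    (hτ : Set.InjOn τ {j | d j ≠ 0}) (x : EllTwo) (s : Finset ℕ) :
    ∑ j ∈ s, ‖d j * x (τ j)‖ ^ (2 : ℝ≥0∞).toReal ≤ (M * ‖x‖) ^ (2 : ℝ≥0∞).toReal := by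
  have hM0 : 0 ≤ M := (norm_nonneg _).trans (hM 0)
  classical
  calc ∑ j ∈ s, ‖d j * x (τ j)‖ ^ (2 : ℝ≥0∞).toReal
      = ∑ j ∈ s with d j ≠ 0, ‖d j * x (τ j)‖ ^ (2 : ℝ≥0∞).toReal := by
        refine (Finset.sum_subset (Finset.filter_subset _ _) fun j hj hj' => ?_).symm
        have : d j = 0 := by
          by_contra h
          exact hj' (Finset.mem_filter.2 ⟨hj, h⟩)
        simp [this]
    _ ≤ ∑ j ∈ s with d j ≠ 0, M ^ (2 : ℝ≥0∞).toReal * ‖x (τ j)‖ ^ (2 : ℝ≥0∞).toReal := by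
        refine Finset.sum_le_sum fun j _ => ?_
        rw [norm_mul, Real.mul_rpow (norm_nonneg _) (norm_nonneg _)]
        have := hM j
        gcongr
    _ = M ^ (2 : ℝ≥0∞).toReal *
          ∑ k ∈ (s.filter fun j => d j ≠ 0).image τ, ‖x k‖ ^ (2 : ℝ≥0∞).toReal := by
        rw [← Finset.mul_sum, Finset.sum_image]
        intro i hi j hj hij
        exact hτ (Finset.mem_filter.1 hi).2 (Finset.mem_filter.1 hj).2 hij
    _ ≤ M ^ (2 : ℝ≥0∞).toReal * ‖x‖ ^ (2 : ℝ≥0∞).toReal := by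
        gcongr
        exact lp.sum_rpow_le_norm_rpow (by norm_num) x _
    _ = (M * ‖x‖) ^ (2 : ℝ≥0∞).toReal := (Real.mul_rpow hM0 (norm_nonneg _)).symm

/-- The operator `(x_j) ↦ (d_j x_{τ j})` on `ℓ²`. -/
def weightedComp (d : ℕ → ℂ) (τ : ℕ → ℕ) {M : ℝ} (hM : ∀ j, ‖d j‖ ≤ M)
    (hτ : Set.InjOn τ {j | d j ≠ 0}) : EllTwo →L[ℂ] EllTwo :=
  LinearMap.mkContinuous
    { toFun := fun x => ⟨fun j => d j * x (τ j), memℓp_gen' (sum_weightedComp_le hM hτ x)⟩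
      map_add' := fun x y => by
        ext j
        exact mul_add (d j) (x (τ j)) (y (τ j))
      map_smul' := fun c x => by
        ext j
        exact mul_left_comm (d j) c (x (τ j)) }
    M fun x => lp.norm_le_of_forall_sum_le (by norm_num)
      (mul_nonneg ((norm_nonneg _).trans (hM 0)) (norm_nonneg _)) (sum_weightedComp_le hM hτ x)

lemma weightedComp_apply {d : ℕ → ℂ} {τ : ℕ → ℕ} {M : ℝ} (hM : ∀ j, ‖d j‖ ≤ M)
    (hτ : Set.InjOn τ {j | d j ≠ 0}) (x : EllTwo) (j : ℕ) :
    weightedComp d τ hM hτ x j = d j * x (τ j) := rfl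

lemma norm_weightedComp_le {d : ℕ → ℂ} {τ : ℕ → ℕ} {M : ℝ} (hM : ∀ j, ‖d j‖ ≤ M)
    (hτ : Set.InjOn τ {j | d j ≠ 0}) : ‖weightedComp d τ hM hτ‖ ≤ M :=
  LinearMap.mkContinuous_norm_le _ ((norm_nonneg _).trans (hM 0)) _

/-- The diagonal operator with bounded diagonal `d` (zero if `d` is unbounded). -/
def multOp (d : ℕ → ℂ) : EllTwo →L[ℂ] EllTwo :=
  open Classical in
  if h : ∃ M : ℝ, ∀ j, ‖d j‖ ≤ M then weightedComp d id h.choose_spec (Function.injective_id.injOn)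
  else 0

lemma multOp_apply {d : ℕ → ℂ} {M : ℝ} (hM : ∀ j, ‖d j‖ ≤ M) (x : EllTwo) (j : ℕ) :
    multOp d x j = d j * x j := by
  rw [multOp, dif_pos ⟨M, hM⟩, weightedComp_apply, id]

lemma norm_multOp_le {d : ℕ → ℂ} {M : ℝ} (hM : ∀ j, ‖d j‖ ≤ M) : ‖multOp d‖ ≤ M := by
  have : multOp d = weightedComp d id hM Function.injective_id.injOn := by
    ext1 x
    ext j
    rw [multOp_apply hM, weightedComp_apply, id]
  rw [this]
  exact norm_weightedComp_le _ _

lemma norm_shift_weight_le (n : ℤ) (j : ℕ) : ‖if n ≤ (j : ℤ) then (1 : ℂ) else 0‖ ≤ 1 := by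
  split_ifs <;> simp

/-- The shift by `n` on `ℓ²`: the matrix `(δ_{j-k,n})`. -/
def shiftOp (n : ℤ) : EllTwo →L[ℂ] EllTwo :=
  weightedComp (fun j => if n ≤ (j : ℤ) then 1 else 0) (fun j => ((j : ℤ) - n).toNat)
    (norm_shift_weight_le n) fun i hi j hj hij => by
      have hi' : n ≤ (i : ℤ) := by by_contra h; simp [h] at hi
      have hj' : n ≤ (j : ℤ) := by by_contra h; simp [h] at hj
      simp only at hij
      omega

lemma shiftOp_apply (n : ℤ) (x : EllTwo) (j : ℕ) :
    shiftOp n x j = if n ≤ (j : ℤ) then x ((j : ℤ) - n).toNat else 0 := by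
  refine (weightedComp_apply (norm_shift_weight_le n) _ x j).trans ?_
  split_ifs <;> simp

lemma norm_shiftOp_le (n : ℤ) : ‖shiftOp n‖ ≤ 1 := norm_weightedComp_le _ _

/-- The `j`-th coordinate as a continuous functional. -/
def coordCLM (j : ℕ) : EllTwo →L[ℂ] ℂ := lp.evalCLM ℂ (fun _ : ℕ => ℂ) 2 j

lemma coordCLM_apply (j : ℕ) (x : EllTwo) : coordCLM j x = x j := rfl

lemma norm_apply_le (x : EllTwo) (j : ℕ) : ‖x j‖ ≤ ‖x‖ := lp.norm_apply_le_norm two_ne_zero x j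

lemma ellE_apply (k j : ℕ) : ellE k j = if j = k then 1 else 0 := by
  rw [ellE, lp.single_apply, Pi.single_apply]

lemma norm_ellE (k : ℕ) : ‖ellE k‖ = 1 := by
  rw [ellE, lp.norm_single (by norm_num), norm_one]

lemma ext_ellE {A B : EllTwo →L[ℂ] EllTwo} (h : ∀ j k, A (ellE k) j = B (ellE k) j) : A = B := by
  refine lp.ext_continuousLinearMap (by norm_num) fun k => ?_
  ext1
  ext j
  exact h j k

/-! ### Geometric weights and coordinate projections -/

/-- The diagonal operator `diag (1, t, t², …)`. -/
def powDiag (t : ℝ) : EllTwo →L[ℂ] EllTwo := multOp fun j => (t : ℂ) ^ j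

/-- The projection on the first `N` coordinates. -/
def trunc (N : ℕ) : EllTwo →L[ℂ] EllTwo := multOp fun j => if j < N then 1 else 0

lemma norm_pow_weight_le {t : ℝ} (ht0 : 0 ≤ t) (ht1 : t ≤ 1) (j : ℕ) : ‖(t : ℂ) ^ j‖ ≤ 1 := by
  rw [norm_pow, Complex.norm_real, Real.norm_of_nonneg ht0]
  exact pow_le_one₀ ht0 ht1

lemma powDiag_apply {t : ℝ} (ht0 : 0 ≤ t) (ht1 : t ≤ 1) (x : EllTwo) (j : ℕ) :
    powDiag t x j = (t : ℂ) ^ j * x j := multOp_apply (norm_pow_weight_le ht0 ht1) x j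

lemma norm_powDiag_le {t : ℝ} (ht0 : 0 ≤ t) (ht1 : t ≤ 1) : ‖powDiag t‖ ≤ 1 :=
  norm_multOp_le (norm_pow_weight_le ht0 ht1)

lemma norm_trunc_weight_le (N j : ℕ) : ‖if j < N then (1 : ℂ) else 0‖ ≤ 1 := by
  split_ifs <;> simp

lemma trunc_apply (N : ℕ) (x : EllTwo) (j : ℕ) : trunc N x j = if j < N then x j else 0 := by
  rw [trunc, multOp_apply (norm_trunc_weight_le N)]
  split_ifs <;> simp

lemma norm_trunc_le (N : ℕ) : ‖trunc N‖ ≤ 1 := norm_multOp_le (norm_trunc_weight_le N)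

lemma trunc_mul_trunc (N : ℕ) : trunc N * trunc N = trunc N := by
  ext1 x
  ext j
  simp only [mul_apply_eq_comp, trunc_apply]
  split_ifs <;> rfl

lemma trunc_mul_powDiag {t : ℝ} (ht0 : 0 ≤ t) (ht1 : t ≤ 1) (N : ℕ) :
    trunc N * powDiag t = powDiag t * trunc N := by
  ext1 x
  ext j
  simp only [mul_apply_eq_comp, trunc_apply, powDiag_apply ht0 ht1]
  split_ifs <;> simp

lemma norm_powDiag_mul_one_sub_trunc_le {t : ℝ} (ht0 : 0 ≤ t) (ht1 : t ≤ 1) (N : ℕ) :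
    ‖powDiag t * (1 - trunc N)‖ ≤ t ^ N := by
  have hM : ∀ j : ℕ, ‖if j < N then (0 : ℂ) else (t : ℂ) ^ j‖ ≤ t ^ N := by
    intro j
    split_ifs with h
    · simpa using pow_nonneg ht0 N
    · rw [norm_pow, Complex.norm_real, Real.norm_of_nonneg ht0]
      exact pow_le_pow_of_le_one ht0 ht1 (not_lt.1 h)
  have : powDiag t * (1 - trunc N) = multOp fun j => if j < N then (0 : ℂ) else (t : ℂ) ^ j := by
    ext1 x
    ext j
    rw [multOp_apply hM]
    simp only [mul_apply_eq_comp, powDiag_apply ht0 ht1, sub_apply,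
      lp.coeFn_sub, Pi.sub_apply, trunc_apply, one_apply_eq_self]
    split_ifs <;> simp
  rw [this]
  exact norm_multOp_le hM

lemma powDiag_mul_powDiag {s t : ℝ} (hs0 : 0 ≤ s) (hs1 : s ≤ 1) (ht0 : 0 ≤ t) (ht1 : t ≤ 1) :
    powDiag s * powDiag t = powDiag (s * t) := by
  ext1 x
  ext j
  rw [mul_apply_eq_comp, powDiag_apply hs0 hs1, powDiag_apply ht0 ht1,
    powDiag_apply (mul_nonneg hs0 ht0) (mul_le_one₀ hs1 ht0 ht1)]
  push_cast
  ring

lemma powDiag_ellE_zero {t : ℝ} (ht0 : 0 ≤ t) (ht1 : t ≤ 1) : powDiag t (ellE 0) = ellE 0 := by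
  ext j
  rw [powDiag_apply ht0 ht1, ellE_apply]
  split_ifs with h <;> simp [h]

lemma powDiag_mul_shiftOp {t : ℝ} (ht0 : 0 < t) (ht1 : t ≤ 1) (n : ℤ) :
    powDiag t * shiftOp n = ((t : ℂ) ^ n) • (shiftOp n * powDiag t) := by
  ext1 x
  ext j
  simp only [mul_apply_eq_comp, powDiag_apply ht0.le ht1, shiftOp_apply,
    smul_apply, lp.coeFn_smul, Pi.smul_apply, smul_eq_mul]
  split_ifs with h
  · have ht : (t : ℂ) ≠ 0 := by exact_mod_cast ht0.ne'
    rw [← mul_assoc, ← zpow_natCast, ← zpow_natCast, ← zpow_add₀ ht]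
    congr 2
    omega
  · simp

/-! ### Toeplitz operators as sums of shifts -/

/-- The operator `∑ c_n σ_n`, whose matrix is `(c_{j-k})`. -/
def toep (c : ℤ → ℂ) : EllTwo →L[ℂ] EllTwo := ∑' n : ℤ, c n • shiftOp n

lemma summable_norm_smul_shiftOp {c : ℤ → ℂ} (hc : Summable fun n => ‖c n‖) :
    Summable fun n => ‖c n • shiftOp n‖ :=
  Summable.of_nonneg_of_le (fun _ => norm_nonneg _) (fun n => by
    rw [norm_smul]
    exact mul_le_of_le_one_right (norm_nonneg _) (norm_shiftOp_le n)) hc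

lemma hasSum_toep {c : ℤ → ℂ} (hc : Summable fun n => ‖c n‖) :
    HasSum (fun n => c n • shiftOp n) (toep c) :=
  (summable_norm_smul_shiftOp hc).of_norm.hasSum

lemma hasSum_toep_apply {c : ℤ → ℂ} (hc : Summable fun n => ‖c n‖) (x : EllTwo) (j : ℕ) :
    HasSum (fun n => c n * shiftOp n x j) (toep c x j) := by
  have h1 := (hasSum_toep hc).mapL (ContinuousLinearMap.apply ℂ EllTwo x)
  exact h1.mapL (coordCLM j)

lemma toep_apply_ellE {c : ℤ → ℂ} (hc : Summable fun n => ‖c n‖) (j k : ℕ) :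
    toep c (ellE k) j = c ((j : ℤ) - k) := by
  refine (hasSum_toep_apply hc (ellE k) j).unique ?_
  have h := hasSum_ite_eq ((j : ℤ) - k) (c ((j : ℤ) - k))
  convert h using 2 with n
  rw [shiftOp_apply, ellE_apply]
  by_cases hn : n = (j : ℤ) - k
  · subst hn
    simp
  · rw [if_neg hn]
    split_ifs with h1 h2
    · omega
    · simp
    · simp

lemma toep_const_mul {c : ℤ → ℂ} (hc : Summable fun n => ‖c n‖) (a : ℂ) :
    toep (fun n => a * c n) = a • toep c := by
  have := (hasSum_toep hc).const_smul a
  simpa only [toep, mul_smul] using this.tsum_eq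

/-- Moving the weights across a shift by `n` costs `t^n`, so the symbol is evaluated on the circle
of radius `t`. A semiconjugation is used because for `t < 1` the weight operator has no bounded
inverse. -/
lemma semiconjBy_powDiag_toep {c : ℤ → ℂ} {t : ℝ} (ht0 : 0 < t) (ht1 : t ≤ 1)
    (hc : Summable fun n => ‖c n‖) (hct : Summable fun n : ℤ => ‖c n * (t : ℂ) ^ n‖) :
    SemiconjBy (powDiag t) (toep c) (toep fun n => c n * (t : ℂ) ^ n) := by
  have h1 := (hasSum_toep hc).mul_left (powDiag t)
  have h2 := (hasSum_toep hct).mul_right (powDiag t)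
  refine h1.unique ?_
  convert h2 using 2 with n
  rw [mul_smul_comm, powDiag_mul_shiftOp ht0 ht1, smul_smul, smul_mul_assoc]

/-! ### Commutators of Toeplitz operators -/

/-- For `m < 0 < n` the two products of shifts differ only in rows `j < n` and columns `k < -m`. On
this finite block the weights can be divided out, at a cost of at most `w^{-n}` for rows and `x^m`
for columns. -/
lemma exists_shiftOp_commutator {w x : ℝ} (hw0 : 0 < w) (hw1 : w ≤ 1) (hx0 : 0 < x) (hx1 : x ≤ 1)
    {m n : ℤ} (hm : m < 0) (hn : 0 < n) :
    ∃ M : EllTwo →L[ℂ] EllTwo, shiftOp m * shiftOp n - shiftOp n * shiftOp m =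
      powDiag w * M * powDiag x ∧ ‖M‖ ≤ 2 * w ^ (-n) * x ^ m := by
  have hbd : ∀ {t : ℝ}, 0 < t → t ≤ 1 → ∀ {l : ℤ}, 0 < l → ∀ j : ℕ,
      ‖if (j : ℤ) < l then ((t : ℂ) ^ j)⁻¹ else 0‖ ≤ t ^ (-l) := by
    intro t ht0 ht1 l hl j
    split_ifs with h
    · rw [norm_inv, norm_pow, Complex.norm_real, Real.norm_of_nonneg ht0.le, zpow_neg]
      refine inv_anti₀ (zpow_pos ht0 _) ?_
      rw [← zpow_natCast]
      exact zpow_right_anti₀ ht0 ht1 h.le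
    · rw [norm_zero]
      positivity
  have hb1 := hbd hw0 hw1 hn
  have hb2 := hbd hx0 hx1 (neg_pos.2 hm)
  have hw : (w : ℂ) ≠ 0 := by exact_mod_cast hw0.ne'
  have hx : (x : ℂ) ≠ 0 := by exact_mod_cast hx0.ne'
  refine ⟨multOp (fun j => if (j : ℤ) < n then ((w : ℂ) ^ j)⁻¹ else 0) *
    (shiftOp m * shiftOp n - shiftOp n * shiftOp m) *
    multOp (fun j => if (j : ℤ) < -m then ((x : ℂ) ^ j)⁻¹ else 0), ?_, ?_⟩
  · ext1 y
    ext j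
    simp only [mul_apply_eq_comp, sub_apply, lp.coeFn_sub,
      Pi.sub_apply, powDiag_apply hw0.le hw1, powDiag_apply hx0.le hx1, multOp_apply hb1,
      multOp_apply hb2, shiftOp_apply]
    have hmj : m ≤ (j : ℤ) := by omega
    by_cases hj : (j : ℤ) < n
    · simp only [if_pos hmj, if_neg (not_le.2 hj), if_pos hj, sub_zero]
      rw [← mul_assoc, mul_inv_cancel₀ (pow_ne_zero _ hw), one_mul]
      split_ifs with h1 h2
      · rw [inv_mul_cancel_left₀ (pow_ne_zero _ hx)]
      · omega
      · rfl
    · rw [if_neg hj]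
      simp only [zero_mul, mul_zero]
      have ha : n ≤ (((j : ℤ) - m).toNat : ℤ) := by omega
      have hb : m ≤ (((j : ℤ) - n).toNat : ℤ) := by omega
      rw [if_pos hmj, if_pos ha, if_pos (not_lt.1 hj), if_pos hb,
        show (((j : ℤ) - m).toNat - n : ℤ).toNat = ((((j : ℤ) - n).toNat : ℤ) - m).toNat by omega,
        sub_self]
  · have h1 : ‖shiftOp m * shiftOp n - shiftOp n * shiftOp m‖ ≤ 2 := by
      refine (norm_sub_le _ _).trans ?_
      have ha := (norm_mul_le (shiftOp m) (shiftOp n)).trans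
        (mul_le_one₀ (norm_shiftOp_le m) (norm_nonneg _) (norm_shiftOp_le n))
      have hb := (norm_mul_le (shiftOp n) (shiftOp m)).trans
        (mul_le_one₀ (norm_shiftOp_le n) (norm_nonneg _) (norm_shiftOp_le m))
      linarith
    have h2 := norm_multOp_le hb1
    have h3 := norm_multOp_le hb2
    rw [neg_neg] at h3
    have hwn : 0 < w ^ (-n) := by positivity
    calc _ ≤ _ := norm_mul₃_le
      _ ≤ w ^ (-n) * 2 * x ^ m := by gcongr
      _ = _ := by ring


/-- The commutator is the double sum of termwise commutators, and the common outer factors `u` and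
`v` come out of it because the middle factors are summable in norm. -/
lemma commutator_eq_of_hasSum {R : Type*} [NormedRing R] [CompleteSpace R] {ι κ : Type*}
    {f : ι → R} {g : κ → R} {a b u v : R} (hf : HasSum f a) (hf' : Summable fun i => ‖f i‖)
    (hg : HasSum g b) (hg' : Summable fun i => ‖g i‖) {M : ι × κ → R} {B : ι × κ → ℝ}
    (hB : Summable B) (hMB : ∀ p, ‖M p‖ ≤ B p)
    (h : ∀ p : ι × κ, f p.1 * g p.2 - g p.2 * f p.1 = u * M p * v) :
    ∃ M' : R, a * b - b * a = u * M' * v := by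
  have h1 := hf.mul hg (summable_mul_of_summable_norm hf' hg')
  have h2 : HasSum (fun p : ι × κ => g p.2 * f p.1) (b * a) :=
    (Equiv.prodComm ι κ).hasSum_iff.2 (hg.mul hf (summable_mul_of_summable_norm hg' hf'))
  have h3 := h1.sub h2
  simp only [h] at h3
  exact ⟨∑' p, M p, h3.unique (((hB.of_norm_bounded hMB).hasSum.mul_left u).mul_right v)⟩

lemma exists_smul_shiftOp_commutator {w x : ℝ} (hw0 : 0 < w) (hw1 : w ≤ 1) (hx0 : 0 < x)
    (hx1 : x ≤ 1) {m n : ℤ} {a b : ℂ} (ha : 0 ≤ m → a = 0) (hb : n ≤ 0 → b = 0) :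
    ∃ M : EllTwo →L[ℂ] EllTwo,
      (a • shiftOp m) * (b • shiftOp n) - (b • shiftOp n) * (a • shiftOp m)
        = powDiag w * M * powDiag x ∧ ‖M‖ ≤ 2 * ((‖a‖ * x ^ m) * (‖b‖ * w ^ (-n))) := by
  have hab : (a • shiftOp m) * (b • shiftOp n) - (b • shiftOp n) * (a • shiftOp m) =
      (a * b) • (shiftOp m * shiftOp n - shiftOp n * shiftOp m) := by
    rw [smul_mul_smul_comm, smul_mul_smul_comm, mul_comm b, ← smul_sub]
  by_cases h : m < 0 ∧ 0 < n
  · obtain ⟨M, hM1, hM2⟩ := exists_shiftOp_commutator hw0 hw1 hx0 hx1 h.1 h.2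
    refine ⟨(a * b) • M, ?_, ?_⟩
    · rw [hab, hM1, mul_smul_comm, smul_mul_assoc]
    · rw [norm_smul, norm_mul]
      calc ‖a‖ * ‖b‖ * ‖M‖ ≤ ‖a‖ * ‖b‖ * (2 * w ^ (-n) * x ^ m) := by gcongr
        _ = _ := by ring
  · have hz : a * b = 0 := by
      rcases not_and_or.1 h with h | h
      · rw [ha (not_lt.1 h), zero_mul]
      · rw [hb (not_lt.1 h), mul_zero]
    have h0 : 0 ≤ 2 * ((‖a‖ * x ^ m) * (‖b‖ * w ^ (-n))) := by positivity
    exact ⟨0, by rw [hab, hz, zero_smul, mul_zero, zero_mul], by rwa [norm_zero]⟩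

/-- The commutator of an upper triangular and a lower triangular Toeplitz operator with
exponentially decaying symbols is exponentially concentrated near the upper left corner. -/
lemma exists_toep_commutator {w x : ℝ} (hw0 : 0 < w) (hw1 : w ≤ 1) (hx0 : 0 < x) (hx1 : x ≤ 1)
    {c d : ℤ → ℂ} (hc : Summable fun n => ‖c n‖) (hd : Summable fun n => ‖d n‖)
    (hcx : Summable fun n : ℤ => ‖c n‖ * x ^ n) (hdw : Summable fun n : ℤ => ‖d n‖ * w ^ (-n))
    (hc0 : ∀ n, 0 ≤ n → c n = 0) (hd0 : ∀ n, n ≤ 0 → d n = 0) :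
    ∃ M : EllTwo →L[ℂ] EllTwo, toep c * toep d - toep d * toep c = powDiag w * M * powDiag x := by
  have hg : Summable fun p : ℤ × ℤ => 2 * ((‖c p.1‖ * x ^ p.1) * (‖d p.2‖ * w ^ (-p.2))) :=
    (Summable.mul_of_nonneg hcx hdw (fun n => mul_nonneg (norm_nonneg _) (zpow_nonneg hx0.le n))
      (fun n => mul_nonneg (norm_nonneg _) (zpow_nonneg hw0.le _))).mul_left 2
  choose M hM1 hM2 using fun p : ℤ × ℤ =>
    exists_smul_shiftOp_commutator hw0 hw1 hx0 hx1 (hc0 p.1) (hd0 p.2)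
  exact commutator_eq_of_hasSum (R := EllTwo →L[ℂ] EllTwo) (hasSum_toep hc)
    (summable_norm_smul_shiftOp hc) (hasSum_toep hd) (summable_norm_smul_shiftOp hd) (M := M) hg hM2 hM1

/-! ### Products and exponentials of Toeplitz operators -/

/-- `f` is continuous on the unit circle with absolutely summable Fourier coefficients. -/
structure IsWiener (f : ℂ → ℂ) : Prop where
  continuousOn : ContinuousOn f 𝕊
  summable : Summable fun n : ℤ => ‖fourierCoef f n‖

lemma DifferentiableOn.isWiener {f : ℂ → ℂ} {r R : ℝ}
    (hf : DifferentiableOn ℂ f (realAnnulus r R)) (hr : 0 ≤ r) (hr1 : r < 1) (hR1 : 1 < R) :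
    IsWiener f :=
  ⟨continuousOn_of_differentiableOn_realAnnulus hr1 hR1 hf,
    summable_norm_fourierCoef hr hr1 hR1 hf⟩

lemma IsWiener.congr {f g : ℂ → ℂ} (hf : IsWiener f) (h : Set.EqOn g f 𝕊) : IsWiener g :=
  ⟨hf.continuousOn.congr h, by simpa only [fourierCoef_congr h] using hf.summable⟩

lemma shiftOp_toep_ellE {c : ℤ → ℂ} (hc : Summable fun n => ‖c n‖) (n : ℤ) (j k : ℕ) :
    shiftOp n (toep c (ellE k)) j = if n ≤ (j : ℤ) then c ((j : ℤ) - k - n) else 0 := by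
  rw [shiftOp_apply]
  split_ifs with h
  · rw [toep_apply_ellE hc]
    congr 1
    omega
  · rfl

/-- The `(j, k)` entry of the operator product is the convolution restricted to `n ≤ j`. The omitted
terms `f_n g_{j-k-n}` have `n > 0` and `j - k - n < 0`, so one-sidedness of either factor kills
them. -/
lemma toep_fourierCoef_mul {f g : ℂ → ℂ} (hf : IsWiener f) (hg : IsWiener g)
    (hfg : IsWiener fun z => f z * g z)
    (h : (∀ n, 0 < n → fourierCoef f n = 0) ∨ (∀ n, n < 0 → fourierCoef g n = 0)) :
    toep (fourierCoef f) * toep (fourierCoef g) = toep (fourierCoef fun z => f z * g z) := by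
  refine ext_ellE fun j k => ?_
  rw [toep_apply_ellE hfg.summable, mul_apply_eq_comp]
  refine (hasSum_toep_apply hf.summable _ j).unique ?_
  convert hasSum_fourierCoef_mul hf.continuousOn hf.summable hg.continuousOn ((j : ℤ) - k)
    using 2 with n
  rw [shiftOp_toep_ellE hg.summable]
  split_ifs with hn
  · rfl
  · rcases h with h | h
    · rw [h n (by omega), zero_mul, zero_mul]
    · rw [h _ (by omega)]

lemma hasSum_fourierCoef_exp {f : ℂ → ℂ} (hf : ContinuousOn f 𝕊) (n : ℤ) :
    HasSum (fun k : ℕ => ((k.factorial : ℂ))⁻¹ * fourierCoef (fun z => f z ^ k) n)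
      (fourierCoef (fun z => Complex.exp (f z)) n) := by
  obtain ⟨C, hC⟩ := (isCompact_sphere (0 : ℂ) 1).exists_bound_of_continuousOn hf
  have := hasSum_fourierCoef (F := fun (k : ℕ) z => ((k.factorial : ℂ))⁻¹ * f z ^ k)
    (f := fun z => Complex.exp (f z)) (u := fun k => C ^ k / k.factorial)
    (fun k => continuousOn_const.mul (hf.pow k)) (Real.summable_pow_div_factorial C)
    (fun k z hz => by
      rw [norm_mul, norm_inv, norm_pow, Complex.norm_natCast, div_eq_inv_mul]
      gcongr
      exact hC z hz)
    (fun z hz => by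
      rw [Complex.exp_eq_exp_ℂ]
      simpa [smul_eq_mul] using NormedSpace.exp_series_hasSum_exp' (𝕂 := ℂ) (f z)) n
  simpa only [fourierCoef_const_mul] using this

lemma toep_fourierCoef_one : toep (fourierCoef fun _ => 1) = 1 := by
  have hs : Summable fun n : ℤ => ‖fourierCoef (fun _ => 1) n‖ :=
    summable_of_ne_finset_zero (s := {0}) fun n hn => by
      rw [fourierCoef_one, if_neg (by simpa using hn), norm_zero]
  refine ext_ellE fun j k => ?_
  rw [toep_apply_ellE hs, fourierCoef_one, one_apply_eq_self, ellE_apply]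
  congr 1
  simp [sub_eq_zero]

/-- The sign `ε` treats the lower (`1`) and upper (`-1`) triangular cases together. One-sided
sequences are closed under convolution, and only the product of the two mean coefficients
contributes to index `0`. -/
lemma toep_fourierCoef_pow {f : ℂ → ℂ} {r R : ℝ} (hf : DifferentiableOn ℂ f (realAnnulus r R))
    (hr : 0 ≤ r) (hr1 : r < 1) (hR1 : 1 < R) {ε : ℤ} (hε : ε = 1 ∨ ε = -1)
    (h : ∀ n, ε * n < 0 → fourierCoef f n = 0) (k : ℕ) :
    toep (fourierCoef fun z => f z ^ k) = toep (fourierCoef f) ^ k ∧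
      (∀ n, ε * n < 0 → fourierCoef (fun z => f z ^ k) n = 0) ∧
      fourierCoef (fun z => f z ^ k) 0 = fourierCoef f 0 ^ k := by
  have hW := hf.isWiener hr hr1 hR1
  induction k with
  | zero =>
    refine ⟨by simpa using toep_fourierCoef_one, fun n hn => ?_, ?_⟩
    · simp only [pow_zero, fourierCoef_one]
      rw [if_neg]
      rintro rfl
      simp at hn
    · simp [fourierCoef_one]
  | succ k ih =>
    obtain ⟨ih1, ih2, ih3⟩ := ih
    have hWk := (hf.pow k).isWiener hr hr1 hR1
    have hWk' := (hf.mul (hf.pow k)).isWiener hr hr1 hR1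
    have hconv := fun n => hasSum_fourierCoef_mul hW.continuousOn hW.summable hWk.continuousOn n
    simp only [pow_succ']
    refine ⟨?_, fun n hn => ?_, ?_⟩
    · rw [← ih1]
      refine (toep_fourierCoef_mul hW hWk hWk' ?_).symm
      rcases hε with rfl | rfl
      · exact Or.inr fun n hn => ih2 n (by omega)
      · exact Or.inl fun n hn => h n (by omega)
    · refine (hconv n).unique ?_
      convert hasSum_zero with i
      by_cases hi : ε * i < 0
      · rw [h i hi, zero_mul]
      · have : ε * (n - i) < 0 := by rw [mul_sub]; omega
        exact mul_eq_zero_of_right _ (ih2 _ this)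
    · refine (hconv 0).unique ?_
      rw [← ih3]
      convert hasSum_single (0 : ℤ) ?_ using 1
      · rw [sub_zero]
        rfl
      intro i hi
      by_cases hi' : ε * i < 0
      · rw [h i hi', zero_mul]
      · have : ε * (0 - i) < 0 := by rcases hε with rfl | rfl <;> omega
        exact mul_eq_zero_of_right _ (ih2 _ this)

/-- For a one-sided symbol, `exp T(f) = T(exp f)`. -/
lemma exp_toep_fourierCoef {f : ℂ → ℂ} {r R : ℝ} (hf : DifferentiableOn ℂ f (realAnnulus r R))
    (hr : 0 ≤ r) (hr1 : r < 1) (hR1 : 1 < R) {ε : ℤ} (hε : ε = 1 ∨ ε = -1)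
    (h : ∀ n, ε * n < 0 → fourierCoef f n = 0) :
    NormedSpace.exp (toep (fourierCoef f)) = toep (fourierCoef fun z => Complex.exp (f z)) ∧
      (∀ n, ε * n < 0 → fourierCoef (fun z => Complex.exp (f z)) n = 0) ∧
      fourierCoef (fun z => Complex.exp (f z)) 0 = Complex.exp (fourierCoef f 0) := by
  have hpow := toep_fourierCoef_pow hf hr hr1 hR1 hε h
  have hW := hf.isWiener hr hr1 hR1
  have hexp := hasSum_fourierCoef_exp hW.continuousOn
  refine ⟨?_, fun n hn => ?_, ?_⟩
  · have hWe := hf.cexp.isWiener hr hr1 hR1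
    refine ext_ellE fun j k => ?_
    rw [toep_apply_ellE hWe.summable]
    have h1 := NormedSpace.exp_series_hasSum_exp' (𝕂 := ℂ) (toep (fourierCoef f))
    have h2 := (h1.mapL (ContinuousLinearMap.apply ℂ EllTwo (ellE k))).mapL (coordCLM j)
    refine h2.unique ?_
    convert hexp ((j : ℤ) - k) using 2 with m
    rw [← (hpow m).1]
    have := toep_apply_ellE ((hf.pow m).isWiener hr hr1 hR1).summable j k
    simp only [map_smul, ContinuousLinearMap.apply_apply, smul_eq_mul]
    rw [coordCLM_apply]
    exact congrArg _ this
  · refine (hexp n).unique ?_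
    convert hasSum_zero with i
    rw [(hpow i).2.1 n hn, mul_zero]
  · refine (hexp 0).unique ?_
    simp only [(hpow _).2.2]
    rw [Complex.exp_eq_exp_ℂ]
    simpa [smul_eq_mul] using NormedSpace.exp_series_hasSum_exp' (𝕂 := ℂ) (fourierCoef f 0)

/-! ### Multiplicative commutators in a Banach algebra -/

section BanachAlgebra

variable {A : Type*} [NormedRing A] [NormedAlgebra ℂ A] [CompleteSpace A]

lemma exp_mul_exp_neg_self (X : A) : NormedSpace.exp X * NormedSpace.exp (-X) = 1 := by
  have : NormedAlgebra ℚ A := NormedAlgebra.restrictScalars ℚ ℂ A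
  rw [← NormedSpace.exp_add_of_commute (Commute.refl X).neg_right, add_neg_cancel,
    NormedSpace.exp_zero]

lemma exp_neg_mul_exp_self (X : A) : NormedSpace.exp (-X) * NormedSpace.exp X = 1 := by
  simpa using exp_mul_exp_neg_self (-X)

lemma norm_exp_le_of_norm_le [NormOneClass A] {X : A} {c : ℝ} (h : ‖X‖ ≤ c) :
    ‖NormedSpace.exp X‖ ≤ Real.exp c := by
  have h1 := NormedSpace.exp_series_hasSum_exp' (𝕂 := ℂ) X
  refine h1.norm_le_of_bounded (g := fun n => c ^ n / n.factorial) ?_ fun n => ?_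
  · rw [Real.exp_eq_exp_ℝ]
    exact NormedSpace.expSeries_div_hasSum_exp c
  · rw [norm_smul, norm_inv, Complex.norm_natCast, div_eq_inv_mul]
    have := norm_pow_le X n
    gcongr
    exact this.trans (by gcongr)

/-- If `[X, Y] = D M E` where `X` can be moved across `D` and `E`, then `[exp X, Y]` has the same
form. -/
lemma exists_exp_commutator [NormOneClass A] {X Y M D E l ρ : A} {c : ℝ} (hl : ‖l‖ ≤ c)
    (hρ : ‖ρ‖ ≤ c) (hXY : X * Y - Y * X = D * M * E) (hXD : X * D = D * l) (hEX : E * X = ρ * E) :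
    ∃ M' : A, NormedSpace.exp X * Y - Y * NormedSpace.exp X = D * M' * E ∧
      ‖M'‖ ≤ ‖M‖ * Real.exp c := by
  have hc : 0 ≤ c := (norm_nonneg _).trans hl
  -- This is the Leibniz rule `[X^{n+1}, Y] = X [X^n, Y] + [X, Y] X^n` after `X` has been carried
  -- across `D` on the left and across `E` on the right.
  let m : ℕ → A := fun n => Nat.rec 0 (fun n a => l * a + M * ρ ^ n) n
  have hEXn : ∀ n, E * X ^ n = ρ ^ n * E := fun n => by
    induction n with
    | zero => simp
    | succ n ih => rw [pow_succ, ← mul_assoc, ih, mul_assoc, hEX, ← mul_assoc, ← pow_succ]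
  have hm : ∀ n, X ^ n * Y - Y * X ^ n = D * m n * E := by
    intro n
    induction n with
    | zero => simp [m]
    | succ n ih =>
      calc X ^ (n + 1) * Y - Y * X ^ (n + 1)
          = X * (X ^ n * Y - Y * X ^ n) + (X * Y - Y * X) * X ^ n := by rw [pow_succ']; noncomm_ring
        _ = (X * D) * m n * E + D * M * (E * X ^ n) := by rw [ih, hXY]; noncomm_ring
        _ = D * (l * m n + M * ρ ^ n) * E := by rw [hXD, hEXn]; noncomm_ring
  -- The factor `n + 1` cancels against the factorial, so the exponential series of the middle
  -- factors is dominated by `‖M‖ e^c`.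
  have hmn : ∀ n, ‖m (n + 1)‖ ≤ (n + 1 : ℕ) * c ^ n * ‖M‖ := by
    intro n
    induction n with
    | zero => simp [m]
    | succ n ih =>
      have h1 : ‖M * ρ ^ (n + 1)‖ ≤ ‖M‖ * c ^ (n + 1) :=
        (norm_mul_le _ _).trans (by
          gcongr
          exact (norm_pow_le _ _).trans (by gcongr))
      have h2 : ‖l * m (n + 1)‖ ≤ c * ((n + 1 : ℕ) * c ^ n * ‖M‖) :=
        (norm_mul_le _ _).trans (by gcongr)
      calc ‖m (n + 1 + 1)‖ ≤ ‖l * m (n + 1)‖ + ‖M * ρ ^ (n + 1)‖ := norm_add_le _ _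
        _ ≤ c * ((n + 1 : ℕ) * c ^ n * ‖M‖) + ‖M‖ * c ^ (n + 1) := add_le_add h2 h1
        _ = _ := by push_cast; ring
  have hbound : ∀ n, ‖(((n + 1).factorial : ℂ))⁻¹ • m (n + 1)‖ ≤ ‖M‖ * (c ^ n / n.factorial) := by
    intro n
    rw [norm_smul, norm_inv, Complex.norm_natCast]
    calc (((n + 1).factorial : ℝ))⁻¹ * ‖m (n + 1)‖
        ≤ (((n + 1).factorial : ℝ))⁻¹ * ((n + 1 : ℕ) * c ^ n * ‖M‖) := by
          gcongr
          exact hmn n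
      _ = _ := by
          rw [Nat.factorial_succ]
          push_cast
          field_simp
  have hexpc : HasSum (fun n : ℕ => c ^ n / n.factorial) (Real.exp c) := by
    rw [Real.exp_eq_exp_ℝ]
    exact NormedSpace.expSeries_div_hasSum_exp c
  have hsum : HasSum (fun n => (((n + 1).factorial : ℂ))⁻¹ • m (n + 1))
      (∑' n, (((n + 1).factorial : ℂ))⁻¹ • m (n + 1)) :=
    ((hexpc.summable.mul_left ‖M‖).of_norm_bounded hbound).hasSum
  refine ⟨∑' n, (((n + 1).factorial : ℂ))⁻¹ • m (n + 1), ?_,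
    hsum.norm_le_of_bounded (hexpc.mul_left ‖M‖) hbound⟩
  have h1 := NormedSpace.exp_series_hasSum_exp' (𝕂 := ℂ) X
  have h2 := (h1.mul_right Y).sub (h1.mul_left Y)
  have h3 : ∀ n : ℕ, ((n.factorial : ℂ)⁻¹ • X ^ n) * Y - Y * ((n.factorial : ℂ)⁻¹ • X ^ n)
      = D * ((n.factorial : ℂ)⁻¹ • m n) * E := fun n => by
    rw [smul_mul_assoc, mul_smul_comm, ← smul_sub, hm, mul_smul_comm, smul_mul_assoc]
  simp only [h3] at h2
  refine h2.unique ?_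
  rw [← hasSum_nat_add_iff' 1]
  simpa [m] using (hsum.mul_left D).mul_right E

/-- The multiplicative commutator `e^{-sp} e^q e^{sp} e^{-q}`. -/
def expCommutator (p q : A) (s : ℂ) : A :=
  NormedSpace.exp (-(s • p)) * NormedSpace.exp q * NormedSpace.exp (s • p) * NormedSpace.exp (-q)

/-- A multiplicative commutator is a perturbation of the identity by a localized element. -/
lemma exists_expCommutator [NormOneClass A] {p q D E M p₁ p₂ q₁ q₂ : A}
    (hM : q * p - p * q = D * M * E) (hp₁ : p * D = D * p₁) (hp₂ : E * p = p₂ * E)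
    (hq₁ : q * D = D * q₁) (hq₂ : E * q = q₂ * E) (S : ℝ) :
    ∃ B, ∀ s : ℂ, ‖s‖ ≤ S → ∃ M' : A, expCommutator p q s = 1 + D * M' * E ∧ ‖M'‖ ≤ B := by
  -- Two passes: first `q` is exponentiated against `p`, then `s • p` against `e^q`. Only the second
  -- depends on `s`, which makes the bound uniform for `‖s‖ ≤ S`.
  obtain ⟨M₁, hM₁, -⟩ := exists_exp_commutator (le_max_left ‖q₁‖ ‖q₂‖) (le_max_right _ _) hM hq₁ hq₂
  set c := max ‖p₁‖ ‖p₂‖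
  have hc : 0 ≤ c := (norm_nonneg _).trans (le_max_left _ _)
  refine ⟨Real.exp (S * c) * (S * ‖M₁‖ * Real.exp (S * c)) * ‖NormedSpace.exp (-q₂)‖,
    fun s hs => ?_⟩
  have hS : 0 ≤ S := (norm_nonneg _).trans hs
  have h₁ : ‖s • p₁‖ ≤ S * c := by
    rw [norm_smul]
    gcongr
    exact le_max_left _ _
  have h₂ : ‖s • p₂‖ ≤ S * c := by
    rw [norm_smul]
    gcongr
    exact le_max_right _ _
  obtain ⟨M₂, hM₂, hM₂n⟩ := exists_exp_commutator (X := s • p) (Y := NormedSpace.exp q)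
    (M := -(s • M₁)) (D := D) (E := E) h₁ h₂
    (by rw [smul_mul_assoc, mul_smul_comm, ← smul_sub, ← neg_sub, hM₁]; simp)
    (by rw [smul_mul_assoc, hp₁, mul_smul_comm]) (by rw [mul_smul_comm, hp₂, smul_mul_assoc])
  have hD : NormedSpace.exp (-(s • p)) * D = D * NormedSpace.exp (-(s • p₁)) := by
    have : SemiconjBy D (-(s • p₁)) (-(s • p)) := by
      rw [SemiconjBy, mul_neg, neg_mul, mul_smul_comm, smul_mul_assoc, hp₁]
    have : NormedAlgebra ℚ A := NormedAlgebra.restrictScalars ℚ ℂ A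
    exact (SemiconjBy.exp_right ‹_›).symm
  have hE : E * NormedSpace.exp (-q) = NormedSpace.exp (-q₂) * E := by
    have : SemiconjBy E (-q) (-q₂) := by
      rw [SemiconjBy, mul_neg, neg_mul, hq₂]
    have : NormedAlgebra ℚ A := NormedAlgebra.restrictScalars ℚ ℂ A
    exact SemiconjBy.exp_right ‹_›
  refine ⟨-(NormedSpace.exp (-(s • p₁)) * M₂ * NormedSpace.exp (-q₂)), ?_, ?_⟩
  · have e1 := exp_neg_mul_exp_self (s • p)
    have e2 := exp_mul_exp_neg_self q
    have h3 : NormedSpace.exp q * NormedSpace.exp (s • p) =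
        NormedSpace.exp (s • p) * NormedSpace.exp q - D * M₂ * E := by
      rw [← hM₂]
      abel
    calc expCommutator p q s
        = NormedSpace.exp (-(s • p)) * (NormedSpace.exp q * NormedSpace.exp (s • p)) *
          NormedSpace.exp (-q) := by rw [expCommutator]; noncomm_ring
      _ = (NormedSpace.exp (-(s • p)) * NormedSpace.exp (s • p)) *
            (NormedSpace.exp q * NormedSpace.exp (-q)) -
          (NormedSpace.exp (-(s • p)) * D) * M₂ * (E * NormedSpace.exp (-q)) := by
          rw [h3]; noncomm_ring
      _ = _ := by
          rw [e1, e2, hD, hE]; noncomm_ring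
  · rw [norm_neg]
    refine norm_mul₃_le.trans ?_
    have h4 : ‖NormedSpace.exp (-(s • p₁))‖ ≤ Real.exp (S * c) :=
      norm_exp_le_of_norm_le (by rwa [norm_neg])
    have h5 : ‖M₂‖ ≤ S * ‖M₁‖ * Real.exp (S * c) := by
      refine hM₂n.trans ?_
      rw [norm_neg, norm_smul]
      gcongr
    gcongr

lemma expCommutator_zero (p q : A) : expCommutator p q 0 = 1 := by
  rw [expCommutator, zero_smul, neg_zero, NormedSpace.exp_zero, one_mul, mul_one,
    exp_mul_exp_neg_self]

/-- A cocycle rule, obtained by inserting `e^{-q} e^{tp} e^{-tp} e^q = 1`. When `e^{tp}` is lower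
triangular, the conjugation by it disappears from determinants of corners, up to a vanishing
truncation error. -/
lemma expCommutator_add (p q : A) (s t : ℂ) : expCommutator p q (s + t) =
    NormedSpace.exp (-(t • p)) * expCommutator p q s * NormedSpace.exp (t • p) *
      expCommutator p q t := by
  have : NormedAlgebra ℚ A := NormedAlgebra.restrictScalars ℚ ℂ A
  have hcomm : ∀ a b : ℂ, NormedSpace.exp ((a + b) • p) =
      NormedSpace.exp (a • p) * NormedSpace.exp (b • p) := fun a b => by
    rw [add_smul]
    exact NormedSpace.exp_add_of_commute (((Commute.refl p).smul_left a).smul_right b)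
  have h1 : NormedSpace.exp (-((s + t) • p)) =
      NormedSpace.exp (-(t • p)) * NormedSpace.exp (-(s • p)) := by
    rw [← neg_smul, neg_add, add_comm, hcomm, neg_smul, neg_smul]
  calc expCommutator p q (s + t)
      = NormedSpace.exp (-(t • p)) * NormedSpace.exp (-(s • p)) * NormedSpace.exp q *
        NormedSpace.exp (s • p) * 1 * 1 * NormedSpace.exp (t • p) * NormedSpace.exp (-q) := by
        rw [expCommutator, h1, hcomm]; noncomm_ring
    _ = NormedSpace.exp (-(t • p)) * NormedSpace.exp (-(s • p)) * NormedSpace.exp q *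
        NormedSpace.exp (s • p) * (NormedSpace.exp (-q) * ((NormedSpace.exp (t • p)) *
          NormedSpace.exp (-(t • p))) * NormedSpace.exp q) *
          NormedSpace.exp (t • p) * NormedSpace.exp (-q) := by
        simp only [exp_mul_exp_neg_self, exp_neg_mul_exp_self, mul_one]
    _ = _ := by
        rw [expCommutator, expCommutator]; noncomm_ring

lemma hasDerivAt_expCommutator (p q : A) (s : ℂ) : ∃ A' : A, HasDerivAt (expCommutator p q) A' s := by
  have h1 : ∀ X : A, HasDerivAt (fun u : ℂ => NormedSpace.exp (u • X))
      (NormedSpace.exp (s • X) * X) s := fun X => hasDerivAt_exp_smul_const X s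
  have h2 := (((h1 (-p)).mul_const (NormedSpace.exp q)).mul (h1 p)).mul_const (NormedSpace.exp (-q))
  simp only [smul_neg] at h2
  exact ⟨_, h2⟩

lemma hasDerivAt_expCommutator_zero (p q : A) : HasDerivAt (expCommutator p q)
    (NormedSpace.exp q * p * NormedSpace.exp (-q) - p) 0 := by
  have h1 : ∀ X : A, HasDerivAt (fun u : ℂ => NormedSpace.exp (u • X)) X 0 := fun X => by
    simpa using hasDerivAt_exp_smul_const (𝕂 := ℂ) X (0 : ℂ)
  have h2 := (((h1 (-p)).mul_const (NormedSpace.exp q)).mul (h1 p)).mul_const (NormedSpace.exp (-q))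
  simp only [smul_neg] at h2
  refine h2.congr_deriv ?_
  simp only [zero_smul, NormedSpace.exp_zero, neg_zero, mul_one, one_mul, add_mul, neg_mul,
    mul_assoc, exp_mul_exp_neg_self]
  abel

end BanachAlgebra

/-! ### Determinant estimates -/

/-- Expanding the product of row sums gives one term for each map of the index set to itself; the
determinant uses only the bijections. -/
lemma norm_det_le_prod_sum_norm {n : Type*} [Fintype n] [DecidableEq n] (B : Matrix n n ℂ) :
    ‖B.det‖ ≤ ∏ i, ∑ k, ‖B i k‖ := by
  rw [← Matrix.det_transpose, Matrix.det_apply]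
  calc ‖∑ σ : Equiv.Perm n, Equiv.Perm.sign σ • ∏ i, Bᵀ (σ i) i‖
      ≤ ∑ σ : Equiv.Perm n, ‖Equiv.Perm.sign σ • ∏ i, Bᵀ (σ i) i‖ := norm_sum_le _ _
    _ = ∑ σ : Equiv.Perm n, ∏ i, ‖B i (σ i)‖ := by
        refine Finset.sum_congr rfl fun σ _ => ?_
        rcases Int.units_eq_one_or (Equiv.Perm.sign σ) with h | h <;>
          simp [h, norm_prod, Matrix.transpose_apply]
    _ = ∑ f ∈ (Finset.univ : Finset (Equiv.Perm n)).map
          ⟨fun σ : Equiv.Perm n => (σ : n → n), DFunLike.coe_injective⟩, ∏ i, ‖B i (f i)‖ := by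
        rw [Finset.sum_map]
        rfl
    _ ≤ ∑ f : n → n, ∏ i, ‖B i (f i)‖ :=
        Finset.sum_le_sum_of_subset_of_nonneg (Finset.subset_univ _) fun f _ _ =>
          Finset.prod_nonneg fun i _ => norm_nonneg _
    _ = ∏ i, ∑ k, ‖B i k‖ := by
        rw [Finset.prod_univ_sum, Fintype.piFinset_univ]

/-- The determinant is a multilinear map of the rows, bounded by `1` for the `ℓ¹` norm, so rows can
be exchanged one at a time. The condition `1 ≤ ρ i` allows the factor of the exchanged row to be put
back into the product. -/
lemma norm_det_sub_det_le {n : Type*} [Fintype n] [DecidableEq n] {B B' : Matrix n n ℂ}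
    {ρ : n → ℝ} (hρ : ∀ i, 1 ≤ ρ i) (hB : ∀ i, ∑ k, ‖B i k‖ ≤ ρ i)
    (hB' : ∀ i, ∑ k, ‖B' i k‖ ≤ ρ i) :
    ‖B.det - B'.det‖ ≤ (∏ i, ρ i) * ∑ i, ∑ k, ‖B i k - B' i k‖ := by
  let f : MultilinearMap ℂ (fun _ : n => PiLp 1 fun _ : n => ℂ) ℂ :=
    (Matrix.detRowAlternating (R := ℂ) (n := n)).toMultilinearMap.compLinearMap
      fun _ => (WithLp.linearEquiv 1 ℂ (n → ℂ)).toLinearMap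
  have hf : ∀ C : Matrix n n ℂ, f (fun i => WithLp.toLp 1 (C i)) = C.det := fun C => rfl
  have hnorm : ∀ v : n → ℂ, ‖(WithLp.toLp 1 v : PiLp 1 fun _ : n => ℂ)‖ = ∑ k, ‖v k‖ := fun v => by
    rw [PiLp.norm_eq_of_L1]
  have H : ∀ m : n → PiLp 1 fun _ : n => ℂ, ‖f m‖ ≤ 1 * ∏ i, ‖m i‖ := fun m => by
    rw [one_mul]
    have := norm_det_le_prod_sum_norm (Matrix.of fun i k => m i k)
    simp only [Matrix.of_apply] at this
    refine (le_of_eq ?_).trans (this.trans (le_of_eq ?_))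
    · rfl
    · exact Finset.prod_congr rfl fun i _ => (hnorm _).symm
  have key := f.norm_image_sub_le_of_bound' zero_le_one H (fun i => WithLp.toLp 1 (B i))
    fun i => WithLp.toLp 1 (B' i)
  rw [hf, hf, one_mul] at key
  refine key.trans ?_
  rw [Finset.mul_sum]
  refine Finset.sum_le_sum fun i _ => ?_
  rw [← Finset.mul_prod_erase _ _ (Finset.mem_univ i), if_pos rfl, mul_comm]
  have h1 : ‖(WithLp.toLp 1 (B i) : PiLp 1 fun _ : n => ℂ) - WithLp.toLp 1 (B' i)‖
      = ∑ k, ‖B i k - B' i k‖ := by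
    rw [← WithLp.toLp_sub, hnorm]
    rfl
  rw [h1]
  refine mul_le_mul_of_nonneg_right ?_ (Finset.sum_nonneg fun _ _ => norm_nonneg _)
  calc ∏ j ∈ Finset.univ.erase i, (if j = i then ∑ k, ‖B i k - B' i k‖ else
          max ‖(WithLp.toLp 1 (B j) : PiLp 1 fun _ : n => ℂ)‖
            ‖(WithLp.toLp 1 (B' j) : PiLp 1 fun _ : n => ℂ)‖)
      ≤ ∏ j ∈ Finset.univ.erase i, ρ j := by
        refine Finset.prod_le_prod (fun j _ => by positivity) fun j hj => ?_
        rw [if_neg (Finset.ne_of_mem_erase hj), hnorm, hnorm]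
        exact max_le (hB j) (hB' j)
    _ ≤ ∏ j, ρ j := by
        rw [← Finset.mul_prod_erase _ _ (Finset.mem_univ i)]
        exact le_mul_of_one_le_left
          (Finset.prod_nonneg fun j _ => zero_le_one.trans (hρ j)) (hρ i)

lemma sum_fin_pow_le {t : ℝ} (ht0 : 0 ≤ t) (ht1 : t < 1) (N : ℕ) :
    ∑ k : Fin N, t ^ (k : ℕ) ≤ (1 - t)⁻¹ := by
  rw [Fin.sum_univ_eq_sum_range fun k => t ^ k, ← tsum_geometric_of_lt_one ht0 ht1]
  exact (summable_geometric_of_lt_one ht0 ht1).sum_le_tsum _ fun i _ => pow_nonneg ht0 i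

/-- A determinant comparison for matrices whose rows are geometrically close to the identity. -/
lemma norm_det_sub_det_le_of_rows {N : ℕ} {B B' : Matrix (Fin N) (Fin N) ℂ} {w C : ℝ} (hw0 : 0 ≤ w)
    (hw1 : w < 1) (hC : 0 ≤ C) (hB : ∀ j : Fin N, ∑ k, ‖B j k‖ ≤ 1 + C * w ^ (j : ℕ))
    (hB' : ∀ j : Fin N, ∑ k, ‖B' j k‖ ≤ 1 + C * w ^ (j : ℕ)) :
    ‖B.det - B'.det‖ ≤ Real.exp (C * (1 - w)⁻¹) * ∑ j, ∑ k, ‖B j k - B' j k‖ := by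
  refine (norm_det_sub_det_le (fun j => ?_) hB hB').trans ?_
  · have := mul_nonneg hC (pow_nonneg hw0 (j : ℕ))
    linarith
  refine mul_le_mul_of_nonneg_right ?_
    (Finset.sum_nonneg fun _ _ => Finset.sum_nonneg fun _ _ => norm_nonneg _)
  calc ∏ j : Fin N, (1 + C * w ^ (j : ℕ)) ≤ ∏ j : Fin N, Real.exp (C * w ^ (j : ℕ)) :=
        Finset.prod_le_prod (fun j _ => by positivity) fun j _ => by
          rw [add_comm]
          exact Real.add_one_le_exp _
    _ = Real.exp (C * ∑ j : Fin N, w ^ (j : ℕ)) := by rw [← Real.exp_sum, Finset.mul_sum]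
    _ ≤ _ := by
        gcongr
        exact sum_fin_pow_le hw0 hw1 N

/-! ### Corners of operators -/

/-- The upper left `N × N` corner of the matrix of an operator. -/
def corner (N : ℕ) (X : EllTwo →L[ℂ] EllTwo) : Matrix (Fin N) (Fin N) ℂ :=
  Matrix.of fun j k => X (ellE k) j

lemma corner_apply (N : ℕ) (X : EllTwo →L[ℂ] EllTwo) (j k : Fin N) :
    corner N X j k = X (ellE k) j := rfl

lemma trunc_eq_sum (N : ℕ) (v : EllTwo) : trunc N v = ∑ i : Fin N, v i • ellE i := by
  ext j
  rw [trunc_apply, ← coordCLM_apply j (∑ i : Fin N, v i • ellE i), map_sum]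
  simp only [map_smul, coordCLM_apply, ellE_apply, smul_eq_mul, mul_ite, mul_one, mul_zero]
  split_ifs with h
  · rw [Finset.sum_eq_single (⟨j, h⟩ : Fin N)]
    · simp
    · intro b _ hb
      rw [if_neg]
      rintro rfl
      exact hb rfl
    · simp
  · refine (Finset.sum_eq_zero fun i _ => ?_).symm
    rw [if_neg]
    rintro rfl
    exact h i.2

lemma corner_mul_trunc_mul (N : ℕ) (X Y : EllTwo →L[ℂ] EllTwo) :
    corner N (X * trunc N * Y) = corner N X * corner N Y := by
  ext j k
  rw [corner_apply, Matrix.mul_apply, mul_apply_eq_comp, mul_apply_eq_comp, trunc_eq_sum, map_sum,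
    ← coordCLM_apply, map_sum]
  refine Finset.sum_congr rfl fun i _ => ?_
  rw [map_smul, map_smul, smul_eq_mul, mul_comm]
  rfl

lemma corner_trunc_mul (N : ℕ) (X : EllTwo →L[ℂ] EllTwo) :
    corner N (trunc N * X) = corner N X := by
  ext j k
  rw [corner_apply, mul_apply_eq_comp, trunc_apply, if_pos j.2]
  rfl

lemma trunc_ellE {N k : ℕ} (h : k < N) : trunc N (ellE k) = ellE k := by
  ext j
  rw [trunc_apply, ellE_apply]
  split_ifs <;> first | rfl | omega

lemma trunc_ellE_of_le {N k : ℕ} (h : N ≤ k) : trunc N (ellE k) = 0 := by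
  ext j
  rw [trunc_apply, ellE_apply]
  split_ifs <;> first | rfl | omega

lemma corner_mul_trunc (N : ℕ) (X : EllTwo →L[ℂ] EllTwo) :
    corner N (X * trunc N) = corner N X := by
  ext j k
  rw [corner_apply, mul_apply_eq_comp, trunc_ellE k.2]
  rfl

lemma corner_one (N : ℕ) : corner N 1 = 1 := by
  ext j k
  rw [corner_apply, one_apply_eq_self, ellE_apply, Matrix.one_apply]
  simp only [Fin.ext_iff]

lemma corner_add (N : ℕ) (X Y : EllTwo →L[ℂ] EllTwo) :
    corner N (X + Y) = corner N X + corner N Y := rfl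

lemma corner_smul (N : ℕ) (c : ℂ) (X : EllTwo →L[ℂ] EllTwo) :
    corner N (c • X) = c • corner N X := rfl

/-- The matrix of `X` is lower triangular. -/
def IsLower (X : EllTwo →L[ℂ] EllTwo) : Prop := ∀ N, trunc N * X = trunc N * X * trunc N

/-- The matrix of `X` is upper triangular. -/
def IsUpper (X : EllTwo →L[ℂ] EllTwo) : Prop := ∀ N, X * trunc N = trunc N * X * trunc N

/-- Lower triangular factors split off on the left and, in the next lemma, upper triangular ones on
the right; a product in the order upper times lower has no such rule. -/
lemma IsLower.corner_mul {X : EllTwo →L[ℂ] EllTwo} (hX : IsLower X) (N : ℕ)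
    (Y : EllTwo →L[ℂ] EllTwo) : corner N (X * Y) = corner N X * corner N Y := by
  rw [← corner_trunc_mul, ← mul_assoc, hX, ← corner_trunc_mul N X, ← corner_mul_trunc_mul]

lemma IsUpper.corner_mul {Y : EllTwo →L[ℂ] EllTwo} (hY : IsUpper Y) (N : ℕ)
    (X : EllTwo →L[ℂ] EllTwo) : corner N (X * Y) = corner N X * corner N Y := by
  rw [← corner_mul_trunc, mul_assoc, hY, ← mul_assoc, ← mul_assoc, corner_mul_trunc,
    corner_mul_trunc_mul]

lemma isLower_toep {c : ℤ → ℂ} (hc : Summable fun n => ‖c n‖) (h : ∀ n < 0, c n = 0) :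
    IsLower (toep c) := fun N => by
  refine ext_ellE fun j k => ?_
  simp only [mul_apply_eq_comp]
  by_cases hk : k < N
  · rw [trunc_ellE hk]
  · rw [trunc_ellE_of_le (not_lt.1 hk), map_zero, map_zero, trunc_apply, toep_apply_ellE hc]
    split_ifs with hj
    · rw [h _ (by omega)]
      rfl
    · rfl

lemma isUpper_toep {c : ℤ → ℂ} (hc : Summable fun n => ‖c n‖) (h : ∀ n, 0 < n → c n = 0) :
    IsUpper (toep c) := fun N => by
  refine ext_ellE fun j k => ?_
  simp only [mul_apply_eq_comp]
  by_cases hk : k < N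
  · rw [trunc_ellE hk, trunc_apply]
    split_ifs with hj
    · rfl
    · rw [toep_apply_ellE hc, h _ (by omega)]
  · rw [trunc_ellE_of_le (not_lt.1 hk), map_zero, map_zero]

lemma corner_toep {c : ℤ → ℂ} (hc : Summable fun n => ‖c n‖) (N : ℕ) :
    corner N (toep c) = Matrix.of fun j k : Fin N => c ((j : ℤ) - (k : ℤ)) := by
  ext j k
  rw [corner_apply, toep_apply_ellE hc]
  rfl

lemma det_corner_toep_of_lower {c : ℤ → ℂ} (hc : Summable fun n => ‖c n‖) (h : ∀ n < 0, c n = 0)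
    (h0 : c 0 = 1) (N : ℕ) : (corner N (toep c)).det = 1 := by
  rw [corner_toep hc, Matrix.det_of_isLowerTriangular]
  · simp [h0]
  · intro i j hij
    have : (i : ℕ) < j := hij
    exact h _ (by omega)

lemma det_corner_toep_of_upper {c : ℤ → ℂ} (hc : Summable fun n => ‖c n‖)
    (h : ∀ n, 0 < n → c n = 0) (h0 : c 0 = 1) (N : ℕ) : (corner N (toep c)).det = 1 := by
  rw [corner_toep hc, Matrix.det_of_isUpperTriangular]
  · simp [h0]
  · intro i j hij
    have : (j : ℕ) < i := hij
    exact h _ (by omega)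

/-! ### Determinants of corners of localized perturbations of the identity -/

lemma norm_powDiag_mul_apply_le {w : ℝ} (hw0 : 0 ≤ w) (hw1 : w ≤ 1) (M : EllTwo →L[ℂ] EllTwo)
    (v : EllTwo) (j : ℕ) : ‖(powDiag w * M) v j‖ ≤ w ^ j * (‖M‖ * ‖v‖) := by
  rw [mul_apply_eq_comp, powDiag_apply hw0 hw1, norm_mul, norm_pow, Complex.norm_real,
    Real.norm_of_nonneg hw0]
  gcongr
  exact (norm_apply_le _ j).trans (M.le_opNorm v)

lemma powDiag_ellE {x : ℝ} (hx0 : 0 ≤ x) (hx1 : x ≤ 1) (k : ℕ) :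
    powDiag x (ellE k) = (x : ℂ) ^ k • ellE k := by
  ext j
  rw [powDiag_apply hx0 hx1, lp.coeFn_smul, Pi.smul_apply, ellE_apply, smul_eq_mul]
  split_ifs with h
  · rw [h]
  · simp

lemma norm_localized_apply_le {w x : ℝ} (hw0 : 0 ≤ w) (hw1 : w ≤ 1) (hx0 : 0 ≤ x) (hx1 : x ≤ 1)
    (M : EllTwo →L[ℂ] EllTwo) (j k : ℕ) :
    ‖(powDiag w * M * powDiag x) (ellE k) j‖ ≤ ‖M‖ * w ^ j * x ^ k := by
  rw [mul_apply_eq_comp]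
  refine (norm_powDiag_mul_apply_le hw0 hw1 M _ j).trans (le_of_eq ?_)
  rw [powDiag_ellE hx0 hx1, norm_smul, norm_ellE, norm_pow, Complex.norm_real,
    Real.norm_of_nonneg hx0]
  ring

section Localized

variable {w x B : ℝ} {M : EllTwo →L[ℂ] EllTwo}

lemma norm_corner_sub_one_le (hw0 : 0 ≤ w) (hw1 : w < 1) (hx0 : 0 ≤ x) (hx1 : x < 1)
    (hM : ‖M‖ ≤ B) {N : ℕ} (j k : Fin N) :
    ‖corner N (1 + powDiag w * M * powDiag x) j k - (1 : Matrix (Fin N) (Fin N) ℂ) j k‖ ≤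
      B * w ^ (j : ℕ) * x ^ (k : ℕ) := by
  rw [corner_add, corner_one, Matrix.add_apply, add_sub_cancel_left, corner_apply]
  refine (norm_localized_apply_le hw0 hw1.le hx0 hx1.le M j k).trans ?_
  gcongr

lemma sum_norm_one_apply {N : ℕ} (j : Fin N) :
    ∑ k, ‖(1 : Matrix (Fin N) (Fin N) ℂ) j k‖ = 1 := by
  rw [Finset.sum_eq_single j]
  · simp
  · intro k _ hk
    rw [Matrix.one_apply_ne hk.symm, norm_zero]
  · simp

lemma sum_norm_corner_sub_one_le (hw0 : 0 ≤ w) (hw1 : w < 1) (hx0 : 0 ≤ x) (hx1 : x < 1)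
    (hM : ‖M‖ ≤ B) {N : ℕ} (j : Fin N) :
    ∑ k, ‖corner N (1 + powDiag w * M * powDiag x) j k - (1 : Matrix (Fin N) (Fin N) ℂ) j k‖ ≤
      B * (1 - x)⁻¹ * w ^ (j : ℕ) := by
  have hB : 0 ≤ B := (norm_nonneg _).trans hM
  calc _ ≤ ∑ k : Fin N, B * w ^ (j : ℕ) * x ^ (k : ℕ) :=
        Finset.sum_le_sum fun k _ => norm_corner_sub_one_le hw0 hw1 hx0 hx1 hM j k
    _ = B * w ^ (j : ℕ) * ∑ k : Fin N, x ^ (k : ℕ) := by rw [Finset.mul_sum]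
    _ ≤ B * w ^ (j : ℕ) * (1 - x)⁻¹ := by
        gcongr
        exact sum_fin_pow_le hx0 hx1 N
    _ = _ := by ring

lemma sum_norm_corner_le (hw0 : 0 ≤ w) (hw1 : w < 1) (hx0 : 0 ≤ x) (hx1 : x < 1)
    (hM : ‖M‖ ≤ B) {N : ℕ} (j : Fin N) :
    ∑ k, ‖corner N (1 + powDiag w * M * powDiag x) j k‖ ≤ 1 + B * (1 - x)⁻¹ * w ^ (j : ℕ) := by
  calc _ ≤ ∑ k, (‖(1 : Matrix (Fin N) (Fin N) ℂ) j k‖ +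
        ‖corner N (1 + powDiag w * M * powDiag x) j k - (1 : Matrix (Fin N) (Fin N) ℂ) j k‖) :=
        Finset.sum_le_sum fun k _ => norm_le_norm_add_norm_sub' _ _
    _ ≤ _ := by
        rw [Finset.sum_add_distrib, sum_norm_one_apply]
        gcongr
        exact sum_norm_corner_sub_one_le hw0 hw1 hx0 hx1 hM j

/-- Replacing the last row of the larger corner by that of the identity gives a matrix with the
determinant of the smaller corner. The change is confined to row `N`, where the perturbation has
size of order `w^N`. -/
lemma norm_det_corner_succ_sub_le (hw0 : 0 ≤ w) (hw1 : w < 1) (hx0 : 0 ≤ x) (hx1 : x < 1)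
    (hM : ‖M‖ ≤ B) (N : ℕ) :
    ‖(corner (N + 1) (1 + powDiag w * M * powDiag x)).det -
      (corner N (1 + powDiag w * M * powDiag x)).det‖ ≤
      Real.exp (B * (1 - x)⁻¹ * (1 - w)⁻¹) * (B * (1 - x)⁻¹ * w ^ N) := by
  have hB : 0 ≤ B := (norm_nonneg _).trans hM
  set X := 1 + powDiag w * M * powDiag x with hX
  set Y := (corner (N + 1) X).updateRow (Fin.last N) ((1 : Matrix _ _ ℂ) (Fin.last N)) with hY
  have hdet : Y.det = (corner N X).det := by
    rw [Matrix.det_succ_row Y (Fin.last N), Finset.sum_eq_single (Fin.last N)]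
    · have hsub : Y.submatrix (Fin.last N).succAbove (Fin.last N).succAbove = corner N X := by
        ext j k
        rw [Matrix.submatrix_apply, Fin.succAbove_last, hY,
          Matrix.updateRow_ne (Fin.castSucc_lt_last j).ne]
        rfl
      rw [hsub, hY, Matrix.updateRow_self, Matrix.one_apply_eq, mul_one, ← two_mul, pow_mul]
      simp
    · intro k _ hk
      rw [hY, Matrix.updateRow_self, Matrix.one_apply_ne hk.symm]
      simp
    · simp
  have hC : 0 ≤ B * (1 - x)⁻¹ := mul_nonneg hB (inv_nonneg.2 (by linarith))
  rw [← hdet]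
  refine (norm_det_sub_det_le_of_rows hw0 hw1 hC
    (fun j => sum_norm_corner_le hw0 hw1 hx0 hx1 hM j) fun j => ?_).trans ?_
  · by_cases hj : j = Fin.last N
    · rw [hj, hY, Matrix.updateRow_self, sum_norm_one_apply]
      have := mul_nonneg hC (pow_nonneg hw0 ((Fin.last N : Fin (N + 1)) : ℕ))
      linarith
    · rw [hY, Matrix.updateRow_ne hj]
      exact sum_norm_corner_le hw0 hw1 hx0 hx1 hM j
  · gcongr
    rw [Finset.sum_eq_single (Fin.last N)]
    · rw [hY]
      simp only [Matrix.updateRow_self]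
      exact (sum_norm_corner_sub_one_le hw0 hw1 hx0 hx1 hM (Fin.last N)).trans_eq
        (by rw [Fin.val_last])
    · intro j _ hj
      simp only [hY, Matrix.updateRow_ne hj, ← hX, sub_self, norm_zero, Finset.sum_const_zero]
    · simp

end Localized

/-! ### The limit of the determinants of multiplicative commutators -/

/-- A permutation other than the identity moves at least two indices, so after one factor is
differentiated an off-diagonal zero of the identity remains. -/
lemma hasDerivAt_det_of_eq_one {n : Type*} [Fintype n] [DecidableEq n] {B : ℂ → Matrix n n ℂ}
    {B' : Matrix n n ℂ} {s : ℂ} (hB : B s = 1)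
    (h : ∀ i j, HasDerivAt (fun u => B u i j) (B' i j) s) :
    HasDerivAt (fun u => (B u).det) B'.trace s := by
  simp only [Matrix.det_apply]
  have h1 := HasDerivAt.fun_sum (u := Finset.univ) fun (σ : Equiv.Perm n) _ =>
    (HasDerivAt.fun_finsetProd (u := Finset.univ) fun (i : n) _ => h (σ i) i).const_smul
      (Equiv.Perm.sign σ)
  refine h1.congr_deriv ?_
  rw [Finset.sum_eq_single (1 : Equiv.Perm n)]
  · simp [hB, Matrix.trace]
  · intro σ _ hσ
    obtain ⟨a, ha⟩ : ∃ a, σ a ≠ a := by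
      by_contra! hcon
      exact hσ (Equiv.ext hcon)
    have hz : ∀ i, ∏ j ∈ Finset.univ.erase i, B s (σ j) j = 0 := by
      intro i
      obtain ⟨b, hbi, hb⟩ : ∃ b, b ≠ i ∧ σ b ≠ b := by
        by_cases hai : a = i
        · exact ⟨σ a, hai ▸ ha, fun h => ha (σ.injective h)⟩
        · exact ⟨a, hai, ha⟩
      refine Finset.prod_eq_zero (Finset.mem_erase.2 ⟨hbi, Finset.mem_univ b⟩) ?_
      rw [hB, Matrix.one_apply_ne hb]
    simp [hz]
  · simp

lemma differentiable_det {n : Type*} [Fintype n] [DecidableEq n] {B : ℂ → Matrix n n ℂ}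
    (h : ∀ i j, Differentiable ℂ fun u => B u i j) : Differentiable ℂ fun u => (B u).det := by
  simp only [Matrix.det_apply]
  fun_prop

lemma hasDerivAt_corner_apply {X : ℂ → EllTwo →L[ℂ] EllTwo} {X' : EllTwo →L[ℂ] EllTwo} {s : ℂ}
    (h : HasDerivAt X X' s) (N : ℕ) (j k : Fin N) :
    HasDerivAt (fun u => corner N (X u) j k) (corner N X' j k) s :=
  ((coordCLM j).comp (ContinuousLinearMap.apply ℂ EllTwo (ellE k))).hasFDerivAt.comp_hasDerivAt s h

/-- The functional equation propagates the derivative at `0` to `f' = c f`, so `f` times `e^{-cu}`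
is constant. -/
lemma eq_exp_of_map_add {f : ℂ → ℂ} {c : ℂ} (h0 : f 0 = 1) (hadd : ∀ s t, f (s + t) = f s * f t)
    (hd : HasDerivAt f c 0) (s : ℂ) : f s = Complex.exp (c * s) := by
  have hf : ∀ s, HasDerivAt f (f s * c) s := fun s => by
    have h1 : HasDerivAt (fun u => f s * f (u - s)) (f s * c) s := by
      refine HasDerivAt.const_mul _ ?_
      have : HasDerivAt f c (s - s) := by rwa [sub_self]
      exact this.comp_sub_const s s
    refine h1.congr_of_eventuallyEq (Eventually.of_forall fun u => ?_)
    simp only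
    rw [← hadd, add_sub_cancel]
  have hg : ∀ u, HasDerivAt (fun u => f u * Complex.exp (-(c * u))) 0 u := fun u => by
    have h2 : HasDerivAt (fun u => Complex.exp (-(c * u))) (Complex.exp (-(c * u)) * -c) u := by
      have := ((hasDerivAt_id u).const_mul c).neg.cexp
      simpa using this
    refine ((hf u).mul h2).congr_deriv ?_
    ring
  have hconst := is_const_of_deriv_eq_zero (fun u => (hg u).differentiableAt)
    (fun u => (hg u).deriv) s 0
  simp only [h0, mul_zero, neg_zero, Complex.exp_zero, mul_one] at hconst
  rw [Complex.exp_neg] at hconst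
  exact (mul_inv_eq_one₀ (Complex.exp_ne_zero _)).1 hconst

lemma nontrivial_ellTwo : Nontrivial EllTwo :=
  ⟨ellE 0, 0, fun h => by simpa [h] using norm_ellE 0⟩

section

variable {w x : ℝ} {p q : EllTwo →L[ℂ] EllTwo}

/-- The corners of a product of the commutators `A_s`, `A_t` nearly multiply. -/
lemma tendsto_det_corner_expCommutator_add (hw0 : 0 ≤ w) (hw1 : w < 1) (hx0 : 0 ≤ x) (hx1 : x < 1)
    {p₁ : EllTwo →L[ℂ] EllTwo} (hp₁ : p * powDiag w = powDiag w * p₁)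
    (hA : ∀ s : ℂ, ∃ M, expCommutator p q s = 1 + powDiag w * M * powDiag x)
    (hlower : ∀ t : ℂ, IsLower (NormedSpace.exp (t • p))) (s t : ℂ) :
    Tendsto (fun N => (corner N (expCommutator p q (s + t))).det -
      (corner N (expCommutator p q s)).det * (corner N (expCommutator p q t)).det) atTop
      (𝓝 0) := by
  have hneg : NormedSpace.exp (-(t • p)) = NormedSpace.exp ((-t) • p) := by rw [neg_smul]
  set R := NormedSpace.exp (-(t • p)) with hR
  set Z := NormedSpace.exp (t • p) * expCommutator p q t with hZ
  obtain ⟨M, hM⟩ := hA s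
  obtain ⟨M', hM'⟩ := hA (s + t)
  have hRlow : IsLower R := hneg ▸ hlower (-t)
  have hRD : ∃ l, R * powDiag w = powDiag w * l := by
    have : SemiconjBy (powDiag w) (-(t • p₁)) (-(t • p)) := by
      rw [SemiconjBy, mul_neg, neg_mul, mul_smul_comm, smul_mul_assoc, hp₁]
    have : NormedAlgebra ℚ (EllTwo →L[ℂ] EllTwo) := NormedAlgebra.restrictScalars ℚ ℂ _
    exact ⟨_, (SemiconjBy.exp_right ‹_›).symm⟩
  obtain ⟨l, hl⟩ := hRD
  let B : (N : ℕ) → Matrix (Fin N) (Fin N) ℂ := fun N => corner N (expCommutator p q (s + t))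
  let B' : (N : ℕ) → Matrix (Fin N) (Fin N) ℂ := fun N =>
    corner N R * corner N (expCommutator p q s) * (corner N (NormedSpace.exp (t • p)) *
      corner N (expCommutator p q t))
  have hdet : ∀ N, (B' N).det =
      (corner N (expCommutator p q s)).det * (corner N (expCommutator p q t)).det := by
    intro N
    have h1 : (corner N R).det * (corner N (NormedSpace.exp (t • p))).det = 1 := by
      rw [← Matrix.det_mul, ← hRlow.corner_mul, exp_neg_mul_exp_self, corner_one, Matrix.det_one]
    simp only [B', Matrix.det_mul]
    linear_combination
      (corner N (expCommutator p q s)).det * (corner N (expCommutator p q t)).det * h1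
  -- Inserting `P_N` between `A_s` and `Z` leaves the error `R A_s (1 - P_N) Z`. The identity part
  -- of `A_s` contributes nothing to the corner, as `R` is lower triangular; the rest contains `E (1
  -- - P_N)`, of norm at most `x^N`.
  have hdiff : ∀ N, B N - B' N =
      corner N (powDiag w * (l * M * (powDiag x * (1 - trunc N)) * Z)) := by
    intro N
    have e1 : B N = corner N (R * (expCommutator p q s * Z)) := by
      simp only [B]
      rw [expCommutator_add]
      simp only [hZ, hR, mul_assoc]
    have e2 : B' N = corner N (R * (expCommutator p q s * trunc N * Z)) := by
      simp only [B']
      rw [← (hlower t).corner_mul, ← hZ, mul_assoc, ← corner_mul_trunc_mul, ← hRlow.corner_mul]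
    have e3 : corner N (R * ((1 - trunc N) * Z)) = 0 := by
      rw [hRlow.corner_mul, sub_mul, one_mul]
      have : corner N (Z - trunc N * Z) = 0 := by
        rw [sub_eq_add_neg, corner_add, ← neg_one_smul ℂ, corner_smul, corner_trunc_mul]
        simp
      rw [this, mul_zero]
    have e4 : R * (expCommutator p q s * Z) = R * (expCommutator p q s * trunc N * Z) +
        (R * ((1 - trunc N) * Z) + powDiag w * (l * M * (powDiag x * (1 - trunc N)) * Z)) := by
      rw [← mul_assoc (powDiag w), ← mul_assoc (powDiag w), ← mul_assoc (powDiag w), ← hl, hM]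
      noncomm_ring
    rw [e1, e4, corner_add, corner_add, e3, e2, zero_add, add_sub_cancel_left]
  set K := ‖l * M‖ * ‖Z‖ with hK
  have hK0 : 0 ≤ K := by positivity
  have hentry : ∀ N (j k : Fin N), ‖B N j k - B' N j k‖ ≤ w ^ (j : ℕ) * (K * x ^ N) := by
    intro N j k
    rw [← Matrix.sub_apply, hdiff, corner_apply]
    refine (norm_powDiag_mul_apply_le hw0 hw1.le _ _ j).trans ?_
    rw [norm_ellE, mul_one]
    gcongr
    calc _ ≤ ‖l * M‖ * ‖powDiag x * (1 - trunc N)‖ * ‖Z‖ := norm_mul₃_le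
      _ ≤ ‖l * M‖ * x ^ N * ‖Z‖ := by
          gcongr
          exact norm_powDiag_mul_one_sub_trunc_le hx0 hx1.le N
      _ = _ := by rw [hK]; ring
  have hrow : ∀ N (j : Fin N), ∑ k, ‖B N j k - B' N j k‖ ≤ w ^ (j : ℕ) * (K * (N * x ^ N)) := by
    intro N j
    refine (Finset.sum_le_sum fun k _ => hentry N j k).trans_eq ?_
    rw [Finset.sum_const, Finset.card_univ, Fintype.card_fin, nsmul_eq_mul]
    ring
  have hNx : Tendsto (fun N : ℕ => (N : ℝ) * x ^ N) atTop (𝓝 0) :=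
    tendsto_self_mul_const_pow_of_lt_one hx0 hx1
  obtain ⟨L, hL⟩ := hNx.bddAbove_range
  replace hL : ∀ N : ℕ, (N : ℝ) * x ^ N ≤ L := fun N => hL ⟨N, rfl⟩
  set C₁ := ‖M'‖ * (1 - x)⁻¹
  have hC₁ : 0 ≤ C₁ := mul_nonneg (norm_nonneg _) (inv_nonneg.2 (by linarith))
  have hL0 : 0 ≤ L := by simpa using hL 0
  have hB1 : ∀ N (j : Fin N), ∑ k, ‖B N j k‖ ≤ 1 + C₁ * w ^ (j : ℕ) := by
    intro N j
    simp only [B, hM']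
    exact sum_norm_corner_le hw0 hw1 hx0 hx1 le_rfl j
  -- The row sums of `B'` are controlled through those of `B` and the difference; summing the
  -- entrywise bound over `N` columns gives `N x^N`, hence the constant `L`.
  have hmain : ∀ N, ‖(B N).det - (B' N).det‖ ≤
      Real.exp ((C₁ + K * L) * (1 - w)⁻¹) * ((1 - w)⁻¹ * (K * (N * x ^ N))) := by
    intro N
    refine (norm_det_sub_det_le_of_rows (C := C₁ + K * L) hw0 hw1 (by positivity) (fun j => ?_)
      fun j => ?_).trans ?_
    · refine (hB1 N j).trans ?_
      gcongr
      exact le_add_of_nonneg_right (by positivity)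
    · calc ∑ k, ‖B' N j k‖ ≤ ∑ k, (‖B N j k‖ + ‖B N j k - B' N j k‖) :=
            Finset.sum_le_sum fun k _ => norm_le_norm_add_norm_sub _ _
        _ ≤ (1 + C₁ * w ^ (j : ℕ)) + w ^ (j : ℕ) * (K * L) := by
            rw [Finset.sum_add_distrib]
            refine add_le_add (hB1 N j) ((hrow N j).trans ?_)
            gcongr
            exact hL N
        _ = _ := by ring
    · gcongr
      calc _ ≤ ∑ j : Fin N, w ^ (j : ℕ) * (K * (N * x ^ N)) := Finset.sum_le_sum fun j _ => hrow N j
        _ = (∑ j : Fin N, w ^ (j : ℕ)) * (K * (N * x ^ N)) := by rw [Finset.sum_mul]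
        _ ≤ _ := by
            gcongr
            exact sum_fin_pow_le hw0 hw1 N
  refine squeeze_zero_norm (fun N => ?_)
    (a := fun N : ℕ => Real.exp ((C₁ + K * L) * (1 - w)⁻¹) * ((1 - w)⁻¹ * (K * (N * x ^ N)))) ?_
  · rw [← hdet]
    exact hmain N
  · simpa using ((hNx.const_mul K).const_mul (1 - w)⁻¹).const_mul
      (Real.exp ((C₁ + K * L) * (1 - w)⁻¹))

/-- The determinants of the corners of `A_s = e^{-sp} e^q e^{sp} e^{-q}` converge to `e^{cs}`, where
`c` is the trace of the derivative of `A_s` at `s = 0`. -/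
lemma tendsto_det_corner_expCommutator (hw0 : 0 ≤ w) (hw1 : w < 1) (hx0 : 0 ≤ x) (hx1 : x < 1)
    {M p₁ p₂ q₁ q₂ : EllTwo →L[ℂ] EllTwo} (hM : q * p - p * q = powDiag w * M * powDiag x)
    (hp₁ : p * powDiag w = powDiag w * p₁) (hp₂ : powDiag x * p = p₂ * powDiag x)
    (hq₁ : q * powDiag w = powDiag w * q₁) (hq₂ : powDiag x * q = q₂ * powDiag x)
    (hlower : ∀ t : ℂ, IsLower (NormedSpace.exp (t • p))) {c : ℂ}
    (hc : Tendsto (fun N => (corner N (NormedSpace.exp q * p * NormedSpace.exp (-q) - p)).trace)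
      atTop (𝓝 c)) (s : ℂ) :
    Tendsto (fun N => (corner N (expCommutator p q s)).det) atTop (𝓝 (Complex.exp (c * s))) := by
  have : Nontrivial EllTwo := nontrivial_ellTwo
  let F : ℕ → ℂ → ℂ := fun N s => (corner N (expCommutator p q s)).det
  have hB := exists_expCommutator hM hp₁ hp₂ hq₁ hq₂
  have hA : ∀ s : ℂ, ∃ M, expCommutator p q s = 1 + powDiag w * M * powDiag x := fun s => by
    obtain ⟨B, hB⟩ := hB ‖s‖
    obtain ⟨M', hM', -⟩ := hB s le_rfl
    exact ⟨M', hM'⟩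
  have hstep : ∀ S : ℝ, ∃ C, ∀ s : ℂ, ‖s‖ ≤ S → ∀ N, dist (F N s) (F (N + 1) s) ≤ C * w ^ N := by
    intro S
    obtain ⟨B, hB⟩ := hB S
    refine ⟨Real.exp (B * (1 - x)⁻¹ * (1 - w)⁻¹) * (B * (1 - x)⁻¹), fun s hs N => ?_⟩
    obtain ⟨M', hM', hMB⟩ := hB s hs
    rw [dist_comm, dist_eq_norm, mul_assoc]
    simp only [F, hM']
    exact norm_det_corner_succ_sub_le hw0 hw1 hx0 hx1 hMB N
  have hlim : ∀ s, ∃ l, Tendsto (fun N => F N s) atTop (𝓝 l) := fun s => by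
    obtain ⟨C, hC⟩ := hstep ‖s‖
    exact cauchySeq_tendsto_of_complete (cauchySeq_of_le_geometric w C hw1 (hC s le_rfl))
  choose f hf using hlim
  -- The geometric bound on consecutive determinants is uniform for `s` in a disc. Locally uniform
  -- limits of holomorphic functions may be differentiated, so `f'(0)` is the limit of the traces.
  have hunif : TendstoLocallyUniformlyOn F f atTop Set.univ := by
    rw [Metric.tendstoLocallyUniformlyOn_iff]
    intro ε hε s _
    obtain ⟨C, hC⟩ := hstep (‖s‖ + 1)
    refine ⟨Metric.ball s 1, mem_nhdsWithin_of_mem_nhds (Metric.ball_mem_nhds s one_pos), ?_⟩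
    have h0 : Tendsto (fun N : ℕ => C * w ^ N / (1 - w)) atTop (𝓝 0) := by
      simpa using ((tendsto_pow_atTop_nhds_zero_of_lt_one hw0 hw1).const_mul C).div_const (1 - w)
    filter_upwards [h0.eventually_lt_const hε] with N hN u hu
    have hu' : ‖u‖ ≤ ‖s‖ + 1 := by
      have := norm_le_norm_add_norm_sub' u s
      rw [Metric.mem_ball, dist_eq_norm] at hu
      linarith
    rw [dist_comm]
    exact (dist_le_of_le_geometric_of_tendsto w C hw1 (hC u hu') (hf u) N).trans_lt hN
  have hFd : ∀ N, Differentiable ℂ (F N) := fun N => by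
    refine differentiable_det fun i j u => ?_
    obtain ⟨A', hA'⟩ := hasDerivAt_expCommutator p q u
    exact (hasDerivAt_corner_apply hA' N i j).differentiableAt
  have hderiv := hunif.deriv (Eventually.of_forall fun N => (hFd N).differentiableOn) isOpen_univ
  have hF0 : ∀ N, deriv (F N) 0 =
      (corner N (NormedSpace.exp q * p * NormedSpace.exp (-q) - p)).trace := fun N => by
    refine (hasDerivAt_det_of_eq_one ?_ fun i j =>
      hasDerivAt_corner_apply (hasDerivAt_expCommutator_zero p q) N i j).deriv
    rw [expCommutator_zero, corner_one]
  have hf0 : deriv f 0 = c := by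
    have h1 := hderiv.tendsto_at (Set.mem_univ 0)
    simp only [Function.comp_apply, hF0] at h1
    exact tendsto_nhds_unique h1 hc
  have hfd : DifferentiableAt ℂ f 0 :=
    (hunif.differentiableOn (Eventually.of_forall fun N => (hFd N).differentiableOn)
      isOpen_univ).differentiableAt univ_mem
  have hone : f 0 = 1 := by
    refine tendsto_nhds_unique (hf 0) ?_
    simp only [F, expCommutator_zero, corner_one, Matrix.det_one]
    exact tendsto_const_nhds
  have hadd : ∀ s t, f (s + t) = f s * f t := fun s t => by
    have h1 := tendsto_det_corner_expCommutator_add hw0 hw1 hx0 hx1 hp₁ hA hlower s t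
    have h2 := (hf (s + t)).sub ((hf s).mul (hf t))
    exact sub_eq_zero.1 (tendsto_nhds_unique h2 h1)
  have := eq_exp_of_map_add hone hadd (hf0 ▸ hfd.hasDerivAt) s
  rw [← this]
  exact hf s

end

/-! ### Additive Wiener–Hopf splitting of the logarithm -/

/-- `L` is continuous on the circle and its Fourier coefficients decay like those of an analytic
function on the annulus `r < |z| < R`. -/
structure HasLaurentDecay (L : ℂ → ℂ) (r R : ℝ) : Prop where
  continuousOn : ContinuousOn L 𝕊
  nonneg : 0 ≤ r
  lt_one : r < 1
  one_lt : 1 < R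
  summable : ∀ t, r < t → t < R → Summable fun n : ℤ => ‖fourierCoef L n‖ * t ^ n

/-- The coefficients `c_n` with `n > 0`. -/
def posCoef (c : ℤ → ℂ) (n : ℤ) : ℂ := if 0 < n then c n else 0

/-- The coefficients `c_n` with `n < 0`. -/
def negCoef (c : ℤ → ℂ) (n : ℤ) : ℂ := if n < 0 then c n else 0

lemma norm_posCoef_le (c : ℤ → ℂ) (n : ℤ) : ‖posCoef c n‖ ≤ ‖c n‖ := by
  rw [posCoef]
  split_ifs <;> simp

lemma norm_negCoef_le (c : ℤ → ℂ) (n : ℤ) : ‖negCoef c n‖ ≤ ‖c n‖ := by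
  rw [negCoef]
  split_ifs <;> simp

/-- The part of the Laurent series of `L` with positive exponents. -/
def posPartLaurent (L : ℂ → ℂ) : ℂ → ℂ := laurentSum (posCoef (fourierCoef L))

/-- The part of the Laurent series of `L` with negative exponents. -/
def negPartLaurent (L : ℂ → ℂ) : ℂ → ℂ := laurentSum (negCoef (fourierCoef L))

namespace HasLaurentDecay

variable {L : ℂ → ℂ} {r R : ℝ} (h : HasLaurentDecay L r R)
include h

lemma summable_of_norm_le {c : ℤ → ℂ} (hc : ∀ n, ‖c n‖ ≤ ‖fourierCoef L n‖) (t : ℝ) (hrt : r < t)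
    (htR : t < R) : Summable fun n : ℤ => ‖c n‖ * t ^ n := by
  have ht : 0 < t := h.nonneg.trans_lt hrt
  refine (h.summable t hrt htR).of_nonneg_of_le (fun n => by positivity) fun n => ?_
  gcongr
  exact hc n

lemma summable_norm_of_norm_le {c : ℤ → ℂ} (hc : ∀ n, ‖c n‖ ≤ ‖fourierCoef L n‖) :
    Summable fun n : ℤ => ‖c n‖ := by
  simpa using h.summable_of_norm_le hc 1 h.lt_one h.one_lt

lemma differentiableOn_posPart : DifferentiableOn ℂ (posPartLaurent L) (realAnnulus r R) :=
  differentiableOn_laurentSum h.nonneg (h.summable_of_norm_le (norm_posCoef_le _))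

lemma differentiableOn_negPart : DifferentiableOn ℂ (negPartLaurent L) (realAnnulus r R) :=
  differentiableOn_laurentSum h.nonneg (h.summable_of_norm_le (norm_negCoef_le _))

lemma fourierCoef_posPart : fourierCoef (posPartLaurent L) = posCoef (fourierCoef L) :=
  funext fun n => fourierCoef_laurentSum (h.summable_norm_of_norm_le (norm_posCoef_le _)) n

lemma fourierCoef_negPart : fourierCoef (negPartLaurent L) = negCoef (fourierCoef L) :=
  funext fun n => fourierCoef_laurentSum (h.summable_norm_of_norm_le (norm_negCoef_le _)) n

lemma isWiener {f : ℂ → ℂ} (hf : DifferentiableOn ℂ f (realAnnulus r R)) : IsWiener f :=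
  hf.isWiener h.nonneg h.lt_one h.one_lt

lemma eq_add {z : ℂ} (hz : z ∈ 𝕊) :
    L z = fourierCoef L 0 + (negPartLaurent L z + posPartLaurent L z) := by
  have hs := h.summable_norm_of_norm_le (c := fourierCoef L) fun _ => le_rfl
  refine (hasSum_fourierCoef_mul_zpow h.continuousOn hs hz).unique ?_
  have h1 := hasSum_laurentSum (h.summable_norm_of_norm_le (norm_posCoef_le _)) hz
  have h2 := hasSum_laurentSum (h.summable_norm_of_norm_le (norm_negCoef_le _)) hz
  have h3 := hasSum_ite_eq (0 : ℤ) (fourierCoef L 0)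
  convert h3.add (h2.add h1) using 2 with n
  rcases lt_trichotomy n 0 with hn | rfl | hn
  · simp [negCoef, posCoef, hn, hn.ne, hn.not_gt]
  · simp [negCoef, posCoef]
  · simp [negCoef, posCoef, hn, hn.ne', hn.not_gt]
  · rfl

lemma exp_smul_toep_posPart (t : ℂ) :
    NormedSpace.exp (t • toep (fourierCoef (posPartLaurent L))) =
      toep (fourierCoef fun z => Complex.exp (t * posPartLaurent L z)) ∧
    (∀ n < 0, fourierCoef (fun z => Complex.exp (t * posPartLaurent L z)) n = 0) ∧
    fourierCoef (fun z => Complex.exp (t * posPartLaurent L z)) 0 = 1 := by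
  have h1 := exp_toep_fourierCoef (h.differentiableOn_posPart.const_mul t) h.nonneg h.lt_one
    h.one_lt (Or.inl rfl) fun n hn => by
      rw [fourierCoef_const_mul, h.fourierCoef_posPart, posCoef, if_neg (by omega), mul_zero]
  have h2 : toep (fourierCoef fun z => t * posPartLaurent L z) =
      t • toep (fourierCoef (posPartLaurent L)) := by
    rw [← toep_const_mul (h.isWiener h.differentiableOn_posPart).summable]
    congr 1
    funext n
    rw [fourierCoef_const_mul]
  rw [h2] at h1
  refine ⟨h1.1, fun n hn => h1.2.1 n (by omega), ?_⟩
  rw [h1.2.2, fourierCoef_const_mul, h.fourierCoef_posPart]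
  simp [posCoef]

lemma exp_smul_toep_negPart (t : ℂ) :
    NormedSpace.exp (t • toep (fourierCoef (negPartLaurent L))) =
      toep (fourierCoef fun z => Complex.exp (t * negPartLaurent L z)) ∧
    (∀ n, 0 < n → fourierCoef (fun z => Complex.exp (t * negPartLaurent L z)) n = 0) ∧
    fourierCoef (fun z => Complex.exp (t * negPartLaurent L z)) 0 = 1 := by
  have h1 := exp_toep_fourierCoef (h.differentiableOn_negPart.const_mul t) h.nonneg h.lt_one
    h.one_lt (Or.inr rfl) fun n hn => by
      rw [fourierCoef_const_mul, h.fourierCoef_negPart, negCoef, if_neg (by omega), mul_zero]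
  have h2 : toep (fourierCoef fun z => t * negPartLaurent L z) =
      t • toep (fourierCoef (negPartLaurent L)) := by
    rw [← toep_const_mul (h.isWiener h.differentiableOn_negPart).summable]
    congr 1
    funext n
    rw [fourierCoef_const_mul]
  rw [h2] at h1
  refine ⟨h1.1, fun n hn => h1.2.1 n (by omega), ?_⟩
  rw [h1.2.2, fourierCoef_const_mul, h.fourierCoef_negPart]
  simp [negCoef]

lemma isWiener_exp_posPart (t : ℂ) : IsWiener fun z => Complex.exp (t * posPartLaurent L z) :=
  h.isWiener (h.differentiableOn_posPart.const_mul t).cexp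

lemma isWiener_exp_negPart (t : ℂ) : IsWiener fun z => Complex.exp (t * negPartLaurent L z) :=
  h.isWiener (h.differentiableOn_negPart.const_mul t).cexp

lemma isLower_exp (t : ℂ) :
    IsLower (NormedSpace.exp (t • toep (fourierCoef (posPartLaurent L)))) := by
  rw [(h.exp_smul_toep_posPart t).1]
  exact isLower_toep (h.isWiener_exp_posPart t).summable (h.exp_smul_toep_posPart t).2.1

lemma isUpper_exp (t : ℂ) :
    IsUpper (NormedSpace.exp (t • toep (fourierCoef (negPartLaurent L)))) := by
  rw [(h.exp_smul_toep_negPart t).1]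
  exact isUpper_toep (h.isWiener_exp_negPart t).summable (h.exp_smul_toep_negPart t).2.1

lemma det_corner_exp_posPart (t : ℂ) (N : ℕ) :
    (corner N (NormedSpace.exp (t • toep (fourierCoef (posPartLaurent L))))).det = 1 := by
  obtain ⟨h1, h2, h3⟩ := h.exp_smul_toep_posPart t
  rw [h1]
  exact det_corner_toep_of_lower (h.isWiener_exp_posPart t).summable h2 h3 N

lemma det_corner_exp_negPart (t : ℂ) (N : ℕ) :
    (corner N (NormedSpace.exp (t • toep (fourierCoef (negPartLaurent L))))).det = 1 := by
  obtain ⟨h1, h2, h3⟩ := h.exp_smul_toep_negPart t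
  rw [h1]
  exact det_corner_toep_of_upper (h.isWiener_exp_negPart t).summable h2 h3 N

lemma isWiener_of_exp_eq {f : ℂ → ℂ} (hf : ∀ z ∈ 𝕊, Complex.exp (L z) = f z) : IsWiener f := by
  refine (h.isWiener (f := fun z => Complex.exp (fourierCoef L 0) *
    (Complex.exp (1 * negPartLaurent L z) * Complex.exp (1 * posPartLaurent L z))) ?_).congr ?_
  · exact ((h.differentiableOn_negPart.const_mul 1).cexp.mul
      (h.differentiableOn_posPart.const_mul 1).cexp).const_mul _
  · intro z hz
    beta_reduce
    rw [← hf z hz, h.eq_add hz, Complex.exp_add, Complex.exp_add, one_mul, one_mul]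

/-- Wiener–Hopf factorization of the Toeplitz operator with symbol `exp L`. -/
lemma toep_eq {f : ℂ → ℂ} (hf : ∀ z ∈ 𝕊, Complex.exp (L z) = f z) :
    toep (fourierCoef f) = Complex.exp (fourierCoef L 0) •
      (NormedSpace.exp (toep (fourierCoef (negPartLaurent L))) *
        NormedSpace.exp (toep (fourierCoef (posPartLaurent L)))) := by
  have h1 := h.exp_smul_toep_negPart 1
  have h2 := h.exp_smul_toep_posPart 1
  rw [one_smul] at h1 h2
  have hW : IsWiener fun z => Complex.exp (1 * negPartLaurent L z) *
      Complex.exp (1 * posPartLaurent L z) :=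
    h.isWiener ((h.differentiableOn_negPart.const_mul 1).cexp.mul
      (h.differentiableOn_posPart.const_mul 1).cexp)
  rw [h1.1, h2.1, toep_fourierCoef_mul (h.isWiener_exp_negPart 1) (h.isWiener_exp_posPart 1) hW
    (Or.inl h1.2.1), ← toep_const_mul hW.summable]
  congr 1
  funext n
  rw [← fourierCoef_const_mul]
  refine fourierCoef_congr (fun z hz => ?_) n
  rw [← hf z hz, h.eq_add hz, Complex.exp_add, Complex.exp_add, one_mul, one_mul]

end HasLaurentDecay

/-! ### The trace of the infinitesimal commutator -/

lemma sum_range_sum_range_succ (a : ℕ → ℂ) (N : ℕ) :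
    ∑ j ∈ Finset.range N, ∑ n ∈ Finset.range (j + 1), a n =
      N * ∑ n ∈ Finset.range N, a n - ∑ n ∈ Finset.range N, n * a n := by
  induction N with
  | zero => simp
  | succ N ih =>
    rw [Finset.sum_range_succ, ih, Finset.sum_range_succ, Finset.sum_range_succ _ N]
    push_cast
    ring

/-- The boundary term `N ∑_{n<N} a_n` of the summation by parts equals `-N` times a tail, since the
full sum is `0`; it is dominated by a tail of `∑ n ‖a_n‖`. -/
lemma tendsto_sum_range_sum_range_succ {a : ℕ → ℂ} {b : ℂ} (ha : HasSum a 0)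
    (hb : HasSum (fun n : ℕ => (n : ℂ) * a n) b) :
    Tendsto (fun N => ∑ j ∈ Finset.range N, ∑ n ∈ Finset.range (j + 1), a n) atTop (𝓝 (-b)) := by
  simp only [sum_range_sum_range_succ]
  have h1 : Tendsto (fun N : ℕ => (N : ℂ) * ∑ n ∈ Finset.range N, a n) atTop (𝓝 0) := by
    have hn := hb.summable.norm
    refine squeeze_zero_norm (fun N => ?_) (tendsto_sum_nat_add fun n => ‖(n : ℂ) * a n‖)
    have h2 : ∑ n ∈ Finset.range N, a n = -∑' n, a (n + N) := by
      rw [eq_neg_iff_add_eq_zero, ha.summable.sum_add_tsum_nat_add N, ha.tsum_eq]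
    have hs : Summable fun n => ‖((n + N : ℕ) : ℂ) * a (n + N)‖ := (summable_nat_add_iff N).2 hn
    rw [h2, mul_neg, norm_neg, ← tsum_mul_left]
    have hle : ∀ n, ‖(N : ℂ) * a (n + N)‖ ≤ ‖((n + N : ℕ) : ℂ) * a (n + N)‖ := fun n => by
      rw [norm_mul, norm_mul, Complex.norm_natCast, Complex.norm_natCast]
      gcongr
      omega
    exact tsum_of_norm_bounded hs.hasSum hle
  simpa using h1.sub hb.tendsto_sum_nat

lemma hasSum_nat_of_hasSum_int {f : ℤ → ℂ} {s : ℂ} (hf : HasSum f s) (h0 : ∀ n < 0, f n = 0) :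
    HasSum (fun n : ℕ => f n) s := by
  refine (Function.Injective.hasSum_iff Nat.cast_injective fun n hn => h0 n ?_).2 hf
  by_contra hn'
  exact hn ⟨n.toNat, by simpa using hn'⟩

namespace HasLaurentDecay

variable {L : ℂ → ℂ} {r R : ℝ} (h : HasLaurentDecay L r R)
include h

/-- Convolve `L₊` with `z L₋'`, using `[z L₋']_{-n} = -n [L]_{-n}` for `n > 0`. -/
lemma hasSum_szego_terms_neg :
    HasSum (fun n : ℕ => -((n : ℂ) * fourierCoef L n * fourierCoef L (-n)))
      (fourierCoef (fun z => posPartLaurent L z * (z * deriv (negPartLaurent L) z)) 0) := by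
  have hop := isOpen_realAnnulus r R
  have hsub := sphere_subset_realAnnulus h.lt_one h.one_lt
  have hd := h.differentiableOn_negPart.deriv hop
  have hP := h.isWiener h.differentiableOn_posPart
  have hQ := h.isWiener (differentiableOn_id.mul hd)
  have hcoef : ∀ n : ℤ, fourierCoef (fun z => z * deriv (negPartLaurent L) z) n =
      n * negCoef (fourierCoef L) n := fun n => by
    rw [← h.fourierCoef_negPart]
    exact fourierCoef_mul_deriv (hd.continuousOn.mono hsub) (fun z hz =>
      (h.differentiableOn_negPart.differentiableAt
        (hop.mem_nhds (hsub hz))).hasDerivAt.hasDerivWithinAt) n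
  have h1 := hasSum_fourierCoef_mul hP.continuousOn hP.summable hQ.continuousOn 0
  have h2 := hasSum_nat_of_hasSum_int h1 fun n hn => by
    rw [h.fourierCoef_posPart, posCoef, if_neg (by omega), zero_mul]
  convert h2 using 2 with n
  have h3 : fourierCoef (id * deriv (negPartLaurent L)) (0 - n) =
      ((0 - n : ℤ) : ℂ) * negCoef (fourierCoef L) (0 - n) := hcoef _
  rw [h3, h.fourierCoef_posPart, posCoef, negCoef]
  rcases Nat.eq_zero_or_pos n with rfl | hn
  · simp
  · rw [if_pos (by omega), if_pos (by omega), zero_sub]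
    push_cast
    ring
  · rfl

lemma summable_szego_terms :
    Summable fun n : ℕ => (n : ℂ) * fourierCoef L n * fourierCoef L (-n) := by
  simpa using h.hasSum_szego_terms_neg.summable.neg

/-- With `g = e^{L₋} L₊` and `k = e^{-L₋}`, the `j`-th diagonal entry is the partial sum over `n ≤
j` of `g_n k_{-n}`, whose full sum is `[g k]_0 = [L₊]_0 = 0`. So the traces tend to `-∑ n g_n k_{-n}
= [g z k']_0`. As `z k' = -k z L₋'`, this is `-[L₊ z L₋']_0`, which is Szegő's sum. -/
lemma tendsto_trace_corner :
    Tendsto (fun N => (corner N (NormedSpace.exp (toep (fourierCoef (negPartLaurent L))) *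
      toep (fourierCoef (posPartLaurent L)) *
        NormedSpace.exp (-toep (fourierCoef (negPartLaurent L))) -
        toep (fourierCoef (posPartLaurent L)))).trace) atTop
      (𝓝 (∑' n : ℕ, (n : ℂ) * fourierCoef L n * fourierCoef L (-n))) := by
  have hop := isOpen_realAnnulus r R
  have hsub := sphere_subset_realAnnulus h.lt_one h.one_lt
  have hpd := h.differentiableOn_posPart
  have hmd := h.differentiableOn_negPart
  set P := posPartLaurent L
  set Q := negPartLaurent L
  set g : ℂ → ℂ := fun z => Complex.exp (1 * Q z) * P z with hg
  set k : ℂ → ℂ := fun z => Complex.exp (-1 * Q z) with hk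
  have hgd : DifferentiableOn ℂ g (realAnnulus r R) := (hmd.const_mul 1).cexp.mul hpd
  have hkd : DifferentiableOn ℂ k (realAnnulus r R) := (hmd.const_mul (-1)).cexp
  have hgW := h.isWiener hgd
  have hkW := h.isWiener hkd
  have hPW := h.isWiener hpd
  have hk0 : ∀ n, 0 < n → fourierCoef k n = 0 := (h.exp_smul_toep_negPart (-1)).2.1
  have e1 : NormedSpace.exp (toep (fourierCoef Q)) * toep (fourierCoef P) =
      toep (fourierCoef g) := by
    have := h.exp_smul_toep_negPart 1
    rw [one_smul] at this
    rw [this.1]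
    exact toep_fourierCoef_mul (h.isWiener_exp_negPart 1) hPW hgW (Or.inl this.2.1)
  have e2 : NormedSpace.exp (-toep (fourierCoef Q)) = toep (fourierCoef k) := by
    have := (h.exp_smul_toep_negPart (-1)).1
    rwa [neg_one_smul] at this
  rw [e1, e2]
  let a : ℕ → ℂ := fun n => fourierCoef g n * fourierCoef k (-n)
  have hdiag : ∀ j : ℕ, (toep (fourierCoef g) * toep (fourierCoef k)) (ellE j) j =
      ∑ n ∈ Finset.range (j + 1), a n := by
    intro j
    rw [mul_apply_eq_comp]
    have h1 := hasSum_toep_apply hgW.summable (toep (fourierCoef k) (ellE j)) j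
    simp only [shiftOp_toep_ellE hkW.summable, sub_self, zero_sub] at h1
    have h2 := hasSum_nat_of_hasSum_int h1 fun n hn => by
      rw [hk0 (-n) (by omega), ite_self, mul_zero]
    refine h2.unique ?_
    convert hasSum_sum_of_ne_finset_zero (s := Finset.range (j + 1)) (f := fun n : ℕ =>
      fourierCoef g n * if (n : ℤ) ≤ j then fourierCoef k (-n) else 0) ?_ using 1
    · refine Finset.sum_congr rfl fun n hn => ?_
      rw [if_pos (by have := Finset.mem_range.1 hn; omega)]
    · intro n hn
      rw [if_neg (by rw [Finset.mem_range] at hn; omega), mul_zero]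
    · infer_instance
  have htrace : ∀ N, (corner N (toep (fourierCoef g) * toep (fourierCoef k) -
      toep (fourierCoef P))).trace =
      ∑ j ∈ Finset.range N, ∑ n ∈ Finset.range (j + 1), a n := by
    intro N
    rw [Matrix.trace, ← Fin.sum_univ_eq_sum_range fun j => ∑ n ∈ Finset.range (j + 1), a n]
    refine Finset.sum_congr rfl fun j _ => ?_
    rw [Matrix.diag_apply, corner_apply, sub_apply, lp.coeFn_sub, Pi.sub_apply, hdiag,
      toep_apply_ellE hPW.summable, sub_self, h.fourierCoef_posPart]
    simp [posCoef]
  simp only [htrace]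
  have hgk : ∀ z, g z * k z = P z := fun z => by
    simp only [hg, hk]
    rw [mul_right_comm, ← Complex.exp_add]
    simp
  have ha : HasSum a 0 := by
    have h1 := hasSum_fourierCoef_mul hgW.continuousOn hgW.summable hkW.continuousOn 0
    simp only [hgk, zero_sub] at h1
    have h2 := hasSum_nat_of_hasSum_int h1 fun n hn => by
      rw [hk0 (-n) (by omega), mul_zero]
    have h3 : fourierCoef P 0 = 0 := by
      rw [h.fourierCoef_posPart]
      simp [posCoef]
    rwa [show (fun z => P z) = P from rfl, h3] at h2
  have hb : HasSum (fun n : ℕ => (n : ℂ) * a n)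
      (fourierCoef (fun z => P z * (z * deriv Q z)) 0) := by
    have hd := hmd.deriv hop
    have hk' : ∀ z ∈ realAnnulus r R, HasDerivAt k (k z * (-1 * deriv Q z)) z := fun z hz =>
      ((hmd.differentiableAt (hop.mem_nhds hz)).hasDerivAt.const_mul (-1)).cexp
    have hcoef : ∀ n : ℤ, fourierCoef (fun z => z * (k z * (-1 * deriv Q z))) n =
        n * fourierCoef k n :=
      fourierCoef_mul_deriv ((hkd.mul (hd.const_mul (-1))).continuousOn.mono hsub)
        fun z hz => (hk' z (hsub hz)).hasDerivWithinAt
    have hmW := h.isWiener (differentiableOn_id.mul (hkd.mul (hd.const_mul (-1))))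
    have h1 := (hasSum_fourierCoef_mul hgW.continuousOn hgW.summable hmW.continuousOn 0).neg
    have h2 := hasSum_nat_of_hasSum_int h1 fun n hn => by
      have : fourierCoef (id * fun z => k z * (-1 * deriv Q z)) (0 - n) =
        ((0 - n : ℤ) : ℂ) * fourierCoef k (0 - n) := hcoef _
      rw [neg_eq_zero]
      refine mul_eq_zero_of_right _ (this.trans ?_)
      rw [hk0 (0 - n) (by omega), mul_zero]
    convert h2 using 1
    · funext n
      have : fourierCoef (id * fun z => k z * (-1 * deriv Q z)) (0 - n) =
        ((0 - n : ℤ) : ℂ) * fourierCoef k (0 - n) := hcoef _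
      simp only [a]
      refine Eq.trans ?_ (congrArg (fun u => -(fourierCoef g n * u)) this.symm)
      rw [zero_sub]
      push_cast
      ring
    · rw [← neg_one_mul, ← fourierCoef_const_mul]
      congr 1
      funext z
      simp only [Pi.mul_apply, id]
      rw [← hgk z]
      ring
  have hlim := tendsto_sum_range_sum_range_succ ha hb
  have hval := h.hasSum_szego_terms_neg
  rw [hval.tsum_eq.symm, tsum_neg, neg_neg] at hlim
  exact hlim

end HasLaurentDecay

/-! ### Weights and Toeplitz operators -/

lemma exists_powDiag_mul_toep {c : ℤ → ℂ} {t : ℝ} (ht0 : 0 < t) (ht1 : t ≤ 1)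
    (hc : Summable fun n => ‖c n‖) (hct : Summable fun n : ℤ => ‖c n‖ * t ^ n) :
    ∃ l, powDiag t * toep c = l * powDiag t :=
  ⟨_, semiconjBy_powDiag_toep ht0 ht1 hc (by
    simpa [norm_mul, norm_zpow, Complex.norm_real, Real.norm_of_nonneg ht0.le] using hct)⟩

/-- The semiconjugation is applied to the rescaled coefficients `c_n t^{-n}`; this direction needs
decay on the larger circle of radius `1/t`. -/
lemma exists_toep_mul_powDiag {c : ℤ → ℂ} {t : ℝ} (ht0 : 0 < t) (ht1 : t ≤ 1)
    (hc : Summable fun n => ‖c n‖) (hct : Summable fun n : ℤ => ‖c n‖ * t⁻¹ ^ n) :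
    ∃ l, toep c * powDiag t = powDiag t * l := by
  have ht : (t : ℂ) ≠ 0 := by exact_mod_cast ht0.ne'
  have h1 : Summable fun n : ℤ => ‖c n * ((t : ℂ) ^ n)⁻¹‖ := by
    simpa [norm_mul, norm_zpow, Complex.norm_real, Real.norm_of_nonneg ht0.le] using hct
  have h2 : ∀ n : ℤ, c n * ((t : ℂ) ^ n)⁻¹ * (t : ℂ) ^ n = c n := fun n =>
    inv_mul_cancel_right₀ (zpow_ne_zero n ht) _
  have := semiconjBy_powDiag_toep (c := fun n => c n * ((t : ℂ) ^ n)⁻¹) ht0 ht1 h1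
    (by simpa only [h2] using hc)
  simp only [h2] at this
  exact ⟨_, this.symm⟩

/-! ### The finite section method for localized perturbations of the identity -/

/-- Diagonal operators commute, so the two weights meet in one diagonal supported on `j ≥ N`. This
is where the inner and outer decay rates multiply. -/
lemma norm_powDiag_mul_trunc_compl_mul_powDiag_le {w x : ℝ} (hw0 : 0 ≤ w) (hw1 : w ≤ 1)
    (hx0 : 0 ≤ x) (hx1 : x ≤ 1) (N : ℕ) :
    ‖powDiag x * (1 - trunc N) * powDiag w‖ ≤ (x * w) ^ N := by
  have : powDiag x * (1 - trunc N) * powDiag w = powDiag (x * w) * (1 - trunc N) := by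
    have h1 : (1 - trunc N) * powDiag w = powDiag w * (1 - trunc N) := by
      rw [sub_mul, mul_sub, one_mul, mul_one, trunc_mul_powDiag hw0 hw1]
    rw [mul_assoc, h1, ← mul_assoc, powDiag_mul_powDiag hx0 hx1 hw0 hw1]
  rw [this]
  exact norm_powDiag_mul_one_sub_trunc_le (mul_nonneg hx0 hw0) (mul_le_one₀ hx1 hw0 hw1) N

/-- The truncation `1 + P_N K P_N` of `1 + K`, with `K = D M E`. -/
def truncPerturbation (w x : ℝ) (M : EllTwo →L[ℂ] EllTwo) (N : ℕ) : EllTwo →L[ℂ] EllTwo :=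
  1 + trunc N * (powDiag w * M * powDiag x) * trunc N

section

variable {w x : ℝ} {M : EllTwo →L[ℂ] EllTwo}

lemma sub_truncPerturbation (N : ℕ) :
    1 + powDiag w * M * powDiag x - truncPerturbation w x M N =
      (1 - trunc N) * (powDiag w * M * powDiag x) +
        trunc N * (powDiag w * M * powDiag x) * (1 - trunc N) := by
  rw [truncPerturbation]
  noncomm_ring

lemma tendsto_truncPerturbation (hw0 : 0 ≤ w) (hw1 : w < 1) (hx0 : 0 ≤ x) (hx1 : x < 1) :
    Tendsto (truncPerturbation w x M) atTop (𝓝 (1 + powDiag w * M * powDiag x)) := by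
  rw [tendsto_iff_norm_sub_tendsto_zero]
  have hD := norm_powDiag_le hw0 hw1.le
  have hE := norm_powDiag_le hx0 hx1.le
  have h0 : Tendsto (fun N : ℕ => w ^ N * ‖M‖ + ‖M‖ * x ^ N) atTop (𝓝 0) := by
    simpa using ((tendsto_pow_atTop_nhds_zero_of_lt_one hw0 hw1).mul_const ‖M‖).add
      ((tendsto_pow_atTop_nhds_zero_of_lt_one hx0 hx1).const_mul ‖M‖)
  refine squeeze_zero (fun _ => norm_nonneg _) (fun N => ?_) h0
  rw [norm_sub_rev, sub_truncPerturbation]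
  have e1 : (1 - trunc N) * (powDiag w * M * powDiag x) =
      (powDiag w * (1 - trunc N)) * M * powDiag x := by
    rw [mul_sub, mul_one, ← trunc_mul_powDiag hw0 hw1.le]
    noncomm_ring
  have e2 : trunc N * (powDiag w * M * powDiag x) * (1 - trunc N) =
      (trunc N * powDiag w) * M * (powDiag x * (1 - trunc N)) := by noncomm_ring
  rw [e1, e2]
  refine (norm_add_le _ _).trans (add_le_add ?_ ?_)
  · calc _ ≤ ‖powDiag w * (1 - trunc N)‖ * ‖M‖ * ‖powDiag x‖ := norm_mul₃_le
      _ ≤ w ^ N * ‖M‖ * 1 := by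
          gcongr
          exact norm_powDiag_mul_one_sub_trunc_le hw0 hw1.le N
      _ = _ := mul_one _
  · have h1 : ‖trunc N * powDiag w‖ ≤ 1 :=
      (norm_mul_le _ _).trans (mul_le_one₀ (norm_trunc_le N) (norm_nonneg _) hD)
    calc _ ≤ ‖trunc N * powDiag w‖ * ‖M‖ * ‖powDiag x * (1 - trunc N)‖ := norm_mul₃_le
      _ ≤ 1 * ‖M‖ * x ^ N := by
          gcongr
          exact norm_powDiag_mul_one_sub_trunc_le hx0 hx1.le N
      _ = _ := by rw [one_mul]

/-- The truncations of an invertible `A` are eventually invertible with bounded inverses. -/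
lemma exists_truncPerturbation_inverse (hw0 : 0 ≤ w) (hw1 : w < 1) (hx0 : 0 ≤ x) (hx1 : x < 1)
    (hA : IsUnit (1 + powDiag w * M * powDiag x)) :
    ∃ β, ∀ᶠ N in atTop, ∃ B : EllTwo →L[ℂ] EllTwo, B * truncPerturbation w x M N = 1 ∧
      truncPerturbation w x M N * B = 1 ∧ ‖B‖ ≤ β := by
  have ht := tendsto_truncPerturbation (M := M) hw0 hw1 hx0 hx1
  obtain ⟨u, hu⟩ := hA
  rw [← hu] at ht
  have hinv := ((NormedRing.inverse_continuousAt u).tendsto.comp ht).norm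
  have h1 : ∀ᶠ N in atTop, IsUnit (truncPerturbation w x M N) :=
    ht.eventually (Units.isOpen.mem_nhds u.isUnit)
  refine ⟨‖Ring.inverse (u : EllTwo →L[ℂ] EllTwo)‖ + 1, ?_⟩
  filter_upwards [h1, hinv.eventually_lt_const (lt_add_one _)] with N hN hN'
  exact ⟨_, Ring.inverse_mul_cancel _ hN, Ring.mul_inverse_cancel _ hN, hN'.le⟩

/-- For `A = 1 + D M E` with truncation `A'`, start from `B - A⁻¹ = A⁻¹ (A - A') B`. The relations
`E A⁻¹ = U E` and `B D = D V` push the outer weights onto `A - A'`, and then every term contains `δ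
= E (1 - P) D`. The constant depends on `B` only through `β`. -/
lemma exists_finiteSection_bound (hw0 : 0 ≤ w) (hw1 : w < 1) (hx0 : 0 ≤ x) (hx1 : x < 1)
    {Ai : EllTwo →L[ℂ] EllTwo} (hAi : Ai * (1 + powDiag w * M * powDiag x) = 1) (β : ℝ)
    (ν : EllTwo →L[ℂ] ℂ) (y : EllTwo) :
    ∃ C, ∀ N (B : EllTwo →L[ℂ] EllTwo), B * truncPerturbation w x M N = 1 →
      truncPerturbation w x M N * B = 1 → ‖B‖ ≤ β →
      ‖ν ((powDiag x * (trunc N * B * trunc N) * powDiag w) y) -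
        ν ((powDiag x * Ai * powDiag w) y)‖ ≤ C * (x * w) ^ N := by
  set D := powDiag w
  set E := powDiag x
  have hD : ‖D‖ ≤ 1 := norm_powDiag_le hw0 hw1.le
  have hE : ‖E‖ ≤ 1 := norm_powDiag_le hx0 hx1.le
  set U := 1 - E * Ai * D * M with hU
  refine ⟨‖ν‖ * ((‖U‖ * ‖M‖ + ‖U‖ * ‖M‖) * (1 + ‖M‖ * β) + 1) * ‖y‖,
    fun N B hB1 hB2 hBβ => ?_⟩
  have hβ : 0 ≤ β := (norm_nonneg _).trans hBβ
  set P := trunc N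
  set A' := truncPerturbation w x M N with hA'
  have hA'def : A' = 1 + P * (D * M * E) * P := rfl
  have hP : P * P = P := trunc_mul_trunc N
  have hPn : ‖P‖ ≤ 1 := norm_trunc_le N
  have hPD : P * D = D * P := trunc_mul_powDiag hw0 hw1.le N
  have hPE : P * E = E * P := trunc_mul_powDiag hx0 hx1.le N
  set δ := E * (1 - P) * D with hδdef
  have hδ : ‖δ‖ ≤ (x * w) ^ N :=
    norm_powDiag_mul_trunc_compl_mul_powDiag_le hw0 hw1.le hx0 hx1.le N
  set V := 1 - P * M * E * P * B * D with hV
  have hVn : ‖V‖ ≤ 1 + ‖M‖ * β := by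
    have hone : ‖(1 : EllTwo →L[ℂ] EllTwo)‖ ≤ 1 := ContinuousLinearMap.norm_id_le
    have h1 : ‖P * M * E * P * B * D‖ ≤ 1 * ‖M‖ * 1 * 1 * β * 1 :=
      calc _ ≤ ‖P * M * E * P * B‖ * ‖D‖ := norm_mul_le _ _
        _ ≤ ‖P * M * E * P‖ * ‖B‖ * ‖D‖ := by gcongr; exact norm_mul_le _ _
        _ ≤ ‖P * M * E‖ * ‖P‖ * ‖B‖ * ‖D‖ := by gcongr; exact norm_mul_le _ _
        _ ≤ ‖P‖ * ‖M‖ * ‖E‖ * ‖P‖ * ‖B‖ * ‖D‖ := by gcongr; exact norm_mul₃_le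
        _ ≤ _ := by gcongr
    calc ‖V‖ ≤ ‖(1 : EllTwo →L[ℂ] EllTwo)‖ + ‖P * M * E * P * B * D‖ := norm_sub_le _ _
      _ ≤ 1 + ‖M‖ * β := add_le_add hone (by simpa using h1)
  have hBD : B * D = D * V := by
    have e1 : B = 1 - P * (D * M * E) * P * B := by
      rw [eq_sub_iff_add_eq, ← hB2, hA'def]
      noncomm_ring
    calc B * D = (1 - P * (D * M * E) * P * B) * D := by rw [← e1]
      _ = D - (P * D) * M * E * P * B * D := by noncomm_ring
      _ = D * V := by rw [hPD, hV]; noncomm_ring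
  have hEA : E * Ai = U * E := by
    have e1 : Ai = 1 - Ai * D * M * E := by
      rw [eq_sub_iff_add_eq, ← hAi]
      noncomm_ring
    calc E * Ai = E * (1 - Ai * D * M * E) := by rw [← e1]
      _ = U * E := by rw [hU]; noncomm_ring
  -- `A'` is the identity on the range of `1 - P`, hence so is `B`; cutting this part off adds one
  -- further `-δ` to the error.
  have hPBP : P * B * P = B - (1 - P) := by
    have hcomm : P * A' = A' * P := by
      rw [hA'def, mul_add, add_mul, mul_one, one_mul, ← mul_assoc, ← mul_assoc, hP,
        mul_assoc _ P P, hP]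
    have hPB : P * B = B * P := by
      calc P * B = B * A' * P * B := by rw [hB1, one_mul]
        _ = B * (P * A') * B := by rw [hcomm]; noncomm_ring
        _ = B * P * (A' * B) := by noncomm_ring
        _ = B * P := by rw [hB2, mul_one]
    have hAQ : A' * (1 - P) = 1 - P := by
      have : P * (1 - P) = 0 := by rw [mul_sub, mul_one, hP, sub_self]
      rw [hA'def, add_mul, one_mul, mul_assoc _ P, this, mul_zero, add_zero]
    have hBQ : B * (1 - P) = 1 - P := by
      rw [← hAQ, ← mul_assoc, hB1, one_mul, hAQ]
    rw [hPB, mul_assoc, hP, ← hBQ]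
    noncomm_ring
  have hBA : B - Ai = Ai * (1 + D * M * E - A') * B := by
    rw [mul_sub, sub_mul, hAi, one_mul, mul_assoc, hB2, mul_one]
  have hmain : E * (P * B * P) * D - E * Ai * D =
      U * (δ * M * (E * D) + P * E * D * M * δ) * V - δ := by
    have e0 : 1 + D * M * E - A' = (1 - P) * (D * M * E) + P * (D * M * E) * (1 - P) :=
      sub_truncPerturbation N
    have e1 : E * (P * B * P) * D - E * Ai * D = E * (B - Ai) * D - δ := by
      rw [hPBP, hδdef]
      noncomm_ring
    have e2 : E * (B - Ai) * D = (E * Ai) * (1 + D * M * E - A') * (B * D) := by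
      rw [hBA]
      noncomm_ring
    have e3 : E * (1 + D * M * E - A') * D = δ * M * (E * D) + P * E * D * M * δ := by
      rw [e0, hPE, hδdef]
      noncomm_ring
    rw [e1, e2, hEA, hBD, ← e3]
    noncomm_ring
  have hn : ‖E * (P * B * P) * D - E * Ai * D‖ ≤
      ((‖U‖ * ‖M‖ + ‖U‖ * ‖M‖) * (1 + ‖M‖ * β) + 1) * (x * w) ^ N := by
    have t1 : ‖δ * M * (E * D)‖ ≤ (x * w) ^ N * ‖M‖ * 1 :=
      norm_mul₃_le.trans (by
        gcongr
        exact (norm_mul_le _ _).trans (mul_le_one₀ hE (norm_nonneg _) hD))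
    have t2 : ‖P * E * D * M * δ‖ ≤ 1 * 1 * 1 * ‖M‖ * (x * w) ^ N :=
      calc _ ≤ ‖P * E * D * M‖ * ‖δ‖ := norm_mul_le _ _
        _ ≤ ‖P * E * D‖ * ‖M‖ * ‖δ‖ := by gcongr; exact norm_mul_le _ _
        _ ≤ ‖P‖ * ‖E‖ * ‖D‖ * ‖M‖ * ‖δ‖ := by gcongr; exact norm_mul₃_le
        _ ≤ _ := by gcongr
    rw [hmain]
    calc _ ≤ ‖U * (δ * M * (E * D) + P * E * D * M * δ) * V‖ + ‖δ‖ := norm_sub_le _ _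
      _ ≤ ‖U‖ * ‖δ * M * (E * D) + P * E * D * M * δ‖ * ‖V‖ + ‖δ‖ := by
          gcongr
          exact norm_mul₃_le
      _ ≤ ‖U‖ * ((x * w) ^ N * ‖M‖ * 1 + 1 * 1 * 1 * ‖M‖ * (x * w) ^ N) * (1 + ‖M‖ * β) +
          (x * w) ^ N := by
          gcongr
          exact (norm_add_le _ _).trans (add_le_add t1 t2)
      _ = _ := by ring
  rw [← map_sub, ← sub_apply]
  calc _ ≤ ‖ν‖ * ‖(E * (P * B * P) * D - E * Ai * D) y‖ := ν.le_opNorm _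
    _ ≤ ‖ν‖ * ((((‖U‖ * ‖M‖ + ‖U‖ * ‖M‖) * (1 + ‖M‖ * β) + 1) * (x * w) ^ N) * ‖y‖) := by
        gcongr
        exact ContinuousLinearMap.le_of_opNorm_le _ hn y
    _ = _ := by ring

end

/-! ### Operators with a localized Wiener–Hopf factorization -/

lemma exists_exp_neg_mul {A : Type*} [NormedRing A] [NormedAlgebra ℂ A] [CompleteSpace A]
    {p p₁ D : A} (h : p * D = D * p₁) :
    ∃ l, NormedSpace.exp (-p) * D = D * l := by
  have : SemiconjBy D (-p₁) (-p) := by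
    rw [SemiconjBy, mul_neg, neg_mul, h]
  have : NormedAlgebra ℚ A := NormedAlgebra.restrictScalars ℚ ℂ A
  exact ⟨_, (SemiconjBy.exp_right ‹_›).symm⟩

lemma exists_mul_exp_neg {A : Type*} [NormedRing A] [NormedAlgebra ℂ A] [CompleteSpace A]
    {q q₂ E : A} (h : E * q = q₂ * E) :
    ∃ l, E * NormedSpace.exp (-q) = l * E := by
  have : SemiconjBy E (-q) (-q₂) := by
    rw [SemiconjBy, mul_neg, neg_mul, h]
  have : NormedAlgebra ℚ A := NormedAlgebra.restrictScalars ℚ ℂ A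
  exact ⟨_, SemiconjBy.exp_right ‹_›⟩

/-- This turns upper times lower into lower times `A` times upper, the order in which corners
multiply. -/
lemma exp_mul_expCommutator_one_mul_exp {A : Type*} [NormedRing A] [NormedAlgebra ℂ A]
    [CompleteSpace A] (p q : A) :
    NormedSpace.exp p * expCommutator p q 1 * NormedSpace.exp q =
      NormedSpace.exp q * NormedSpace.exp p := by
  rw [expCommutator, one_smul]
  calc _ = (NormedSpace.exp p * NormedSpace.exp (-p)) * NormedSpace.exp q * NormedSpace.exp p *
        (NormedSpace.exp (-q) * NormedSpace.exp q) := by noncomm_ring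
    _ = _ := by rw [exp_mul_exp_neg_self, exp_neg_mul_exp_self, one_mul, mul_one]

/-- The inverse of `expCommutator p q 1`. -/
def expCommutatorInv {A : Type*} [NormedRing A] [NormedAlgebra ℂ A] (p q : A) : A :=
  NormedSpace.exp q * NormedSpace.exp (-p) * NormedSpace.exp (-q) * NormedSpace.exp p

section

variable {A : Type*} [NormedRing A] [NormedAlgebra ℂ A] [CompleteSpace A] (p q : A)

lemma expCommutatorInv_mul : expCommutatorInv p q * expCommutator p q 1 = 1 := by
  rw [expCommutator, expCommutatorInv, one_smul]
  calc _ = NormedSpace.exp q * NormedSpace.exp (-p) * (NormedSpace.exp (-q) *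
        ((NormedSpace.exp p * NormedSpace.exp (-p)) * NormedSpace.exp q)) * NormedSpace.exp p *
        NormedSpace.exp (-q) := by noncomm_ring
    _ = NormedSpace.exp q * (NormedSpace.exp (-p) * NormedSpace.exp p) * NormedSpace.exp (-q) := by
        rw [exp_mul_exp_neg_self, one_mul, exp_neg_mul_exp_self, mul_one]
        noncomm_ring
    _ = 1 := by rw [exp_neg_mul_exp_self, mul_one, exp_mul_exp_neg_self]

lemma mul_expCommutatorInv : expCommutator p q 1 * expCommutatorInv p q = 1 := by
  rw [expCommutator, expCommutatorInv, one_smul]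
  calc _ = NormedSpace.exp (-p) * NormedSpace.exp q * (NormedSpace.exp p *
        ((NormedSpace.exp (-q) * NormedSpace.exp q) * NormedSpace.exp (-p))) *
        NormedSpace.exp (-q) * NormedSpace.exp p := by noncomm_ring
    _ = NormedSpace.exp (-p) * (NormedSpace.exp q * NormedSpace.exp (-q)) * NormedSpace.exp p := by
        rw [exp_neg_mul_exp_self, one_mul, exp_mul_exp_neg_self, mul_one]
        noncomm_ring
    _ = 1 := by rw [exp_mul_exp_neg_self, mul_one, exp_neg_mul_exp_self]

lemma exp_neg_mul_expCommutatorInv_mul_exp_neg :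
    NormedSpace.exp (-q) * expCommutatorInv p q * NormedSpace.exp (-p) =
      NormedSpace.exp (-p) * NormedSpace.exp (-q) := by
  rw [expCommutatorInv]
  calc _ = (NormedSpace.exp (-q) * NormedSpace.exp q) * NormedSpace.exp (-p) *
        NormedSpace.exp (-q) * (NormedSpace.exp p * NormedSpace.exp (-p)) := by noncomm_ring
    _ = _ := by rw [exp_mul_exp_neg_self, exp_neg_mul_exp_self, one_mul, mul_one]

lemma inverse_smul_exp_mul_exp {g : ℂ} (hg : g ≠ 0) :
    IsUnit (g • (NormedSpace.exp q * NormedSpace.exp p)) ∧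
    Ring.inverse (g • (NormedSpace.exp q * NormedSpace.exp p)) =
      g⁻¹ • (NormedSpace.exp (-p) * NormedSpace.exp (-q)) := by
  have h1 : (g • (NormedSpace.exp q * NormedSpace.exp p)) *
      (g⁻¹ • (NormedSpace.exp (-p) * NormedSpace.exp (-q))) = 1 := by
    rw [smul_mul_smul_comm, mul_inv_cancel₀ hg, one_smul]
    calc _ = NormedSpace.exp q * (NormedSpace.exp p * NormedSpace.exp (-p)) *
          NormedSpace.exp (-q) := by noncomm_ring
      _ = 1 := by rw [exp_mul_exp_neg_self, mul_one, exp_mul_exp_neg_self]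
  have h2 : (g⁻¹ • (NormedSpace.exp (-p) * NormedSpace.exp (-q))) *
      (g • (NormedSpace.exp q * NormedSpace.exp p)) = 1 := by
    rw [smul_mul_smul_comm, inv_mul_cancel₀ hg, one_smul]
    calc _ = NormedSpace.exp (-p) * (NormedSpace.exp (-q) * NormedSpace.exp q) *
          NormedSpace.exp p := by noncomm_ring
      _ = 1 := by rw [exp_neg_mul_exp_self, mul_one, exp_neg_mul_exp_self]
  let u : Aˣ := ⟨_, _, h1, h2⟩
  exact ⟨u.isUnit, Ring.inverse_unit u⟩

end

/-- The operators `p` and `q` generate lower and upper triangular groups, are compatible with the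
weights `powDiag w` on the left and `powDiag x` on the right, and have a localized commutator. -/
structure IsLocalizedPair (p q : EllTwo →L[ℂ] EllTwo) (w x : ℝ) : Prop where
  w_nonneg : 0 ≤ w
  w_lt_one : w < 1
  x_nonneg : 0 ≤ x
  x_lt_one : x < 1
  commutator : ∃ M, q * p - p * q = powDiag w * M * powDiag x
  mul_powDiag_p : ∃ l, p * powDiag w = powDiag w * l
  powDiag_mul_p : ∃ l, powDiag x * p = l * powDiag x
  mul_powDiag_q : ∃ l, q * powDiag w = powDiag w * l
  powDiag_mul_q : ∃ l, powDiag x * q = l * powDiag x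
  isLower : ∀ t : ℂ, IsLower (NormedSpace.exp (t • p))
  isUpper : ∀ t : ℂ, IsUpper (NormedSpace.exp (t • q))

lemma commute_trunc_truncPerturbation (w x : ℝ) (M : EllTwo →L[ℂ] EllTwo) (N : ℕ) :
    trunc N * truncPerturbation w x M N = truncPerturbation w x M N * trunc N := by
  have hP := trunc_mul_trunc N
  rw [truncPerturbation, mul_add, add_mul, mul_one, one_mul, ← mul_assoc, ← mul_assoc, hP,
    mul_assoc _ (trunc N) (trunc N), hP]

lemma corner_truncPerturbation (w x : ℝ) (M : EllTwo →L[ℂ] EllTwo) (N : ℕ) :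
    corner N (truncPerturbation w x M N) = corner N (1 + powDiag w * M * powDiag x) := by
  rw [truncPerturbation, corner_add, corner_add, corner_mul_trunc, corner_trunc_mul]

lemma finE0_succ (N : ℕ) : finE0 (N + 1) = Pi.single 0 1 := by
  funext i
  rw [finE0, Pi.single_apply]
  congr 1
  rw [Fin.ext_iff, Fin.val_zero]

lemma finE0_dotProduct_mulVec_finE0 (N : ℕ) (C : Matrix (Fin (N + 1)) (Fin (N + 1)) ℂ) :
    finE0 (N + 1) ⬝ᵥ (C *ᵥ finE0 (N + 1)) = C 0 0 := by
  rw [finE0_succ, Matrix.mulVec_single_one, single_one_dotProduct]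
  rfl

namespace IsLocalizedPair

variable {p q : EllTwo →L[ℂ] EllTwo} {w x : ℝ}

lemma corner_exp_mul_exp (h : IsLocalizedPair p q w x) (g : ℂ) (N : ℕ) :
    corner N (g • (NormedSpace.exp q * NormedSpace.exp p)) =
      g • (corner N (NormedSpace.exp p) * corner N (expCommutator p q 1) *
        corner N (NormedSpace.exp q)) := by
  have h1 := h.isLower 1
  have h2 := h.isUpper 1
  rw [one_smul] at h1 h2
  rw [corner_smul, ← exp_mul_expCommutator_one_mul_exp, h2.corner_mul, h1.corner_mul]

/-- Finite sections converge geometrically in the upper left entry. -/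
lemma exists_finiteSection_rate (h : IsLocalizedPair p q w x) {g : ℂ} (hg : g ≠ 0)
    {S l : EllTwo →L[ℂ] EllTwo} (hS : S * powDiag w = powDiag w * l) :
    ∃ C, ∀ᶠ N in atTop, IsUnit (corner N (g • (NormedSpace.exp q * NormedSpace.exp p))) ∧
      ‖finE0 N ⬝ᵥ ((corner N (g • (NormedSpace.exp q * NormedSpace.exp p)))⁻¹ *ᵥ
          (corner N S *ᵥ finE0 N)) -
        Ring.inverse (g • (NormedSpace.exp q * NormedSpace.exp p)) (S (ellE 0)) 0‖ ≤
        C * (x * w) ^ N := by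
  have : Nontrivial EllTwo := nontrivial_ellTwo
  obtain ⟨M₀, hM₀⟩ := h.commutator
  obtain ⟨p₁, hp₁⟩ := h.mul_powDiag_p
  obtain ⟨p₂, hp₂⟩ := h.powDiag_mul_p
  obtain ⟨q₁, hq₁⟩ := h.mul_powDiag_q
  obtain ⟨q₂, hq₂⟩ := h.powDiag_mul_q
  obtain ⟨_, hB⟩ := exists_expCommutator hM₀ hp₁ hp₂ hq₁ hq₂ 1
  obtain ⟨M, hM, -⟩ := hB 1 (by simp)
  obtain ⟨l', hl'⟩ := exists_exp_neg_mul hp₁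
  obtain ⟨ρ, hρ⟩ := exists_mul_exp_neg hq₂
  have hAi := expCommutatorInv_mul p q
  have hAi' := mul_expCommutatorInv p q
  have hlow : IsLower (NormedSpace.exp (-p)) := by simpa using h.isLower (-1)
  have hlow1 : IsLower (NormedSpace.exp p) := by simpa using h.isLower 1
  have hup : IsUpper (NormedSpace.exp (-q)) := by simpa using h.isUpper (-1)
  have hAu : IsUnit (1 + powDiag w * M * powDiag x) :=
    hM ▸ (⟨_, _, hAi', hAi⟩ : (EllTwo →L[ℂ] EllTwo)ˣ).isUnit
  obtain ⟨β, hβ⟩ := exists_truncPerturbation_inverse h.w_nonneg h.w_lt_one h.x_nonneg h.x_lt_one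
    hAu
  obtain ⟨C, hC⟩ := exists_finiteSection_bound h.w_nonneg h.w_lt_one h.x_nonneg h.x_lt_one
    (hM ▸ hAi) β ((coordCLM 0).comp ρ) ((l' * l) (ellE 0))
  refine ⟨‖g⁻¹‖ * C, ?_⟩
  filter_upwards [hβ, eventually_ge_atTop 1] with N ⟨B, hB1, hB2, hBβ⟩ hN
  have hBA : corner N B * corner N (expCommutator p q 1) = 1 := by
    rw [hM, ← corner_truncPerturbation, ← corner_mul_trunc_mul, mul_assoc,
      commute_trunc_truncPerturbation, ← mul_assoc, hB1, one_mul, ← one_mul (trunc N),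
      corner_mul_trunc, corner_one]
  have hq : corner N (NormedSpace.exp (-q)) * corner N (NormedSpace.exp q) = 1 := by
    have h2 : IsUpper (NormedSpace.exp q) := by simpa using h.isUpper 1
    rw [← h2.corner_mul, exp_neg_mul_exp_self, corner_one]
  have hp : corner N (NormedSpace.exp (-p)) * corner N (NormedSpace.exp p) = 1 := by
    rw [← hlow.corner_mul, exp_neg_mul_exp_self, corner_one]
  have hinv : g⁻¹ • (corner N (NormedSpace.exp (-q)) * corner N B *
      corner N (NormedSpace.exp (-p))) *
        corner N (g • (NormedSpace.exp q * NormedSpace.exp p)) = 1 := by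
    rw [h.corner_exp_mul_exp, smul_mul_smul_comm, inv_mul_cancel₀ hg, one_smul]
    calc _ = corner N (NormedSpace.exp (-q)) * (corner N B * ((corner N (NormedSpace.exp (-p)) *
          corner N (NormedSpace.exp p)) * corner N (expCommutator p q 1))) *
          corner N (NormedSpace.exp q) := by noncomm_ring
      _ = 1 := by rw [hp, one_mul, hBA, mul_one, hq]
  refine ⟨(Matrix.isUnit_iff_isUnit_det _).2 (Matrix.isUnit_det_of_left_inverse hinv), ?_⟩
  rw [Matrix.inv_eq_left_inv hinv, (inverse_smul_exp_mul_exp p q hg).2]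
  -- As `D e₀ = e₀`, the vector `S e₀ = S D e₀` lies in the range of `D`, and `e^{-p}` preserves
  -- that range.
  have hy : NormedSpace.exp (-p) (S (ellE 0)) = powDiag w ((l' * l) (ellE 0)) := by
    have e1 : NormedSpace.exp (-p) * S * powDiag w = powDiag w * (l' * l) := by
      rw [mul_assoc, hS, ← mul_assoc, hl', mul_assoc]
    have e2 := congrArg (fun X : EllTwo →L[ℂ] EllTwo => X (ellE 0)) e1
    simpa only [mul_apply_eq_comp, powDiag_ellE_zero h.w_nonneg h.w_lt_one.le] using e2
  -- Dually, `E` does not change coordinate `0`, so it may be inserted in front of `e^{-q}` and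
  -- moved to its right.
  have hν : ∀ v, NormedSpace.exp (-q) v 0 = ((coordCLM 0).comp ρ) (powDiag x v) := by
    intro v
    have e1 := congrArg (fun X : EllTwo →L[ℂ] EllTwo => X v 0) hρ
    simp only [mul_apply_eq_comp, powDiag_apply h.x_nonneg h.x_lt_one.le, pow_zero, one_mul] at e1
    exact e1
  obtain ⟨N, rfl⟩ : ∃ n, N = n + 1 := ⟨N - 1, by omega⟩
  have hval : finE0 (N + 1) ⬝ᵥ ((g⁻¹ • (corner (N + 1) (NormedSpace.exp (-q)) * corner (N + 1) B *
      corner (N + 1) (NormedSpace.exp (-p)))) *ᵥ (corner (N + 1) S *ᵥ finE0 (N + 1))) =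
      g⁻¹ * ((coordCLM 0).comp ρ) ((powDiag x * (trunc (N + 1) * B * trunc (N + 1)) * powDiag w)
        ((l' * l) (ellE 0))) := by
    rw [Matrix.mulVec_mulVec, finE0_dotProduct_mulVec_finE0, smul_mul_assoc, mul_assoc,
      ← hlow.corner_mul, ← corner_mul_trunc_mul, ← corner_mul_trunc_mul, Matrix.smul_apply,
      smul_eq_mul, corner_apply]
    simp only [mul_apply_eq_comp, Fin.val_zero, hy, hν]
  have hlim : (g⁻¹ • (NormedSpace.exp (-p) * NormedSpace.exp (-q))) (S (ellE 0)) 0 =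
      g⁻¹ * ((coordCLM 0).comp ρ) ((powDiag x * expCommutatorInv p q * powDiag w)
        ((l' * l) (ellE 0))) := by
    rw [← exp_neg_mul_expCommutatorInv_mul_exp_neg]
    simp only [smul_apply, lp.coeFn_smul, Pi.smul_apply, smul_eq_mul, mul_apply_eq_comp, hy, hν]
  rw [hval, hlim, ← mul_sub, norm_mul, mul_assoc ‖g⁻¹‖]
  gcongr
  exact hC _ B hB1 hB2 hBβ

lemma det_corner_exp_mul_exp (h : IsLocalizedPair p q w x) (g : ℂ) {N : ℕ}
    (hp : (corner N (NormedSpace.exp p)).det = 1) (hq : (corner N (NormedSpace.exp q)).det = 1) :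
    (corner N (g • (NormedSpace.exp q * NormedSpace.exp p))).det =
      g ^ N * (corner N (expCommutator p q 1)).det := by
  rw [h.corner_exp_mul_exp, Matrix.det_smul, Matrix.det_mul, Matrix.det_mul, hp, hq,
    Fintype.card_fin, one_mul, mul_one]

lemma tendsto_det_corner_expCommutator_one (h : IsLocalizedPair p q w x) {c : ℂ}
    (hc : Tendsto (fun N => (corner N (NormedSpace.exp q * p * NormedSpace.exp (-q) - p)).trace)
      atTop (𝓝 c)) :
    Tendsto (fun N => (corner N (expCommutator p q 1)).det) atTop (𝓝 (Complex.exp c)) := by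
  obtain ⟨M, hM⟩ := h.commutator
  obtain ⟨p₁, hp₁⟩ := h.mul_powDiag_p
  obtain ⟨p₂, hp₂⟩ := h.powDiag_mul_p
  obtain ⟨q₁, hq₁⟩ := h.mul_powDiag_q
  obtain ⟨q₂, hq₂⟩ := h.powDiag_mul_q
  simpa using tendsto_det_corner_expCommutator h.w_nonneg h.w_lt_one h.x_nonneg h.x_lt_one hM
    hp₁ hp₂ hq₁ hq₂ h.isLower hc 1

end IsLocalizedPair

/-- A convergent sequence whose consecutive ratios converge geometrically converges
geometrically. -/
lemma exists_norm_sub_le_of_ratio {a d : ℕ → ℂ} {l e : ℂ} {ρ C : ℝ} (hρ0 : 0 < ρ) (hρ1 : ρ < 1)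
    (hd : Tendsto d atTop (𝓝 e)) (he : e ≠ 0) (ha : ∀ᶠ n in atTop, a n * d (n + 1) = d n)
    (hal : ∀ᶠ n in atTop, ‖a n - l‖ ≤ C * ρ ^ n) :
    (fun n => d n - e) =O[atTop] fun n => ρ ^ n := by
  have hd' : Tendsto (fun n => d (n + 1)) atTop (𝓝 e) := (tendsto_add_atTop_iff_nat 1).2 hd
  have hat : Tendsto a atTop (𝓝 l) := by
    rw [tendsto_iff_norm_sub_tendsto_zero]
    refine squeeze_zero' (Eventually.of_forall fun _ => norm_nonneg _) hal ?_
    simpa using (tendsto_pow_atTop_nhds_zero_of_lt_one hρ0.le hρ1).const_mul C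
  -- The limit of the ratios is forced by `a_n d_{n+1} = d_n` and `d_n → e ≠ 0`; no separate
  -- evaluation is needed.
  have hl : l = 1 := by
    have h1 := (hat.mul hd').congr' ha
    exact mul_right_cancel₀ he ((tendsto_nhds_unique h1 hd).trans (one_mul e).symm)
  obtain ⟨n₀, hn₀⟩ := eventually_atTop.1
    ((ha.and hal).and (hd'.norm.eventually_lt_const (lt_add_one ‖e‖)))
  have hC : 0 ≤ C * ρ ^ n₀ := (norm_nonneg _).trans (hn₀ n₀ le_rfl).1.2
  have hstep : ∀ n, dist (d (n + n₀)) (d (n + n₀ + 1)) ≤ ((‖e‖ + 1) * (C * ρ ^ n₀)) * ρ ^ n := by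
    intro n
    obtain ⟨⟨h1, h2⟩, h3⟩ := hn₀ (n + n₀) (by omega)
    rw [hl] at h2
    rw [dist_eq_norm]
    nth_rewrite 1 [← h1]
    calc ‖a (n + n₀) * d (n + n₀ + 1) - d (n + n₀ + 1)‖
        = ‖d (n + n₀ + 1)‖ * ‖a (n + n₀) - 1‖ := by rw [← norm_mul]; congr 1; ring
      _ ≤ (‖e‖ + 1) * (C * ρ ^ (n + n₀)) := by gcongr
      _ = _ := by rw [pow_add]; ring
  have hbd := dist_le_of_le_geometric_of_tendsto ρ _ hρ1 (f := fun n => d (n + n₀))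
    (fun n => by simpa [add_right_comm] using hstep n) ((tendsto_add_atTop_iff_nat n₀).2 hd)
  refine IsBigO.of_bound ((‖e‖ + 1) * (C * ρ ^ n₀) / (1 - ρ) / ρ ^ n₀) ?_
  filter_upwards [eventually_ge_atTop n₀] with n hn
  obtain ⟨m, rfl⟩ := Nat.exists_eq_add_of_le' hn
  rw [← dist_eq_norm, norm_pow, Real.norm_of_nonneg hρ0.le]
  refine (hbd m).trans (le_of_eq ?_)
  have : ρ ^ n₀ ≠ 0 := (pow_pos hρ0 _).ne'
  rw [pow_add]
  field_simp

/-! ### Toeplitz operators and matrices -/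

lemma IsWiener.isToeplitzOp_toep {f : ℂ → ℂ} (hf : IsWiener f) :
    IsToeplitzOp f (toep (fourierCoef f)) := fun j k => toep_apply_ellE hf.summable j k

lemma IsWiener.isToeplitzOp_toeplitzOp {f : ℂ → ℂ} (hf : IsWiener f) :
    IsToeplitzOp f (toeplitzOp f) := Classical.epsilon_spec ⟨_, hf.isToeplitzOp_toep⟩

lemma IsWiener.toeplitzOp_eq {f : ℂ → ℂ} (hf : IsWiener f) :
    toeplitzOp f = toep (fourierCoef f) :=
  ext_ellE fun j k => (hf.isToeplitzOp_toeplitzOp j k).trans (hf.isToeplitzOp_toep j k).symm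

lemma IsWiener.toeplitzMatrix_eq {f : ℂ → ℂ} (hf : IsWiener f) (N : ℕ) :
    toeplitzMatrix f N = corner N (toep (fourierCoef f)) := (corner_toep hf.summable N).symm

lemma toeplitzMatrix_submatrix_succ (f : ℂ → ℂ) (N : ℕ) :
    (toeplitzMatrix f (N + 1)).submatrix Fin.succ Fin.succ = toeplitzMatrix f N := by
  ext j k
  simp only [Matrix.submatrix_apply, toeplitzMatrix, Matrix.of_apply, Fin.val_succ]
  push_cast
  rw [add_sub_add_right_eq_sub]

/-- Deleting the first row and column of a Toeplitz matrix leaves the next smaller one, so this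
cofactor identity expresses ratios of consecutive Toeplitz determinants by an entry of the inverse.
-/
lemma inv_zero_zero_mul_det {N : ℕ} {T : Matrix (Fin (N + 1)) (Fin (N + 1)) ℂ} (hT : IsUnit T) :
    T⁻¹ 0 0 * T.det = (T.submatrix Fin.succ Fin.succ).det := by
  have hd := (Matrix.isUnit_iff_isUnit_det T).1 hT
  rw [Matrix.inv_def, Matrix.smul_apply, smul_eq_mul, Matrix.adjugate_fin_succ_eq_det_submatrix,
    mul_right_comm, Ring.inverse_mul_cancel _ hd]
  simp

/-- Cramer's rule for the bordered Toeplitz determinant. -/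
lemma borderedToeplitzDet_eq {φ ψ : ℂ → ℂ} {N : ℕ} (hN : 1 ≤ N)
    (hT : IsUnit (toeplitzMatrix φ N)) :
    borderedToeplitzDet φ ψ N = (toeplitzMatrix φ N).det * finF φ ψ N := by
  obtain ⟨N, rfl⟩ := Nat.exists_eq_add_of_le' hN
  have hd := (Matrix.isUnit_iff_isUnit_det _).1 hT
  have h0 := finE0_succ N
  have h1 := congrFun (Matrix.det_smul_inv_mulVec_eq_cramer (toeplitzMatrix φ (N + 1))
    (toeplitzMatrix ψ (N + 1) *ᵥ finE0 (N + 1)) hd) 0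
  rw [Matrix.cramer_apply, Pi.smul_apply, smul_eq_mul] at h1
  have h2 : finF φ ψ (N + 1) =
      ((toeplitzMatrix φ (N + 1))⁻¹ *ᵥ (toeplitzMatrix ψ (N + 1) *ᵥ finE0 (N + 1))) 0 := by
    rw [finF]
    nth_rewrite 1 [h0]
    exact single_one_dotProduct _ _
  -- Reversing the order of both rows and columns preserves the determinant and turns the bordered
  -- matrix into `T_N(φ)` with column `0` replaced by `T_N(ψ) e₀`, as Cramer's rule requires.
  rw [h2, h1, borderedToeplitzDet, ← Matrix.det_submatrix_equiv_self Fin.revPerm]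
  congr 1
  ext i j
  rw [Matrix.submatrix_apply, Matrix.of_apply, Matrix.updateCol_apply, Fin.revPerm_apply,
    Fin.revPerm_apply]
  have hi := i.2
  have hj := j.2
  have hi' : ((Fin.rev i : Fin (N + 1)) : ℕ) = N - i := by rw [Fin.val_rev]; omega
  have hj' : ((Fin.rev j : Fin (N + 1)) : ℕ) = N - j := by rw [Fin.val_rev]; omega
  rw [hi', hj']
  by_cases hj0 : j = 0
  · subst hj0
    rw [if_pos (by simp), if_pos rfl, h0, Matrix.mulVec_single_one]
    simp only [Matrix.col_apply, toeplitzMatrix, Matrix.of_apply]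
    congr 1
    simp only [Fin.val_zero]
    omega
  · have : (j : ℕ) ≠ 0 := fun h => hj0 (Fin.ext h)
    rw [if_neg (by omega), if_neg hj0, toeplitzMatrix, Matrix.of_apply]
    congr 1
    omega

namespace HasLaurentDecay

variable {L : ℂ → ℂ} {r R : ℝ}

/-- The two radii act separately: `r < x` makes the coefficients summable against `x^n`, and `w⁻¹ <
R` makes them summable against `w^{-n}`. -/
lemma isLocalizedPair (h : HasLaurentDecay L r R) {w x : ℝ} (hrx : r < x) (hx1 : x < 1)
    (hw0 : 0 < w) (hw1 : w < 1) (hwR : w⁻¹ < R) :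
    IsLocalizedPair (toep (fourierCoef (posPartLaurent L))) (toep (fourierCoef (negPartLaurent L)))
      w x := by
  have hx0 : 0 < x := h.nonneg.trans_lt hrx
  have hxR : x < R := hx1.trans h.one_lt
  have hrw : r < w⁻¹ := h.lt_one.trans (one_lt_inv₀ hw0 |>.2 hw1)
  have hp := norm_posCoef_le (fourierCoef L)
  have hq := norm_negCoef_le (fourierCoef L)
  have hps := h.summable_norm_of_norm_le hp
  have hqs := h.summable_norm_of_norm_le hq
  have hpx := h.summable_of_norm_le hp x hrx hxR
  have hpw := h.summable_of_norm_le hp _ hrw hwR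
  have hqx := h.summable_of_norm_le hq x hrx hxR
  have hqw := h.summable_of_norm_le hq _ hrw hwR
  have hL := h.isLower_exp
  have hU := h.isUpper_exp
  rw [h.fourierCoef_posPart] at hL ⊢
  rw [h.fourierCoef_negPart] at hU ⊢
  refine ⟨hw0.le, hw1, hx0.le, hx1, ?_, ?_, ?_, ?_, ?_, hL, hU⟩
  · refine exists_toep_commutator hw0 hw1.le hx0 hx1.le hqs hps hqx (by simpa using hpw)
      (fun n hn => ?_) fun n hn => ?_
    · rw [negCoef, if_neg (by omega)]
    · rw [posCoef, if_neg (by omega)]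
  · exact exists_toep_mul_powDiag hw0 hw1.le hps hpw
  · exact exists_powDiag_mul_toep hx0 hx1.le hps hpx
  · exact exists_toep_mul_powDiag hw0 hw1.le hqs hqw
  · exact exists_powDiag_mul_toep hx0 hx1.le hqs hqx

end HasLaurentDecay

/-- The logarithm of a function with winding number zero, analytic and nonvanishing on an annulus,
has Laurent decay. -/
lemma HasWindingNumber.hasLaurentDecay_circleLog {φ : ℂ → ℂ} {r R : ℝ} (hr : 0 ≤ r) (hr1 : r < 1)
    (hR1 : 1 < R) (hφ : DifferentiableOn ℂ φ (realAnnulus r R))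
    (hφ0 : ∀ z ∈ realAnnulus r R, φ z ≠ 0) (hw : HasWindingNumber φ 0) :
    HasLaurentDecay (circleLog φ) r R :=
  ⟨hw.isCircleLog_circleLog.1, hr, hr1, hR1, fun _ hrt htR =>
    hw.isCircleLog_circleLog.summable_norm_fourierCoef hr hr1 hR1 hφ hφ0 hrt htR⟩

/-! ### Geometric rates for finite sections and Toeplitz determinants -/

section

variable {φ ψ : ℂ → ℂ} {r R w x : ℝ}

lemma HasLaurentDecay.toeplitzOp_eq (h : HasLaurentDecay (circleLog φ) r R)
    (hl : IsCircleLog φ (circleLog φ)) :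
    toeplitzOp φ = szegoG φ • (NormedSpace.exp (toep (fourierCoef (negPartLaurent (circleLog φ)))) *
      NormedSpace.exp (toep (fourierCoef (posPartLaurent (circleLog φ))))) :=
  (h.isWiener_of_exp_eq hl.2).toeplitzOp_eq.trans (h.toep_eq hl.2)

/-- Besides being Wiener, `ψ` enters only through `T(ψ) D = D l`, that is, through decay on the
circle of radius `1/w`. This is why only its outer radius affects the rate. -/
lemma HasLaurentDecay.eventually_norm_finF_sub_le (h : HasLaurentDecay (circleLog φ) r R)
    (hl : IsCircleLog φ (circleLog φ)) (hrx : r < x) (hx1 : x < 1) (hw0 : 0 < w) (hw1 : w < 1)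
    (hwR : w⁻¹ < R) (hψ : IsWiener ψ)
    (hψw : Summable fun n : ℤ => ‖fourierCoef ψ n‖ * w⁻¹ ^ n) :
    ∃ C, ∀ᶠ N in atTop, IsUnit (toeplitzMatrix φ N) ∧
      ‖finF φ ψ N - limF φ ψ‖ ≤ C * (x * w) ^ N := by
  have hφ := h.isWiener_of_exp_eq hl.2
  obtain ⟨l, hS⟩ := exists_toep_mul_powDiag hw0 hw1.le hψ.summable hψw
  have := (h.isLocalizedPair hrx hx1 hw0 hw1 hwR).exists_finiteSection_rate
    (g := szegoG φ) (Complex.exp_ne_zero _) hS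
  simpa only [finF, limF, hφ.toeplitzMatrix_eq, hψ.toeplitzMatrix_eq, ← hφ.toeplitzOp_eq,
    hψ.toeplitzOp_eq, ← h.toeplitzOp_eq hl] using this

/-- Szegő's strong limit theorem. -/
lemma HasLaurentDecay.tendsto_det_toeplitzMatrix (h : HasLaurentDecay (circleLog φ) r R)
    (hl : IsCircleLog φ (circleLog φ)) :
    Tendsto (fun N => (toeplitzMatrix φ N).det / szegoG φ ^ N) atTop (𝓝 (szegoE φ)) := by
  obtain ⟨x, hrx, hx1⟩ := exists_between h.lt_one
  obtain ⟨t, ht1, htR⟩ := exists_between h.one_lt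
  have ht0 : 0 < t := one_pos.trans ht1
  have hpair := h.isLocalizedPair (w := t⁻¹) hrx hx1 (inv_pos.2 ht0) (inv_lt_one_of_one_lt₀ ht1)
    (by rwa [inv_inv])
  have hφ := h.isWiener_of_exp_eq hl.2
  refine (hpair.tendsto_det_corner_expCommutator_one h.tendsto_trace_corner).congr fun N => ?_
  have h1 := h.det_corner_exp_posPart 1 N
  have h2 := h.det_corner_exp_negPart 1 N
  rw [one_smul] at h1 h2
  rw [hφ.toeplitzMatrix_eq, ← hφ.toeplitzOp_eq, h.toeplitzOp_eq hl,
    hpair.det_corner_exp_mul_exp _ h1 h2]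
  exact (mul_div_cancel_left₀ _ (pow_ne_zero N (Complex.exp_ne_zero _))).symm

lemma HasLaurentDecay.isBigO_det_toeplitzMatrix (h : HasLaurentDecay (circleLog φ) r R)
    (hl : IsCircleLog φ (circleLog φ)) (hrx : r < x) (hx1 : x < 1) (hw0 : 0 < w) (hw1 : w < 1)
    (hwR : w⁻¹ < R) :
    (fun N => (toeplitzMatrix φ N).det / szegoG φ ^ N - szegoE φ) =O[atTop]
      fun N => (x * w) ^ N := by
  have hx0 : 0 < x := h.nonneg.trans_lt hrx
  have hφ := h.isWiener_of_exp_eq hl.2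
  have hG : szegoG φ ≠ 0 := Complex.exp_ne_zero _
  have hxw : x * w < 1 := mul_lt_one_of_nonneg_of_lt_one_left hx0.le hx1 hw1.le
  -- The choice `S = 1` turns the finite section estimate into one for the entry `(T_N(φ)⁻¹)_{00}`.
  obtain ⟨C, hC⟩ := (h.isLocalizedPair hrx hx1 hw0 hw1 hwR).exists_finiteSection_rate
    (g := szegoG φ) hG (S := 1) (l := 1) (by rw [one_mul, mul_one])
  rw [← h.toeplitzOp_eq hl, hφ.toeplitzOp_eq] at hC
  simp only [← hφ.toeplitzMatrix_eq, corner_one, Matrix.one_mulVec] at hC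
  replace hC := (tendsto_add_atTop_nat 1).eventually hC
  simp only [finE0_dotProduct_mulVec_finE0] at hC
  set l := Ring.inverse (toep (fourierCoef φ)) ((1 : EllTwo →L[ℂ] EllTwo) (ellE 0)) 0
  refine exists_norm_sub_le_of_ratio (a := fun N => szegoG φ * (toeplitzMatrix φ (N + 1))⁻¹ 0 0)
    (l := szegoG φ * l) (C := ‖szegoG φ‖ * (C * (x * w))) (mul_pos hx0 hw0) hxw
    (h.tendsto_det_toeplitzMatrix hl) (Complex.exp_ne_zero _) ?_ ?_
  · filter_upwards [hC] with N hN
    rw [← toeplitzMatrix_submatrix_succ φ N, ← inv_zero_zero_mul_det hN.1, pow_succ]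
    field_simp
  · filter_upwards [hC] with N hN
    rw [← mul_sub, norm_mul, mul_assoc]
    gcongr
    refine hN.2.trans (le_of_eq ?_)
    rw [pow_succ]
    ring

end

/-! ### Choice of radii -/

lemma realAnnulus_subset_annulus {a b : ℝ≥0∞} (ha : a < 1) {s : ℝ} (hs : 0 < s)
    (hb : b⁻¹ < ENNReal.ofReal s) : realAnnulus a.toReal s⁻¹ ⊆ annulus a b := by
  intro z hz
  have hz0 : ‖z‖ₑ = ENNReal.ofReal ‖z‖ := (ofReal_norm z).symm
  constructor
  · rw [hz0]
    exact (ENNReal.lt_ofReal_iff_toReal_lt (ha.trans ENNReal.one_lt_top).ne).2 hz.1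
  · rw [hz0]
    refine lt_of_le_of_lt (ENNReal.ofReal_le_ofReal hz.2.le) ?_
    rw [ENNReal.ofReal_inv_of_pos hs]
    exact ENNReal.inv_lt_iff_inv_lt.1 hb

/-- For small `t > 0` take `x = a + t`, `w = m + t` and `s = m + t/2`. Then `1/w` lies strictly
inside the radius `1/s`, which in turn lies inside the annuli of analyticity. -/
lemma exists_weights {a m : ℝ≥0∞} {κ : ℝ≥0} (ha : a < 1) (hm : m < 1) (h : a * m < κ) :
    ∃ x w s : ℝ, a.toReal < x ∧ x < 1 ∧ 0 < s ∧ s < w ∧ w < 1 ∧ m < ENNReal.ofReal s ∧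
      x * w ≤ κ := by
  have ha' := (ha.trans ENNReal.one_lt_top).ne
  have hm' := (hm.trans ENNReal.one_lt_top).ne
  have ha1 : a.toReal < 1 := by simpa using ENNReal.toReal_strict_mono ENNReal.one_ne_top ha
  have hm1 : m.toReal < 1 := by simpa using ENNReal.toReal_strict_mono ENNReal.one_ne_top hm
  have hκ : a.toReal * m.toReal < κ := by
    rw [← ENNReal.toReal_mul]
    simpa using ENNReal.toReal_strict_mono ENNReal.coe_ne_top h
  have lim : ∀ {f : ℝ → ℝ} {c : ℝ}, Continuous f → f 0 < c → ∀ᶠ t in 𝓝[>] (0 : ℝ), f t < c :=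
    fun hf h0 => mem_nhdsWithin_of_mem_nhds ((isOpen_lt hf continuous_const).mem_nhds h0)
  have e1 := lim (f := fun t => a.toReal + t) (c := 1) (by fun_prop) (by simpa)
  have e2 := lim (f := fun t => m.toReal + t) (c := 1) (by fun_prop) (by simpa)
  have e3 := lim (f := fun t => (a.toReal + t) * (m.toReal + t)) (c := κ) (by fun_prop) (by simpa)
  obtain ⟨t, ⟨⟨h1, h2⟩, h3⟩, ht⟩ :=
    (((e1.and e2).and e3).and (self_mem_nhdsWithin (a := (0 : ℝ)))).exists
  have ht0 : 0 < t := ht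
  have hm0 : 0 ≤ m.toReal := ENNReal.toReal_nonneg
  refine ⟨a.toReal + t, m.toReal + t, m.toReal + t / 2, by linarith, h1, by linarith, by linarith,
    h2, ?_, h3.le⟩
  exact (ENNReal.lt_ofReal_iff_toReal_lt hm').2 (by linarith)

theorem corollary3p7 (φ ψ : ℂ → ℂ) (a₁ b₁ a₂ b₂ : ℝ≥0∞)
    (ha₁ : a₁ < 1) (hb₁ : 1 < b₁) (ha₂ : a₂ < 1) (hb₂ : 1 < b₂)
    (hφ : AnalyticOnNhd ℂ φ (annulus a₁ b₁)) (hφ0 : ∀ z ∈ annulus a₁ b₁, φ z ≠ 0)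
    (hw : HasWindingNumber φ 0)
    (hψ : AnalyticOnNhd ℂ ψ (annulus a₂ b₂)) :
    -- the quantities `F[φ;ψ]`, `G[φ]`, `E[φ]` are well defined
    (IsToeplitzOp φ (toeplitzOp φ) ∧ IsToeplitzOp ψ (toeplitzOp ψ) ∧ IsUnit (toeplitzOp φ) ∧
      IsCircleLog φ (circleLog φ) ∧ Summable (szegoTerm φ)) ∧
    -- so is `F_N[φ;ψ]` for all large `N`
    (∀ᶠ N : ℕ in atTop, IsUnit (toeplitzMatrix φ N)) ∧
    ∀ κ : ℝ≥0, a₁ * max b₁⁻¹ b₂⁻¹ < κ →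
      (∃ r : ℕ → ℂ, r =O[atTop] (fun N : ℕ => (κ : ℝ) ^ N) ∧
        ∀ N : ℕ, finF φ ψ N = limF φ ψ + r N) ∧
      (∃ s : ℕ → ℂ, s =O[atTop] (fun N : ℕ => (κ : ℝ) ^ N) ∧
        ∀ N : ℕ, 1 < N →
          borderedToeplitzDet φ ψ N = szegoG φ ^ N * szegoE φ * (limF φ ψ + s N)) := by
  have hl := hw.isCircleLog_circleLog
  have hG : szegoG φ ≠ 0 := Complex.exp_ne_zero _
  have hE : szegoE φ ≠ 0 := Complex.exp_ne_zero _
  have hm : max b₁⁻¹ b₂⁻¹ < 1 := max_lt (ENNReal.inv_lt_one.2 hb₁) (ENNReal.inv_lt_one.2 hb₂)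
  have hr1 : ∀ {a : ℝ≥0∞}, a < 1 → a.toReal < 1 := fun ha => by
    simpa using ENNReal.toReal_strict_mono ENNReal.one_ne_top ha
  have key : ∀ κ : ℝ≥0, a₁ * max b₁⁻¹ b₂⁻¹ < κ → ∃ r R x w : ℝ,
      HasLaurentDecay (circleLog φ) r R ∧ IsWiener ψ ∧
      (∃ C, ∀ᶠ N in atTop, IsUnit (toeplitzMatrix φ N) ∧
        ‖finF φ ψ N - limF φ ψ‖ ≤ C * (x * w) ^ N) ∧
      ((fun N => (toeplitzMatrix φ N).det / szegoG φ ^ N - szegoE φ) =O[atTop]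
        fun N => (x * w) ^ N) ∧ 0 < x * w ∧ x * w < 1 ∧ x * w ≤ κ := by
    intro κ hκ
    obtain ⟨x, w, s, hax, hx1, hs0, hsw, hw1, hms, hxw⟩ := exists_weights ha₁ hm hκ
    have hs1 : 1 < s⁻¹ := (one_lt_inv₀ hs0).2 (hsw.trans hw1)
    have hw0 := hs0.trans hsw
    have hws : w⁻¹ < s⁻¹ := inv_strictAnti₀ hs0 hsw
    have hsub₁ := realAnnulus_subset_annulus ha₁ hs0 ((le_max_left _ _).trans_lt hms)
    have hsub₂ := realAnnulus_subset_annulus ha₂ hs0 ((le_max_right _ _).trans_lt hms)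
    have h := hw.hasLaurentDecay_circleLog ENNReal.toReal_nonneg (hr1 ha₁) hs1
      (hφ.differentiableOn.mono hsub₁) fun z hz => hφ0 z (hsub₁ hz)
    have hψd := hψ.differentiableOn.mono hsub₂
    have hψW := hψd.isWiener ENNReal.toReal_nonneg (hr1 ha₂) hs1
    have hψw := summable_norm_fourierCoef_mul_zpow ENNReal.toReal_nonneg (hr1 ha₂) hs1 hψd
      ((hr1 ha₂).trans ((one_lt_inv₀ hw0).2 hw1)) hws
    have hx0 : 0 < x := ENNReal.toReal_nonneg.trans_lt hax
    exact ⟨_, _, x, w, h, hψW, h.eventually_norm_finF_sub_le hl hax hx1 hw0 hw1 hws hψW hψw,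
      h.isBigO_det_toeplitzMatrix hl hax hx1 hw0 hw1 hws, mul_pos hx0 hw0,
      mul_lt_one_of_nonneg_of_lt_one_left hx0.le hx1 hw1.le, hxw⟩
  -- The qualitative claims need only some admissible pair of weights, and `κ = 1` always qualifies.
  obtain ⟨r, R, x, w, h, hψW, ⟨C, hC⟩, -⟩ := key 1 (by
    rw [ENNReal.coe_one]
    exact lt_of_le_of_lt (mul_le_of_le_one_right' hm.le) ha₁)
  refine ⟨⟨(h.isWiener_of_exp_eq hl.2).isToeplitzOp_toeplitzOp, hψW.isToeplitzOp_toeplitzOp, ?_, hl,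
    h.summable_szego_terms⟩, hC.mono fun N hN => hN.1, fun κ hκ => ?_⟩
  · rw [h.toeplitzOp_eq hl]
    exact (inverse_smul_exp_mul_exp _ _ hG).1
  obtain ⟨r, R, x, w, -, -, ⟨C, hC⟩, hdet, hxw0, hxw1, hxw⟩ := key κ hκ
  have hpow : (fun N : ℕ => (x * w) ^ N) =O[atTop] fun N : ℕ => (κ : ℝ) ^ N :=
    IsBigO.of_norm_le fun N => by
      rw [norm_pow, Real.norm_of_nonneg hxw0.le]
      gcongr
  have hF : (fun N => finF φ ψ N - limF φ ψ) =O[atTop] fun N => (x * w) ^ N := by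
    refine IsBigO.of_bound C ?_
    filter_upwards [hC] with N hN
    rw [norm_pow, Real.norm_of_nonneg hxw0.le]
    exact hN.2
  have hFb : (fun N => finF φ ψ N) =O[atTop] fun _ => (1 : ℝ) := by
    have h1 : (fun N : ℕ => (x * w) ^ N) =O[atTop] fun _ => (1 : ℝ) :=
      IsBigO.of_norm_le fun N => by
        rw [norm_pow, Real.norm_of_nonneg hxw0.le]
        exact pow_le_one₀ hxw0.le hxw1.le
    simpa using (hF.trans h1).add (isBigO_const_const (limF φ ψ) one_ne_zero atTop)
  -- Both remainders are defined by solving the required identities. These then hold also for those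
  -- `N` for which `T_N(φ)` is singular, because `G` and `E` do not vanish.
  refine ⟨⟨fun N => finF φ ψ N - limF φ ψ, hF.trans hpow, fun N => (add_sub_cancel _ _).symm⟩,
    fun N => borderedToeplitzDet φ ψ N / (szegoG φ ^ N * szegoE φ) - limF φ ψ, ?_, fun N _ => ?_⟩
  -- With `d_N = det T_N(φ) / G^N`, the remainder is eventually `E⁻¹ (d_N - E) F_N + (F_N - F)`, and
  -- `F_N` is bounded.
  · have h1 := ((hdet.mul hFb).const_mul_left (szegoE φ)⁻¹).add (by simpa using hF)
    refine IsBigO.trans (h1.congr' ?_ EventuallyEq.rfl) (by simpa using hpow)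
    filter_upwards [hC, eventually_ge_atTop 1] with N hN hN1
    rw [borderedToeplitzDet_eq hN1 hN.1]
    field_simp
    ring
  · rw [add_sub_cancel, mul_div_cancel₀ _ (mul_ne_zero (pow_ne_zero N hG) hE)]

end
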